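/- **Setting and notation.** On $\mathbb R^3$ with Cartesian coordinates, $r=|x|$, let $e$ be the Euclidean metric. For $k\in\mathbb N$, $\rho\in\mathbb R$, $H^k_\rho$ is the completion of $C_c^\infty(\mathbb R^3)$ for the norm $\sum_{|\alpha|\le k}\|(1+r)^{-\rho-\frac32+|\alpha|}\nabla^\alpha u\|_{L^2}$ (componentwise for tensors); derivatives are weak derivatives and functions are identified when they agree a.e. A TT tensor is a symmetric 2-tensor which is traceless and divergence free with respect to $e$. For a vector field $X$, $(L_eX)_{ij}=\partial_iX_j+\partial_jX_i-(\mathrm{div}X)\delta_{ij}$. A pair $(g,\pi)$ is a solution of the constraint equations on $\mathbb R^3$ if $g$ is a (continuous, everywhere positive definite) Riemannian metric with components in $H^2_{loc}$, $\pi$ is a symmetric 2-tensor with components in $H^1_{loc}$, and $$R(g)+\tfrac12(\mathrm{tr}_g\pi)^2-|\pi|_g^2=0,\qquad \mathrm{div}_g\pi=0\qquad\text{a.e.}$$ Fix a smooth $\chi:\mathbb R_+\to[0,1]$ with $\chi(r)=0$ for $r\le1$ and $\chi(r)=1$ for $r\ge2$. *Kerr data.* Let $\vec p=(m,y,a,v)$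 with $m\ge0$, $y,a\in\mathbb R^3$, $v\in\mathbb R^3$, $|v|<1$. In Kerr–Schild coordinates $(t,x^1,x^2,x^3)$ let $$\mathbf g_{m,|a|}=\mathbf m+\frac{2m\tilde r^3}{\tilde r^4+|a|^2(x^3)^2}\,k\otimes k,\qquad k=\Big(1,\tfrac{\tilde rx^1+|a|x^2}{\tilde r^2+|a|^2},\tfrac{\tilde rx^2-|a|x^1}{\tilde r^2+|a|^2},\tfrac{x^3}{\tilde r}\Big),$$ where $\mathbf m$ is the Minkowski metric and $\tilde r>0$ solves $\frac{(x^1)^2+(x^2)^2}{\tilde r^2+|a|^2}+\frac{(x^3)^2}{\tilde r^2}=1$. Let $x'=\Lambda(Rx+y)$, where $R$ is a spatial rotation with $R\partial_3=a/|a|$ ($R=\mathrm{Id}$ if $a=0$), $y$ is a spatial translation and $\Lambda$ is the Lorentz boost of velocity $v$, so that $(x')^0=\gamma(x^0-v\cdot x)$ for $y=0$, $R=\mathrm{Id}$, $\gamma=(1-|v|^2)^{-1/2}$. Then $g_{\vec p}$ is the metric induced by $\mathbf g_{m,|a|}$ on $\{(x')^0=0\}$, in the coordinates $(x')^i$, and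 $\pi_{\vec p}=\kappa-(\mathrm{tr}_{g_{\vec p}}\kappa)g_{\vec p}$ with $\kappa=-\frac12\mathcal L_T\mathbf g_{m,|a|}$, $T$ the future-directed unit normal. Set $\chi_{\vec p}(r)=\chi(r/\lambda)$ with $\lambda=\max(2|y|,2|a|,3)$; $\chi_{\vec p}(g_{\vec p}-e)$ and $\chi_{\vec p}\pi_{\vec p}$ are smooth on $\mathbb R^3$. *Correctors.* Let $q\ge3$ and let $w_{j,\ell}=r^{j-1}Y_{j-1,\ell}$, with $Y_{n,\ell}$ the real spherical harmonics normalised by $\int_{\mathbb S^2}Y_{n,\ell}^2=4\pi$. Let $D\mathcal H^*(f)=-(\Delta f)e+\mathrm{Hess}f$ and $D\mathcal M^*(Z)_{ij}=-\frac12(\partial_iZ_j+\partial_jZ_i)$, and let $\langle\cdot,\cdot\rangle$ be the $L^2$ pairing. Let $\mathcal Z_q$ consist of the vector fields $x^a\partial_b+x^b\partial_a$ ($1\le a\le b\le3$) and $w_{j,\ell}\partial_k$ ($3\le j\le q$, $|\ell|\le j-1$, $1\le k\le3$). Let $(h_{j,\ell})_{3\le j\le q,|\ell|\le j-1}$ and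 $(\varpi_Z)_{Z\in\mathcal Z_q}$ be any families of smooth symmetric 2-tensors supported in $\{1\le r\le10\}$ such that the $h_{j,\ell}$ are traceless, the matrices $(\langle h_{j,\ell},D\mathcal H^*(w_{j',\ell'})\rangle)$ and $(\langle\varpi_Z,D\mathcal M^*(Z')\rangle)$ are invertible, the 1-forms $\mathrm{div}\,h_{j,\ell}$ are linearly independent, and the functions $(\Delta\mathrm{tr}+\mathrm{div}\,\mathrm{div})\varpi_Z$ are linearly independent. Put $\mathcal A_q=\mathrm{Span}(h_{j,\ell})$ and $\mathcal B_q=\mathrm{Span}(\varpi_Z)$. **Proposition (Uniqueness).** Let $q\ge3$, $0<\delta<1$, and let $(g,\pi)$ be a solution of the constraint equations on $\mathbb R^3$. Assume that for $i=1,2$ there are $\vec p_i=(m_i,y_i,a_i,v_i)$ as above, TT tensors $\check g_i,\check\pi_i\in H^2_{-q-\delta}$, correctors $(\breve g_i,\breve\pi_i)\in\mathcal A_q\times\mathcal B_q$, and $u_i-1\in H^2_{-q-\delta}$, $X_i\in H^2_{-q-\delta}$ such that $$g=u_i^4\big(e+\chi_{\vec p_i}(g_{\vec p_i}-e)+\check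 g_i+\breve g_i\big),\qquad \pi=\chi_{\vec p_i}\pi_{\vec p_i}+\check\pi_i+\breve\pi_i+L_eX_i .$$ Then $m_1=m_2$, $\check g_1=\check g_2$, $\check\pi_1=\check\pi_2$, $\breve g_1=\breve g_2$, $\breve\pi_1=\breve\pi_2$, $u_1=u_2$, $X_1=X_2$, and, if $m_1>0$, also $\vec p_1=\vec p_2$. (If the common mass is $0$, then $g_{\vec p_i}=e$ and $\pi_{\vec p_i}=0$ whatever $y_i,a_i,v_i$ are.) -/

import Mathlib

open MeasureTheory Filter Topology
open scoped ContDiff Matrix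

noncomputable section

/-! ### Function spaces on `ℝ³` -/

abbrev R3 : Type := EuclideanSpace ℝ (Fin 3)

/-- A 2-tensor field on `ℝ³`, given by its Cartesian components. -/
abbrev TensorField : Type := R3 → Matrix (Fin 3) (Fin 3) ℝ

/-- A vector field on `ℝ³`, given by its Cartesian components. -/
abbrev VecField : Type := R3 → Fin 3 → ℝ

/-- Smooth compactly supported functions. -/
def IsTest (φ : R3 → ℝ) : Prop := ContDiff ℝ ∞ φ ∧ HasCompactSupport φ

/-- Classical partial derivative `∂ᵢ f`. -/
def pd (i : Fin 3) (f : R3 → ℝ) : R3 → ℝ :=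
  fun x => fderiv ℝ f x (EuclideanSpace.single i 1)

/-- Iterated classical partial derivative along a list of coordinate directions. -/
def pdList : List (Fin 3) → (R3 → ℝ) → R3 → ℝ
  | [], f => f
  | i :: l, f => pd i (pdList l f)

/-- The weight `(1 + r) ^ (-ρ - 3/2 + k)`. -/
def sobolevWeight (ρ : ℝ) (k : ℕ) (x : R3) : ℝ := (1 + ‖x‖) ^ (-ρ - 3 / 2 + (k : ℝ))

/-- `f ∈ H^k_ρ`: `f` is an element of the completion of the smooth compactly supported functions for
the norm `∑_{|α| ≤ k} ‖(1+r)^{-ρ-3/2+|α|} ∇^α u‖_{L²}`. The completion is realised by functions: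
there is a sequence of test functions all of whose derivatives of order `≤ k` converge in the
weighted `L²` spaces, and whose limit is `f` almost everywhere. -/
def MemH (k : ℕ) (ρ : ℝ) (f : R3 → ℝ) : Prop :=
  ∃ (φ : ℕ → R3 → ℝ) (F : List (Fin 3) → R3 → ℝ),
    (∀ n, IsTest (φ n)) ∧ F [] =ᵐ[volume] f ∧
    ∀ l : List (Fin 3), l.length ≤ k →
      MemLp (fun x => sobolevWeight ρ l.length x * F l x) 2 volume ∧
      Tendsto (fun n => eLpNorm
        (fun x => sobolevWeight ρ l.length x * (pdList l (φ n) x - F l x)) 2 volume)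
        atTop (𝓝 0)

/-- `f ∈ H^k_loc`. -/
def MemHloc (k : ℕ) (f : R3 → ℝ) : Prop :=
  ∀ ζ : R3 → ℝ, IsTest ζ → MemH k 0 (fun x => ζ x * f x)

/-- `f'` is the weak partial derivative `∂ᵢ f`. -/
def IsWeakDeriv (i : Fin 3) (f f' : R3 → ℝ) : Prop :=
  LocallyIntegrable f volume ∧ LocallyIntegrable f' volume ∧
    ∀ φ : R3 → ℝ, IsTest φ → ∫ x, f x * pd i φ x = - ∫ x, f' x * φ x

open Classical in
/-- The weak partial derivative `∂ᵢ f` (unique up to null sets; `0` if there is none). -/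
def wd (i : Fin 3) (f : R3 → ℝ) : R3 → ℝ :=
  if H : ∃ f', IsWeakDeriv i f f' then H.choose else 0

/-! ### The constraint equations -/

/-- Christoffel symbols `Γᵏᵢⱼ` of the metric `g`. -/
def christoffel (g : TensorField) (k i j : Fin 3) (x : R3) : ℝ :=
  1 / 2 * ∑ l, (g x)⁻¹ k l *
    (wd i (fun z => g z j l) x + wd j (fun z => g z i l) x - wd l (fun z => g z i j) x)

/-- Ricci curvature `∂ₖΓᵏᵢⱼ - ∂ⱼΓᵏᵢₖ + ΓᵏₖₗΓˡᵢⱼ - ΓᵏⱼₗΓˡᵢₖ`. -/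
def ricci (g : TensorField) (i j : Fin 3) (x : R3) : ℝ :=
  ∑ k, (wd k (christoffel g k i j) x - wd j (christoffel g k i k) x) +
    ∑ k, ∑ l, (christoffel g k k l x * christoffel g l i j x
      - christoffel g k j l x * christoffel g l i k x)

/-- Scalar curvature `R(g)`. -/
def scalarCurv (g : TensorField) (x : R3) : ℝ := ∑ i, ∑ j, (g x)⁻¹ i j * ricci g i j x

/-- `tr_g π`. -/
def trG (g π : TensorField) (x : R3) : ℝ := ∑ i, ∑ j, (g x)⁻¹ i j * π x i j

/-- `|π|²_g = gⁱʲ gᵃᵇ πᵢₐ πⱼᵦ`. -/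
def normSqG (g π : TensorField) (x : R3) : ℝ :=
  ∑ i, ∑ j, ∑ a, ∑ b, (g x)⁻¹ i j * (g x)⁻¹ a b * π x i a * π x j b

/-- `(div_g π)_l = gⁱʲ Dᵢ πⱼₗ`. -/
def divG (g π : TensorField) (l : Fin 3) (x : R3) : ℝ :=
  ∑ i, ∑ j, (g x)⁻¹ i j * (wd i (fun z => π z j l) x
    - ∑ k, christoffel g k i j x * π x k l - ∑ k, christoffel g k i l x * π x j k)

/-- `(g, π)` is a solution of the constraint equations on `ℝ³` at the regularity `H² × H¹`:
`g` is a (continuous, everywhere positive definite) Riemannian metric, `π` is a symmetric 2-tensor,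
and `R(g) + (tr_g π)²/2 - |π|²_g = 0`, `div_g π = 0` hold almost everywhere. (Functions in `H²_loc`
have a continuous representative in dimension three; `g` is that representative.) -/
structure IsConstraintSolution (g π : TensorField) : Prop where
  continuous : Continuous g
  posDef : ∀ x, (g x).PosDef
  memH_g : ∀ i j, MemHloc 2 (fun x => g x i j)
  symm : ∀ᵐ x, (π x).IsSymm
  memH_pi : ∀ i j, MemHloc 1 (fun x => π x i j)
  hamiltonian : ∀ᵐ x, scalarCurv g x + 1 / 2 * trG g π x ^ 2 - normSqG g π x = 0
  momentum : ∀ᵐ x, ∀ l, divG g π l x = 0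

/-- `T` is a symmetric 2-tensor, traceless and divergence free for the Euclidean metric. -/
structure IsTT (T : TensorField) : Prop where
  symm : ∀ᵐ x, (T x).IsSymm
  trace : ∀ᵐ x, (T x).trace = 0
  div : ∀ᵐ x, ∀ i, ∑ j, wd j (fun z => T z j i) x = 0

/-- `L_e X = ℒ_X e - (div X) e`. -/
def Le (X : VecField) : TensorField := fun x => Matrix.of fun i j =>
  wd i (fun z => X z j) x + wd j (fun z => X z i) x
    - (∑ k, wd k (fun z => X z k) x) * (1 : Matrix (Fin 3) (Fin 3) ℝ) i j

/-! ### The spaces of correctors -/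

/-- The function `w_{j,ℓ} = r^{j-1} Y_{j-1,ℓ}`, where `Y_{n,ℓ}` are the real spherical harmonics with
`∫_{𝕊²} Y_{n,ℓ}² = 4π`. With `n = j - 1`, `m = |ℓ|` and `P_n` the Legendre polynomial (Rodrigues'
formula) this is `c r^{n-m} P_n^{(m)}(x³/r)` times the real part (`ℓ ≥ 0`) or the imaginary part
(`ℓ < 0`) of `(x¹ + i x²)^m`. -/
def solidHarmonic (j : ℕ) (ℓ : ℤ) (x : R3) : ℝ :=
  let n : ℕ := j - 1
  let m : ℕ := ℓ.natAbs
  let P : Polynomial ℝ := Polynomial.C (1 / (2 ^ n * (n.factorial : ℝ))) *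
    Polynomial.derivative^[n + m] ((Polynomial.X ^ 2 - 1) ^ n)
  let c : ℝ := Real.sqrt ((if ℓ = 0 then 1 else 2) * (2 * (n : ℝ) + 1) *
    ((n - m).factorial : ℝ) / ((n + m).factorial : ℝ))
  let ζ : ℂ := ((x 0 : ℂ) + (x 1 : ℂ) * Complex.I) ^ m
  c * ‖x‖ ^ (n - m) * P.eval (x 2 / ‖x‖) * (if 0 ≤ ℓ then ζ.re else ζ.im)

/-- The pairs `(j, ℓ)` with `3 ≤ j ≤ q` and `-(j-1) ≤ ℓ ≤ j-1`. -/
abbrev IdxA (q : ℕ) : Type :=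
  {p : ℕ × ℤ // p ∈ (Finset.Icc 3 q ×ˢ Finset.Icc (-(q : ℤ)) q).filter
    (fun p => |p.2| ≤ (p.1 : ℤ) - 1)}

/-- The index set of `𝒵_q`: the pairs `a ≤ b` (for `Ω⁺_{ab}`) and the triples `(j, ℓ, k)` with
`3 ≤ j ≤ q` (for `W_{j,ℓ,k}`). -/
abbrev IdxB (q : ℕ) : Type := {ab : Fin 3 × Fin 3 // ab.1 ≤ ab.2} ⊕ (IdxA q × Fin 3)

/-- The vector fields of `𝒵_q`: `Ω⁺_{ab} = xᵃ ∂_b + xᵇ ∂_a` and `W_{j,ℓ,k} = w_{j,ℓ} ∂_k`. -/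
def zField (q : ℕ) : IdxB q → VecField
  | Sum.inl ab => fun x i =>
      (if i = ab.1.2 then x ab.1.1 else 0) + (if i = ab.1.1 then x ab.1.2 else 0)
  | Sum.inr jlk => fun x i =>
      if i = jlk.2 then solidHarmonic jlk.1.1.1 jlk.1.1.2 x else 0

/-- `Dℋ[e,0]^*(f) = -(Δ f) e + Hess f`. -/
def DHstar (f : R3 → ℝ) : TensorField := fun x => Matrix.of fun i j =>
  -(∑ k, pd k (pd k f) x) * (1 : Matrix (Fin 3) (Fin 3) ℝ) i j + pd i (pd j f) x

/-- `Dℳ[e,0]^*(Z) = -½ (∂ᵢ Zⱼ + ∂ⱼ Zᵢ)`. -/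
def DMstar (Z : VecField) : TensorField := fun x => Matrix.of fun i j =>
  -(1 / 2) * (pd i (fun z => Z z j) x + pd j (fun z => Z z i) x)

/-- The `L²` pairing `⟨S, T⟩` of 2-tensors. -/
def tensorPairing (S T : TensorField) : ℝ := ∫ x, ∑ i, ∑ j, S x i j * T x i j

/-- The (classical) divergence of a 2-tensor. -/
def divT (T : TensorField) : VecField := fun x i => ∑ j, pd j (fun z => T z j i) x

/-- `Δ tr T + div div T`. -/
def lapTrDivDiv (T : TensorField) (x : R3) : ℝ :=
  ∑ k, pd k (pd k (fun z => (T z).trace)) x + ∑ i, pd i (fun z => divT T z i) x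

/-- Smooth symmetric 2-tensors supported in `{1 ≤ r ≤ 10}`. -/
structure IsAnnularTensor (T : TensorField) : Prop where
  smooth : ∀ i j, ContDiff ℝ ∞ (fun x => T x i j)
  symm : ∀ x, (T x).IsSymm
  support : ∀ x, ¬ (1 ≤ ‖x‖ ∧ ‖x‖ ≤ 10) → T x = 0

/-- The families `(h_{j,ℓ})` of tensors that may be used to define `𝒜_q`. -/
structure IsMetricCorrectorFamily (q : ℕ) (h : IdxA q → TensorField) : Prop where
  annular : ∀ a, IsAnnularTensor (h a)
  trace : ∀ a x, (h a x).trace = 0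
  invertible : IsUnit (Matrix.of fun a b : IdxA q =>
    tensorPairing (h a) (DHstar (solidHarmonic b.1.1 b.1.2)))
  linInd : LinearIndependent ℝ (fun a => divT (h a))

/-- The families `(ϖ_Z)` of tensors that may be used to define `ℬ_q`. -/
structure IsMomentumCorrectorFamily (q : ℕ) (ϖ : IdxB q → TensorField) : Prop where
  annular : ∀ a, IsAnnularTensor (ϖ a)
  invertible : IsUnit (Matrix.of fun a b : IdxB q =>
    tensorPairing (ϖ a) (DMstar (zField q b)))
  linInd : LinearIndependent ℝ (fun a => lapTrDivDiv (ϖ a))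

/-- `𝒜_q = Span (h_{j,ℓ})` and `ℬ_q = Span (ϖ_Z)`. -/
def correctorSpace {ι : Type} (h : ι → TensorField) : Submodule ℝ TensorField :=
  Submodule.span ℝ (Set.range h)

/-! ### Kerr initial data sets -/

abbrev Spacetime : Type := Fin 4 → ℝ

/-- The Minkowski metric. -/
def minkowski : Matrix (Fin 4) (Fin 4) ℝ := Matrix.diagonal ![-1, 1, 1, 1]

/-- The function `r̃` of the Kerr-Schild coordinates, see `ksRadius_spec`. -/
def ksRadius (α : ℝ) (x : Spacetime) : ℝ :=
  let s : ℝ := x 1 ^ 2 + x 2 ^ 2 + x 3 ^ 2 - α ^ 2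
  Real.sqrt ((s + Real.sqrt (s ^ 2 + 4 * α ^ 2 * x 3 ^ 2)) / 2)

/-- The implicit definition of `r̃`. -/
theorem ksRadius_spec (α : ℝ) (x : Spacetime) (h : 0 < ksRadius α x) :
    (x 1 ^ 2 + x 2 ^ 2) / (ksRadius α x ^ 2 + α ^ 2) + x 3 ^ 2 / ksRadius α x ^ 2 = 1 := by
  set s : ℝ := x 1 ^ 2 + x 2 ^ 2 + x 3 ^ 2 - α ^ 2 with hs
  set D : ℝ := Real.sqrt (s ^ 2 + 4 * α ^ 2 * x 3 ^ 2) with hD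
  have hDsq : D ^ 2 = s ^ 2 + 4 * α ^ 2 * x 3 ^ 2 := Real.sq_sqrt (by positivity)
  have hr : ksRadius α x = Real.sqrt ((s + D) / 2) := rfl
  have hpos : 0 < (s + D) / 2 := Real.sqrt_pos.mp (hr ▸ h)
  have hr2 : ksRadius α x ^ 2 = (s + D) / 2 := by rw [hr]; exact Real.sq_sqrt hpos.le
  rw [hr2]
  have h2 : (s + D) / 2 + α ^ 2 ≠ 0 := by positivity
  have h1 : (s + D) / 2 ≠ 0 := hpos.ne'
  rw [div_add_div _ _ h2 h1, div_eq_one_iff_eq (mul_ne_zero h2 h1)]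
  have hx : x 1 ^ 2 + x 2 ^ 2 = s + α ^ 2 - x 3 ^ 2 := by rw [hs]; ring
  rw [hx]
  nlinarith [hDsq]

/-- The 1-form `k` of the Kerr-Schild coordinates. -/
def ksForm (α : ℝ) (x : Spacetime) : Fin 4 → ℝ :=
  let r := ksRadius α x
  ![1, (r * x 1 + α * x 2) / (r ^ 2 + α ^ 2), (r * x 2 - α * x 1) / (r ^ 2 + α ^ 2), x 3 / r]

/-- The Kerr metric of mass `m` and angular momentum `α`, rotating around the `x³`-axis, in
Kerr-Schild coordinates. -/
def kerrMetric (m α : ℝ) (x : Spacetime) : Matrix (Fin 4) (Fin 4) ℝ :=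
  minkowski + (2 * m * ksRadius α x ^ 3 / (ksRadius α x ^ 4 + α ^ 2 * x 3 ^ 2)) •
    Matrix.vecMulVec (ksForm α x) (ksForm α x)

/-- A black hole parameter `(m, y, a, v)`. -/
@[ext] structure KerrParam where
  m : ℝ
  y : R3
  a : R3
  v : R3

def lorentzFactor (v : R3) : ℝ := 1 / Real.sqrt (1 - ‖v‖ ^ 2)

/-- The Lorentz boost `Λ` of relative velocity `|v|` in the direction `v / |v|`:
`x'⁰ = γ (x⁰ - v · x)`, `x' = x + (γ - 1) (v · x) v / |v|² - γ x⁰ v`.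
(Recall `(γ - 1) / |v|² = γ² / (1 + γ)`.) -/
def boost (v : R3) : Matrix (Fin 4) (Fin 4) ℝ :=
  let γ := lorentzFactor v
  let c := γ ^ 2 / (1 + γ)
  !![γ, -γ * v 0, -γ * v 1, -γ * v 2;
    -γ * v 0, 1 + c * v 0 * v 0, c * v 0 * v 1, c * v 0 * v 2;
    -γ * v 1, c * v 1 * v 0, 1 + c * v 1 * v 1, c * v 1 * v 2;
    -γ * v 2, c * v 2 * v 0, c * v 2 * v 1, 1 + c * v 2 * v 2]

theorem lorentzFactor_sq {v : R3} (hv : ‖v‖ < 1) :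
    lorentzFactor v ^ 2 * (1 - (v 0 ^ 2 + v 1 ^ 2 + v 2 ^ 2)) = 1 := by
  have h1 : 0 < 1 - ‖v‖ ^ 2 := by nlinarith [norm_nonneg v]
  have h2 : ‖v‖ ^ 2 = v 0 ^ 2 + v 1 ^ 2 + v 2 ^ 2 := by
    rw [EuclideanSpace.norm_sq_eq, Fin.sum_univ_three]; simp
  rw [lorentzFactor, div_pow, Real.sq_sqrt h1.le, ← h2]
  field_simp

theorem lorentzFactor_pos {v : R3} (hv : ‖v‖ < 1) : 0 < lorentzFactor v := by
  have h1 : 0 < 1 - ‖v‖ ^ 2 := by nlinarith [norm_nonneg v]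
  exact div_pos one_pos (Real.sqrt_pos.mpr h1)

/-- `Λ` is a Lorentz transformation. -/
theorem boost_minkowski {v : R3} (hv : ‖v‖ < 1) :
    (boost v)ᵀ * minkowski * boost v = minkowski := by
  have h := lorentzFactor_sq hv
  have hp := lorentzFactor_pos hv
  obtain ⟨c, hc⟩ : ∃ c, c = lorentzFactor v ^ 2 / (1 + lorentzFactor v) := ⟨_, rfl⟩
  have hc' : c * (1 + lorentzFactor v) = lorentzFactor v ^ 2 := by
    rw [hc]; field_simp
  have e : 2 * c - lorentzFactor v ^ 2 + c ^ 2 * (v 0 ^ 2 + v 1 ^ 2 + v 2 ^ 2) = 0 := by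
    have h1 : (1 + lorentzFactor v) ≠ 0 := by positivity
    have h2 : (1 + lorentzFactor v) ^ 2 *
      (2 * c - lorentzFactor v ^ 2 + c ^ 2 * (v 0 ^ 2 + v 1 ^ 2 + v 2 ^ 2)) = 0 := by
      linear_combination (2 * (1 + lorentzFactor v) + (v 0 ^ 2 + v 1 ^ 2 + v 2 ^ 2) *
        (c * (1 + lorentzFactor v) + lorentzFactor v ^ 2)) * hc' - lorentzFactor v ^ 2 * h
    exact (mul_eq_zero.mp h2).resolve_left (pow_ne_zero 2 h1)
  have e0 : lorentzFactor v * (1 + c * (v 0 ^ 2 + v 1 ^ 2 + v 2 ^ 2)) = lorentzFactor v ^ 2 := by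
    have h1 : (1 + lorentzFactor v) ≠ 0 := by positivity
    refine mul_left_cancel₀ h1 ?_
    linear_combination lorentzFactor v * (v 0 ^ 2 + v 1 ^ 2 + v 2 ^ 2) * hc' - lorentzFactor v * h
  simp only [boost, ← hc]
  clear hc
  generalize lorentzFactor v = γ at *
  ext i j
  fin_cases i <;> fin_cases j <;>
    simp [minkowski, Matrix.mul_apply, Fin.sum_univ_four, Matrix.diagonal_apply, Matrix.one_apply]
  · linear_combination -h
  · linear_combination (-v 0) * e0
  · linear_combination (-v 1) * e0
  · linear_combination (-v 2) * e0
  · linear_combination (-v 0) * e0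
  · linear_combination (v 0) ^ 2 * e
  · linear_combination (v 0) * (v 1) * e
  · linear_combination (v 0) * (v 2) * e
  · linear_combination (-v 1) * e0
  · linear_combination (v 0) * (v 1) * e
  · linear_combination (v 1) ^ 2 * e
  · linear_combination (v 2) * (v 1) * e
  · linear_combination (-v 2) * e0
  · linear_combination (v 0) * (v 2) * e
  · linear_combination (v 2) * (v 1) * e
  · linear_combination (v 2) ^ 2 * e

/-- `boost (-v)` is the inverse of `boost v`. -/
theorem boost_neg_mul {v : R3} (hv : ‖v‖ < 1) : boost (-v) * boost v = 1 := by
  have h1 : boost (-v) = minkowski * (boost v)ᵀ * minkowski := by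
    have hl : lorentzFactor (-v) = lorentzFactor v := by simp [lorentzFactor]
    ext i j
    fin_cases i <;> fin_cases j <;>
      simp [boost, hl, minkowski, Matrix.mul_apply, Fin.sum_univ_four, Matrix.diagonal_apply,
        Matrix.one_apply] <;> ring
  have h2 : minkowski * minkowski = 1 := by
    ext i j
    fin_cases i <;> fin_cases j <;> simp [minkowski]
  rw [h1, Matrix.mul_assoc, Matrix.mul_assoc, ← Matrix.mul_assoc (boost v)ᵀ, boost_minkowski hv, h2]

open Classical in
/-- A rotation `R` with `R ∂₃ = a / |a|`, the identity for `a = 0`: the half turn around the axis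
spanned by `w = ∂₃ + a / |a|` (by `w = ∂₁` if `a / |a| = -∂₃`). The Kerr metric being axisymmetric, the
choice of such a rotation is immaterial. -/
def axisRotation (a : R3) : Matrix (Fin 3) (Fin 3) ℝ :=
  if a = 0 then 1 else
    let n : Fin 3 → ℝ := fun i => a i / ‖a‖
    let w : Fin 3 → ℝ := if n = ![0, 0, -1] then ![1, 0, 0] else ![0, 0, 1] + n
    (2 / (w ⬝ᵥ w)) • Matrix.vecMulVec w w - 1

/-- `R` is orthogonal, with determinant one, and maps `|a| ∂₃` to `a`. -/
theorem axisRotation_spec (a : R3) : (axisRotation a)ᵀ * axisRotation a = 1 ∧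
    (axisRotation a).det = 1 ∧ axisRotation a *ᵥ ![0, 0, ‖a‖] = fun i => a i := by
  by_cases ha : a = 0
  · subst ha
    refine ⟨by simp [axisRotation], by simp [axisRotation], ?_⟩
    ext i; fin_cases i <;> simp [axisRotation]
  have hn : ‖a‖ ≠ 0 := norm_ne_zero_iff.mpr ha
  have hR : ∀ w : Fin 3 → ℝ, w ⬝ᵥ w ≠ 0 →
      ((2 / (w ⬝ᵥ w)) • Matrix.vecMulVec w w - 1)ᵀ * ((2 / (w ⬝ᵥ w)) • Matrix.vecMulVec w w - 1) = 1
      ∧ ((2 / (w ⬝ᵥ w)) • Matrix.vecMulVec w w - 1).det = 1 := by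
    intro w hw
    obtain ⟨t, ht⟩ : ∃ t, t = 2 / (w ⬝ᵥ w) := ⟨_, rfl⟩
    have ht' : t * (w 0 ^ 2 + w 1 ^ 2 + w 2 ^ 2) = 2 := by
      have : w 0 ^ 2 + w 1 ^ 2 + w 2 ^ 2 = w ⬝ᵥ w := by
        simp [dotProduct, Fin.sum_univ_three]; ring
      rw [this, ht]; field_simp
    rw [← ht]
    constructor
    · ext i j
      fin_cases i <;> fin_cases j <;>
        simp [Matrix.mul_apply, Fin.sum_univ_three, Matrix.vecMulVec_apply, Matrix.one_apply]
      · linear_combination t * w 0 * w 0 * ht'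
      · linear_combination t * w 0 * w 1 * ht'
      · linear_combination t * w 0 * w 2 * ht'
      · linear_combination t * w 1 * w 0 * ht'
      · linear_combination t * w 1 * w 1 * ht'
      · linear_combination t * w 1 * w 2 * ht'
      · linear_combination t * w 2 * w 0 * ht'
      · linear_combination t * w 2 * w 1 * ht'
      · linear_combination t * w 2 * w 2 * ht'
    · rw [Matrix.det_fin_three]
      simp [Matrix.vecMulVec_apply, Matrix.one_apply]
      linear_combination ht'
  obtain ⟨n, hnd⟩ : ∃ n : Fin 3 → ℝ, n = fun i => a i / ‖a‖ := ⟨_, rfl⟩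
  have han : ∀ i, a i = ‖a‖ * n i := by intro i; rw [hnd]; field_simp
  have hn1 : n 0 ^ 2 + n 1 ^ 2 + n 2 ^ 2 = 1 := by
    have h2 : ‖a‖ ^ 2 = a 0 ^ 2 + a 1 ^ 2 + a 2 ^ 2 := by
      rw [EuclideanSpace.norm_sq_eq, Fin.sum_univ_three]; simp
    rw [hnd]; field_simp; linarith
  by_cases hs : n = ![0, 0, -1]
  · have hd : axisRotation a = (2 / ((![1, 0, 0] : Fin 3 → ℝ) ⬝ᵥ ![1, 0, 0])) •
        Matrix.vecMulVec ![1, 0, 0] ![1, 0, 0] - 1 := by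
      simp only [axisRotation, if_neg ha, ← hnd, if_pos hs]
    rw [hd]
    refine ⟨(hR _ (by simp [dotProduct, Fin.sum_univ_three])).1,
      (hR _ (by simp [dotProduct, Fin.sum_univ_three])).2, ?_⟩
    ext i
    rw [han, hs]
    fin_cases i <;> simp [Matrix.mulVec, dotProduct, Fin.sum_univ_three, Matrix.vecMulVec_apply,
      Matrix.one_apply]
  · have hd : axisRotation a = (2 / ((![0, 0, 1] + n) ⬝ᵥ (![0, 0, 1] + n))) •
        Matrix.vecMulVec (![0, 0, 1] + n) (![0, 0, 1] + n) - 1 := by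
      simp only [axisRotation, if_neg ha, ← hnd, if_neg hs]
    have hww : (![0, 0, 1] + n) ⬝ᵥ (![0, 0, 1] + n) = 2 * (1 + n 2) := by
      simp [dotProduct, Fin.sum_univ_three]; linear_combination hn1
    have hw0 : 1 + n 2 ≠ 0 := by
      intro h0
      apply hs
      have h2 : n 2 = -1 := by linarith
      rw [h2] at hn1
      have h3 : n 0 = 0 := by nlinarith [sq_nonneg (n 0), sq_nonneg (n 1)]
      have h4 : n 1 = 0 := by nlinarith [sq_nonneg (n 0), sq_nonneg (n 1)]
      ext i; fin_cases i <;> simp [h2, h3, h4]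
    rw [hd]
    have hw : (![0, 0, 1] + n) ⬝ᵥ (![0, 0, 1] + n) ≠ 0 := by
      rw [hww]; exact mul_ne_zero two_ne_zero hw0
    refine ⟨(hR _ hw).1, (hR _ hw).2, ?_⟩
    ext i
    rw [han, hww]
    fin_cases i <;> simp [Matrix.mulVec, dotProduct, Fin.sum_univ_three, Matrix.vecMulVec_apply,
      Matrix.one_apply, Matrix.vecHead, Matrix.vecTail] <;> field_simp <;> ring

/-- The space-time matrix acting by `R` on space and by the identity on time. -/
def spaceMatrix (R : Matrix (Fin 3) (Fin 3) ℝ) : Matrix (Fin 4) (Fin 4) ℝ :=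
  !![1, 0, 0, 0; 0, R 0 0, R 0 1, R 0 2; 0, R 1 0, R 1 1, R 1 2; 0, R 2 0, R 2 1, R 2 2]

theorem spaceMatrix_mul (R S : Matrix (Fin 3) (Fin 3) ℝ) :
    spaceMatrix R * spaceMatrix S = spaceMatrix (R * S) := by
  ext i j
  fin_cases i <;> fin_cases j <;>
    simp [spaceMatrix, Matrix.mul_apply, Fin.sum_univ_four, Fin.sum_univ_three]

/-- The event of time coordinate `0` and space coordinates `x`. -/
def atTimeZero (x : R3) : Spacetime := Fin.cons 0 (fun i => x i)

/-- The coordinates `x' = Λ (R x + y)`. -/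
def kerrCoord (p : KerrParam) (x : Spacetime) : Spacetime :=
  boost p.v *ᵥ (spaceMatrix (axisRotation p.a) *ᵥ x + atTimeZero p.y)

/-- The Jacobian `∂x / ∂x' = R⁻¹ Λ⁻¹` of the inverse change of coordinates. -/
def kerrJacobian (p : KerrParam) : Matrix (Fin 4) (Fin 4) ℝ :=
  spaceMatrix (axisRotation p.a)ᵀ * boost (-p.v)

/-- The inverse change of coordinates `x = R⁻¹ (Λ⁻¹ x' - y)`. -/
def kerrCoordInv (p : KerrParam) (x' : Spacetime) : Spacetime :=
  spaceMatrix (axisRotation p.a)ᵀ *ᵥ (boost (-p.v) *ᵥ x' - atTimeZero p.y)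

theorem kerrCoordInv_kerrCoord {p : KerrParam} (hv : ‖p.v‖ < 1) (x : Spacetime) :
    kerrCoordInv p (kerrCoord p x) = x := by
  have h1 : spaceMatrix (1 : Matrix (Fin 3) (Fin 3) ℝ) = 1 := by
    ext i j
    fin_cases i <;> fin_cases j <;> simp [spaceMatrix, Matrix.one_apply]
  rw [kerrCoordInv, kerrCoord, Matrix.mulVec_mulVec, boost_neg_mul hv, Matrix.one_mulVec,
    add_sub_cancel_right, Matrix.mulVec_mulVec, spaceMatrix_mul, (axisRotation_spec p.a).1, h1,
    Matrix.one_mulVec]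

/-- The Kerr metric in the coordinates `x'`. -/
def kerrMetric' (p : KerrParam) (x' : Spacetime) : Matrix (Fin 4) (Fin 4) ℝ :=
  (kerrJacobian p)ᵀ * kerrMetric p.m ‖p.a‖ (kerrCoordInv p x') * kerrJacobian p

/-- The future-directed unit normal `T^μ = -g^{μ0} / √(-g^{00})` to the level sets of the first
coordinate, for a Lorentzian metric `G`. -/
def unitNormal (G : Spacetime → Matrix (Fin 4) (Fin 4) ℝ) (μ : Fin 4) (x : Spacetime) : ℝ :=
  -(G x)⁻¹ μ 0 / Real.sqrt (-(G x)⁻¹ 0 0)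

/-- Partial derivatives on space-time. -/
def pd4 (μ : Fin 4) (f : Spacetime → ℝ) (x : Spacetime) : ℝ := fderiv ℝ f x (Pi.single μ 1)

/-- The Lie derivative `ℒ_T G` of a 2-tensor:
`(ℒ_T G)_{μν} = T^σ ∂_σ G_{μν} + G_{σν} ∂_μ T^σ + G_{μσ} ∂_ν T^σ`. -/
def lieDeriv4 (T : Fin 4 → Spacetime → ℝ) (G : Spacetime → Matrix (Fin 4) (Fin 4) ℝ)
    (μ ν : Fin 4) (x : Spacetime) : ℝ :=
  ∑ σ, (T σ x * pd4 σ (fun z => G z μ ν) x + G x σ ν * pd4 μ (T σ) x + G x μ σ * pd4 ν (T σ) x)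

/-- The metric `g_p` induced by the Kerr metric on `{x'⁰ = 0}`. -/
def kerrG (p : KerrParam) : TensorField := fun x => Matrix.of fun i j =>
  kerrMetric' p (atTimeZero x) i.succ j.succ

/-- The second fundamental form `k = -½ ℒ_T 𝐠` of `{x'⁰ = 0}`. -/
def kerrK (p : KerrParam) : TensorField := fun x => Matrix.of fun i j =>
  -(1 / 2) * lieDeriv4 (unitNormal (kerrMetric' p)) (kerrMetric' p) i.succ j.succ (atTimeZero x)

/-- The reduced second fundamental form `π_p = k - (tr_g k) g`. -/
def kerrPi (p : KerrParam) : TensorField := fun x =>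
  kerrK p x - trG (kerrG p) (kerrK p) x • kerrG p x

/-- A smooth cutoff `χ : ℝ₊ → [0, 1]`, `χ(r) = 0` for `r ≤ 1` and `χ(r) = 1` for `r ≥ 2`
(extended by `0` to negative `r`). -/
structure IsCutoff (χ : ℝ → ℝ) : Prop where
  smooth : ContDiff ℝ ∞ χ
  mem_Icc : ∀ r, χ r ∈ Set.Icc (0 : ℝ) 1
  eq_zero : ∀ r, r ≤ 1 → χ r = 0
  eq_one : ∀ r, 2 ≤ r → χ r = 1

/-- `χ_p(r) = χ(r / λ)` with `λ = max (2|y|, 2|a|, 3)`. -/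
def chiP (χ : ℝ → ℝ) (p : KerrParam) (x : R3) : ℝ :=
  χ (‖x‖ / max (max (2 * ‖p.y‖) (2 * ‖p.a‖)) 3)

/-! ### Representations of a solution -/

/-- The data `(p, ǧ, π̌, ğ, π̆, u, X)`. -/
structure AnsatzData where
  p : KerrParam
  gTT : TensorField
  piTT : TensorField
  gCor : TensorField
  piCor : TensorField
  u : R3 → ℝ
  X : VecField

/-- The data `D` satisfy the membership requirements and represent `(g, π)`:
`g = u⁴ (e + χ_p (g_p - e) + ǧ + ğ)` and `π = χ_p π_p + π̌ + π̆ + L_e X`. -/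
structure Represents (q : ℕ) (δ : ℝ) (χ : ℝ → ℝ) (h : IdxA q → TensorField)
    (ϖ : IdxB q → TensorField) (D : AnsatzData) (g π : TensorField) : Prop where
  mass_nonneg : 0 ≤ D.p.m
  boost_lt : ‖D.p.v‖ < 1
  gTT_tt : IsTT D.gTT
  gTT_mem : ∀ i j, MemH 2 (-q - δ) (fun x => D.gTT x i j)
  piTT_tt : IsTT D.piTT
  piTT_mem : ∀ i j, MemH 2 (-q - δ) (fun x => D.piTT x i j)
  gCor_mem : D.gCor ∈ correctorSpace h
  piCor_mem : D.piCor ∈ correctorSpace ϖ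
  u_mem : MemH 2 (-q - δ) (fun x => D.u x - 1)
  X_mem : ∀ i, MemH 2 (-q - δ) (fun x => D.X x i)
  g_eq : ∀ᵐ x, g x = D.u x ^ 4 • (1 + chiP χ D.p x • (kerrG D.p x - 1) + D.gTT x + D.gCor x)
  pi_eq : ∀ᵐ x, π x = chiP χ D.p x • kerrPi D.p x + D.piTT x + D.piCor x + Le D.X x

end

noncomputable section

/-! ### Test functions and weak derivatives -/

/-! The Kerr parameters are read off at infinity. As `q ≥ 3` and `δ > 0`, for almost every direction
`s` the difference between `g` and the Kerr metric is `o(r⁻³)` along the dyadic points `2^k s`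
(`Represents.ae_tendsto`), too small to affect the orders `r⁻¹` and `r⁻²` of the Kerr perturbation.
That perturbation is a rank-one tensor with explicit homogeneous coefficients, so on a ray it is
`r⁻¹` times a profile in `ε = 1/r` that is differentiable at `0`. The value of the profile at `0`
gives `m` and, if `m > 0`, also `γv`; its derivative gives `y`, then `a`
(`kerrParam_eq_of_tendsto`). For `m = 0` the Kerr data are trivial. In both cases the two
backgrounds agree.

TT tensors and metric correctors are traceless, so `tr g = u⁴ tr(background)`, where the background
has trace at least `3`. This determines `u⁴`, and the sign of `u` has to be found separately
(`ae_pos_of_memH`): `|u|` is locally bounded below, so a smooth step function of `u` separating the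
two signs has zero gradient, and the Sobolev inequality together with `u - 1 ∈ L²` excludes the
negative phase.

After division by `u⁴` the sums of TT part and corrector agree. The divergence kills the TT part and
is injective on the corrector space (`metricCorrector_unique`).

For the momentum, `Δ tr + div div` annihilates both TT tensors and `L_e X`: the trace of `L_e X` is
`-div X`, and its double divergence is `Δ div X`. This operator is injective on the momentum
correctors. Once these agree, `div L_e X = ΔX` shows that `X₁ - X₂` is weakly harmonic; as an
element of `H¹` it vanishes (`momentum_unique`). The constraint equations are not used, only that
`g` is continuous and positive definite. -/

theorem contDiff_pd {f : R3 → ℝ} (hf : ContDiff ℝ ∞ f) (i : Fin 3) : ContDiff ℝ ∞ (pd i f) :=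
  (hf.fderiv_right (m := ∞) (by simp)).clm_apply contDiff_const

theorem IsTest.pd {φ : R3 → ℝ} (hφ : IsTest φ) (i : Fin 3) : IsTest (pd i φ) :=
  ⟨contDiff_pd hφ.1 i, hφ.2.fderiv_apply ℝ _⟩

theorem IsTest.pdList {φ : R3 → ℝ} (hφ : IsTest φ) (l : List (Fin 3)) : IsTest (pdList l φ) := by
  induction l with
  | nil => exact hφ
  | cons i l ih => exact ih.pd i

theorem IsTest.memLp {φ : R3 → ℝ} (hφ : IsTest φ) (p : ENNReal) : MemLp φ p volume :=
  hφ.1.continuous.memLp_of_hasCompactSupport hφ.2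

theorem IsTest.mul_left {φ f : R3 → ℝ} (hφ : IsTest φ) (hf : ContDiff ℝ ∞ f) :
    IsTest (fun x => f x * φ x) :=
  ⟨hf.mul hφ.1, hφ.2.mul_left⟩

theorem pd_comm {f : R3 → ℝ} (hf : ContDiff ℝ ∞ f) (i j : Fin 3) :
    pd i (pd j f) = pd j (pd i f) := by
  funext x
  have hd : DifferentiableAt ℝ (fderiv ℝ f) x :=
    (hf.fderiv_right (m := ∞) (by simp)).differentiable (by simp) x
  have h : ∀ a b : Fin 3, pd a (pd b f) x =
      fderiv ℝ (fderiv ℝ f) x (EuclideanSpace.single a 1) (EuclideanSpace.single b 1) := by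
    intro a b
    unfold pd
    rw [fderiv_clm_apply hd (by fun_prop)]
    simp
  rw [h, h]
  exact (hf.contDiffAt.isSymmSndFDerivAt (by simp; exact WithTop.coe_le_coe.2 le_top)) _ _

theorem pd_sum {ι : Type*} (s : Finset ι) {f : ι → R3 → ℝ} (hf : ∀ a, ContDiff ℝ ∞ (f a))
    (i : Fin 3) : pd i (fun x => ∑ a ∈ s, f a x) = fun x => ∑ a ∈ s, pd i (f a) x := by
  funext x
  unfold pd
  rw [fderiv_fun_sum (fun a _ => (hf a).differentiable (by simp) x)]
  simp

theorem pd_const_mul {f : R3 → ℝ} (hf : ContDiff ℝ ∞ f) (c : ℝ) (i : Fin 3) :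
    pd i (fun x => c * f x) = fun x => c * pd i f x := by
  funext x
  unfold pd
  rw [fderiv_const_mul (hf.differentiable (by simp) x)]
  simp

theorem integrable_mul_test {f φ : R3 → ℝ} (hf : LocallyIntegrable f volume) (hφ : IsTest φ) :
    Integrable (fun x => f x * φ x) volume := by
  have := hf.integrable_smul_left_of_hasCompactSupport hφ.1.continuous hφ.2
  simpa [mul_comm] using this

theorem ae_eq_zero_of_test {f : R3 → ℝ} (hf : LocallyIntegrable f volume)
    (h : ∀ φ, IsTest φ → ∫ x, f x * φ x = 0) : f =ᵐ[volume] 0 := by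
  refine ae_eq_zero_of_integral_contDiff_smul_eq_zero hf fun φ h1 h2 => ?_
  simpa [mul_comm] using h φ ⟨h1, h2⟩

theorem integral_mul_pd {f φ : R3 → ℝ} (hf : ContDiff ℝ ∞ f) (hφ : IsTest φ) (i : Fin 3) :
    ∫ x, f x * pd i φ x = -∫ x, pd i f x * φ x :=
  integral_mul_fderiv_eq_neg_fderiv_mul_of_integrable
    (integrable_mul_test (contDiff_pd hf i).continuous.locallyIntegrable hφ)
    (integrable_mul_test hf.continuous.locallyIntegrable (hφ.pd i))
    (integrable_mul_test hf.continuous.locallyIntegrable hφ)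
    (fun x _ => hf.differentiable (by simp) x) (fun x _ => hφ.1.differentiable (by simp) x)

theorem IsWeakDeriv.ae_eq {i : Fin 3} {f f₁ f₂ : R3 → ℝ} (h₁ : IsWeakDeriv i f f₁)
    (h₂ : IsWeakDeriv i f f₂) : f₁ =ᵐ[volume] f₂ := by
  have : f₁ - f₂ =ᵐ[volume] 0 := by
    refine ae_eq_zero_of_test (h₁.2.1.sub h₂.2.1) fun φ hφ => ?_
    have e1 := h₁.2.2 φ hφ
    have e2 := h₂.2.2 φ hφ
    simp only [Pi.sub_apply, sub_mul]
    rw [integral_sub (integrable_mul_test h₁.2.1 hφ) (integrable_mul_test h₂.2.1 hφ)]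
    linarith
  filter_upwards [this] with x hx
  simpa [sub_eq_zero] using hx

theorem IsWeakDeriv.wd {i : Fin 3} {f f' : R3 → ℝ} (h : IsWeakDeriv i f f') :
    IsWeakDeriv i f (wd i f) := by
  have H : ∃ f', IsWeakDeriv i f f' := ⟨f', h⟩
  rw [_root_.wd, dif_pos H]
  exact H.choose_spec

theorem IsWeakDeriv.sub {i : Fin 3} {f f' g g' : R3 → ℝ} (hf : IsWeakDeriv i f f')
    (hg : IsWeakDeriv i g g') :
    IsWeakDeriv i (fun x => f x - g x) (fun x => f' x - g' x) := by
  refine ⟨hf.1.sub hg.1, hf.2.1.sub hg.2.1, fun φ hφ => ?_⟩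
  simp only [sub_mul]
  rw [integral_sub (integrable_mul_test hf.1 (hφ.pd i)) (integrable_mul_test hg.1 (hφ.pd i)),
    integral_sub (integrable_mul_test hf.2.1 hφ) (integrable_mul_test hg.2.1 hφ),
    hf.2.2 φ hφ, hg.2.2 φ hφ]
  ring

/-! ### Approximation of elements of `H^k_ρ`, `ρ ≤ -3/2` -/

/-- For `ρ ≤ -3/2` the exponent `-ρ - 3/2 + k` is nonnegative. Every decay rate in the proposition
is in this range, so outside the study of Kerr parameters the weights can be dropped in favour of
plain `L²`. -/
theorem one_le_sobolevWeight {ρ : ℝ} (hρ : ρ ≤ -(3 / 2)) (k : ℕ) (x : R3) :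
    1 ≤ sobolevWeight ρ k x :=
  Real.one_le_rpow (by linarith [norm_nonneg x]) (by have := Nat.cast_nonneg (α := ℝ) k; linarith)

theorem continuous_sobolevWeight (ρ : ℝ) (k : ℕ) : Continuous (sobolevWeight ρ k) := by
  unfold sobolevWeight
  exact (continuous_const.add continuous_norm).rpow_const
    fun x => Or.inl (show 0 < 1 + ‖x‖ by linarith [norm_nonneg x]).ne'

theorem sobolevWeight_pos (ρ : ℝ) (k : ℕ) (x : R3) : 0 < sobolevWeight ρ k x :=
  Real.rpow_pos_of_pos (by have := norm_nonneg x; positivity) _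

/-- `φ n` are test functions whose derivatives of order at most `k` converge in `L²` to `F`. -/
structure IsApprox (k : ℕ) (φ : ℕ → R3 → ℝ) (F : List (Fin 3) → R3 → ℝ) : Prop where
  test : ∀ n, IsTest (φ n)
  memLp : ∀ l : List (Fin 3), l.length ≤ k → MemLp (F l) 2 volume
  tendsto : ∀ l : List (Fin 3), l.length ≤ k →
    Tendsto (fun n => eLpNorm (fun x => pdList l (φ n) x - F l x) 2 volume) atTop (𝓝 0)

theorem MemH.exists_isApprox {k : ℕ} {ρ : ℝ} {f : R3 → ℝ} (hf : MemH k ρ f)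
    (hρ : ρ ≤ -(3 / 2)) : ∃ φ F, IsApprox k φ F ∧ F [] =ᵐ[volume] f := by
  obtain ⟨φ, F, h1, h2, h3⟩ := hf
  refine ⟨φ, F, ⟨h1, fun l hl => ?_, fun l hl => ?_⟩, h2⟩
  · have hm := (h3 l hl).1
    refine hm.mono ?_ (ae_of_all _ fun x => ?_)
    · have := ((continuous_sobolevWeight ρ l.length).inv₀
        fun x => (sobolevWeight_pos ρ l.length x).ne').aestronglyMeasurable.mul
          (μ := volume) hm.1
      refine this.congr (ae_of_all _ fun x => ?_)
      have := (sobolevWeight_pos ρ l.length x).ne'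
      simp only [Pi.mul_apply, Pi.inv_apply]
      field_simp
    · rw [norm_mul, Real.norm_of_nonneg (sobolevWeight_pos ρ l.length x).le]
      exact le_mul_of_one_le_left (norm_nonneg _) (one_le_sobolevWeight hρ _ x)
  · refine tendsto_of_tendsto_of_tendsto_of_le_of_le tendsto_const_nhds (h3 l hl).2
      (fun _ => zero_le) fun n => eLpNorm_mono fun x => ?_
    rw [norm_mul, Real.norm_of_nonneg (sobolevWeight_pos ρ l.length x).le]
    exact le_mul_of_one_le_left (norm_nonneg _) (one_le_sobolevWeight hρ _ x)

theorem tendsto_integral_mul {f : ℕ → R3 → ℝ} {g ψ : R3 → ℝ} (hf : ∀ n, MemLp (f n) 2 volume)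
    (hg : MemLp g 2 volume) (hψ : MemLp ψ 2 volume)
    (h : Tendsto (fun n => eLpNorm (fun x => f n x - g x) 2 volume) atTop (𝓝 0)) :
    Tendsto (fun n => ∫ x, f n x * ψ x) atTop (𝓝 (∫ x, g x * ψ x)) := by
  refine tendsto_integral_of_L1' _ (MemLp.integrable_mul hg hψ).1
    (Eventually.of_forall fun n => MemLp.integrable_mul (hf n) hψ) ?_
  have hb : ∀ n, eLpNorm ((fun x => f n x * ψ x) - fun x => g x * ψ x) 1 volume ≤
      eLpNorm (fun x => f n x - g x) 2 volume * eLpNorm ψ 2 volume := by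
    intro n
    have := eLpNorm_smul_le_mul_eLpNorm (p := 2) (q := 2) (r := 1) (μ := (volume : Measure R3))
      hψ.1 ((hf n).sub hg).1
    refine le_trans (le_of_eq ?_) this
    congr 1
    funext x
    simp [sub_mul]
  refine tendsto_of_tendsto_of_tendsto_of_le_of_le tendsto_const_nhds ?_ (fun _ => zero_le) hb
  simpa using ENNReal.Tendsto.mul_const h (Or.inr hψ.2.ne)

/-- Integration by parts holds for the approximants and passes to the `L²` limit. This identifies
the abstract limits `F` with weak derivatives, and hence with the chosen representative `wd`. -/
theorem IsApprox.isWeakDeriv {k : ℕ} {φ : ℕ → R3 → ℝ} {F : List (Fin 3) → R3 → ℝ}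
    (h : IsApprox k φ F) (l : List (Fin 3)) (i : Fin 3) (hl : l.length + 1 ≤ k) :
    IsWeakDeriv i (F l) (F (i :: l)) := by
  have m1 := h.memLp l (by omega)
  have m2 := h.memLp (i :: l) hl
  refine ⟨m1.locallyIntegrable (by norm_num), m2.locallyIntegrable (by norm_num),
    fun ψ hψ => ?_⟩
  have t1 := tendsto_integral_mul (fun n => ((h.test n).pdList l).memLp 2) m1
    ((hψ.pd i).memLp 2) (h.tendsto l (by omega))
  have t2 := tendsto_integral_mul (fun n => ((h.test n).pdList (i :: l)).memLp 2) m2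
    (hψ.memLp 2) (h.tendsto (i :: l) hl)
  refine tendsto_nhds_unique t1 (t2.neg.congr fun n => ?_)
  rw [integral_mul_pd ((h.test n).pdList l).1 hψ i]
  rfl

theorem IsWeakDeriv.congr {i : Fin 3} {f g f' : R3 → ℝ} (h : IsWeakDeriv i f f')
    (hfg : f =ᵐ[volume] g) : IsWeakDeriv i g f' := by
  refine ⟨h.1.congr hfg, h.2.1, fun φ hφ => ?_⟩
  rw [← h.2.2 φ hφ]
  exact integral_congr_ae (by filter_upwards [hfg] with x hx; rw [hx])

theorem MemH.isWeakDeriv_wd {k : ℕ} {ρ : ℝ} {f : R3 → ℝ} (hf : MemH k ρ f)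
    (hρ : ρ ≤ -(3 / 2)) (hk : 1 ≤ k) (i : Fin 3) : IsWeakDeriv i f (wd i f) := by
  obtain ⟨φ, F, h, hF⟩ := hf.exists_isApprox hρ
  exact ((h.isWeakDeriv [] i (by simpa using hk)).congr hF).wd

theorem MemH.memLp {k : ℕ} {ρ : ℝ} {f : R3 → ℝ} (hf : MemH k ρ f)
    (hρ : ρ ≤ -(3 / 2)) : MemLp f 2 volume := by
  obtain ⟨φ, F, h, hF⟩ := hf.exists_isApprox hρ
  exact (memLp_congr_ae hF).1 (h.memLp [] (by simp))

/-! ### The Sobolev inequality -/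

theorem norm_fderiv_le_sum_pd (f : R3 → ℝ) (x : R3) : ‖fderiv ℝ f x‖ ≤ ∑ i, ‖pd i f x‖ := by
  refine ContinuousLinearMap.opNorm_le_bound _ (Finset.sum_nonneg fun i _ => norm_nonneg _)
    fun y => ?_
  have hy : y = ∑ i, y i • EuclideanSpace.single i (1 : ℝ) := by
    ext j
    simp [Finset.sum_apply, Pi.single_apply]
  have : fderiv ℝ f x y = ∑ i, y i * pd i f x := by
    conv_lhs => rw [hy]
    simp [pd]
  rw [this, Finset.sum_mul]
  refine (norm_sum_le _ _).trans (Finset.sum_le_sum fun i _ => ?_)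
  rw [norm_mul, mul_comm]
  exact mul_le_mul_of_nonneg_left (PiLp.norm_apply_le y i) (norm_nonneg _)

/-- The Gagliardo–Nirenberg–Sobolev inequality with `1/6 = 1/2 - 1/3`. Its constant does not depend
on the support, so it survives limits of test functions and growing cutoffs. -/
theorem exists_eLpNorm_six_le : ∃ C : NNReal, ∀ f : R3 → ℝ, ContDiff ℝ 1 f → HasCompactSupport f →
    eLpNorm f 6 volume ≤ C * ∑ i, eLpNorm (pd i f) 2 volume := by
  refine ⟨eLpNormLESNormFDerivOfEqInnerConst (volume : Measure R3) 2, fun f hf hc => ?_⟩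
  have h := eLpNorm_le_eLpNorm_fderiv_of_eq_inner (volume : Measure R3) hf hc (p := 2) (p' := 6)
    (by norm_num) (by simp) (by simp; norm_num)
  refine h.trans (mul_le_mul_right ?_ _)
  have hc : ∀ i, Continuous (pd i f) := fun i =>
    (hf.continuous_fderiv (by simp)).clm_apply continuous_const
  calc eLpNorm (fderiv ℝ f) 2 volume ≤ eLpNorm (∑ i, fun x => ‖pd i f x‖) 2 volume := by
        refine eLpNorm_mono_real fun x => ?_
        simpa using norm_fderiv_le_sum_pd f x
    _ ≤ ∑ i, eLpNorm (fun x => ‖pd i f x‖) 2 volume :=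
        eLpNorm_sum_le (fun i _ => (hc i).norm.aestronglyMeasurable) (by norm_num)
    _ = _ := by simp only [eLpNorm_norm]

theorem ae_eq_of_tendsto_eLpNorm {p₁ p₂ : ENNReal} (hp₁ : p₁ ≠ 0) (hp₂ : p₂ ≠ 0)
    {f : ℕ → R3 → ℝ} {g₁ g₂ : R3 → ℝ} (hf : ∀ n, AEStronglyMeasurable (f n) volume)
    (hg₁ : AEStronglyMeasurable g₁ volume) (hg₂ : AEStronglyMeasurable g₂ volume)
    (h₁ : Tendsto (fun n => eLpNorm (f n - g₁) p₁ volume) atTop (𝓝 0))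
    (h₂ : Tendsto (fun n => eLpNorm (f n - g₂) p₂ volume) atTop (𝓝 0)) : g₁ =ᵐ[volume] g₂ :=
  tendstoInMeasure_ae_unique (tendstoInMeasure_of_tendsto_eLpNorm hp₁ hf hg₁ h₁)
    (tendstoInMeasure_of_tendsto_eLpNorm hp₂ hf hg₂ h₂)

/-- An element of `H¹` with vanishing gradient is zero. -/
theorem IsApprox.ae_eq_zero {k : ℕ} {φ : ℕ → R3 → ℝ} {F : List (Fin 3) → R3 → ℝ}
    (h : IsApprox k φ F) (hk : 1 ≤ k) (h0 : ∀ i, F [i] =ᵐ[volume] 0) : F [] =ᵐ[volume] 0 := by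
  obtain ⟨C, hC⟩ := exists_eLpNorm_six_le
  -- The same approximants converge to `F []` in `L²` and, by the Sobolev inequality, to `0` in
  -- `L⁶`; both imply convergence in measure, whose limits are unique.
  refine ae_eq_of_tendsto_eLpNorm (p₁ := 2) (p₂ := 6) (by norm_num) (by norm_num)
    (fun n => (h.test n).1.continuous.aestronglyMeasurable) (h.memLp [] (by simp)).1
    aestronglyMeasurable_const (h.tendsto [] (by simp)) ?_
  have hd : ∀ i, Tendsto (fun n => eLpNorm (pd i (φ n)) 2 volume) atTop (𝓝 0) := by
    intro i
    refine (h.tendsto [i] (by simpa using hk)).congr fun n => eLpNorm_congr_ae ?_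
    filter_upwards [h0 i] with x hx
    simp [hx, pdList]
  have hs : Tendsto (fun n => C * ∑ i, eLpNorm (pd i (φ n)) 2 volume) atTop (𝓝 0) := by
    have := ENNReal.Tendsto.const_mul (a := C) (tendsto_finsetSum Finset.univ fun i _ => hd i)
      (Or.inr ENNReal.coe_ne_top)
    simpa using this
  refine tendsto_of_tendsto_of_tendsto_of_le_of_le tendsto_const_nhds hs (fun _ => zero_le)
    fun n => ?_
  simpa using hC (φ n) ((h.test n).1.of_le (by simp)) (h.test n).2

/-! ### Correctors -/

/-- Linearity of `A` is required only on combinations of the family: classical derivatives are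
additive on smooth tensors, not on arbitrary tensor fields. -/
theorem eq_zero_of_mem_correctorSpace {ι V : Type} [Fintype ι] [AddCommGroup V] [Module ℝ V]
    {h : ι → TensorField} {A : TensorField → V}
    (hA : ∀ c : ι → ℝ, A (∑ a, c a • h a) = ∑ a, c a • A (h a))
    (hli : LinearIndependent ℝ (fun a => A (h a))) {H : TensorField}
    (hH : H ∈ correctorSpace h) (h0 : A H = 0) : H = 0 := by
  obtain ⟨c, rfl⟩ := (Submodule.mem_span_range_iff_exists_fun ℝ).1 hH
  rw [hA] at h0
  have := Fintype.linearIndependent_iff.1 hli c h0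
  simp [this]

theorem IsAnnularTensor.contDiff_trace {T : TensorField} (hT : IsAnnularTensor T) :
    ContDiff ℝ ∞ (fun x => (T x).trace) := by
  simp only [Matrix.trace, Matrix.diag]
  exact ContDiff.sum fun i _ => hT.smooth i i

theorem IsAnnularTensor.contDiff_divT {T : TensorField} (hT : IsAnnularTensor T) (i : Fin 3) :
    ContDiff ℝ ∞ (fun x => divT T x i) :=
  ContDiff.sum fun j _ => contDiff_pd (hT.smooth j i) j

theorem IsAnnularTensor.contDiff_lapTrDivDiv {T : TensorField} (hT : IsAnnularTensor T) :
    ContDiff ℝ ∞ (lapTrDivDiv T) :=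
  (ContDiff.sum fun k _ => contDiff_pd (contDiff_pd hT.contDiff_trace k) k).add
    (ContDiff.sum fun i _ => contDiff_pd (hT.contDiff_divT i) i)

theorem divT_sum_smul {ι : Type} [Fintype ι] {h : ι → TensorField}
    (hh : ∀ a, IsAnnularTensor (h a)) (c : ι → ℝ) :
    divT (∑ a, c a • h a) = ∑ a, c a • divT (h a) := by
  funext x i
  simp only [divT, Finset.sum_apply, Pi.smul_apply, Matrix.sum_apply, Matrix.smul_apply,
    smul_eq_mul]
  simp_rw [Finset.mul_sum]
  rw [Finset.sum_comm]
  refine Finset.sum_congr rfl fun j _ => ?_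
  rw [pd_sum _ (fun a => contDiff_const.mul ((hh a).smooth j i))]
  exact Finset.sum_congr rfl fun a _ => by rw [pd_const_mul ((hh a).smooth j i)]

theorem lapTrDivDiv_sum_smul {ι : Type} [Fintype ι] {h : ι → TensorField}
    (hh : ∀ a, IsAnnularTensor (h a)) (c : ι → ℝ) :
    lapTrDivDiv (∑ a, c a • h a) = ∑ a, c a • lapTrDivDiv (h a) := by
  funext x
  have h1 : (fun z => ((∑ a, c a • h a) z).trace) = fun z => ∑ a, c a * (h a z).trace := by
    funext z
    simp [Finset.sum_apply, Matrix.trace_sum, Matrix.trace_smul]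
  have h2 : ∀ i, (fun z => divT (∑ a, c a • h a) z i) = fun z => ∑ a, c a * divT (h a) z i := by
    intro i
    funext z
    rw [divT_sum_smul hh]
    simp [Finset.sum_apply]
  have key : ∀ (f : ι → R3 → ℝ), (∀ a, ContDiff ℝ ∞ (f a)) → ∀ k,
      pd k (fun z => ∑ a, c a * f a z) = fun z => ∑ a, c a * pd k (f a) z := by
    intro f hf k
    rw [pd_sum _ (fun a => contDiff_const.mul (hf a))]
    funext z
    exact Finset.sum_congr rfl fun a _ => by rw [pd_const_mul (hf a)]
  unfold lapTrDivDiv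
  rw [h1]
  simp only [h2, Finset.sum_apply, Pi.smul_apply, smul_eq_mul, mul_add, Finset.sum_add_distrib]
  congr 1
  · simp_rw [Finset.mul_sum]
    rw [Finset.sum_comm]
    refine Finset.sum_congr rfl fun k _ => ?_
    rw [key _ (fun a => (hh a).contDiff_trace), key _ (fun a => contDiff_pd (hh a).contDiff_trace k)]
  · simp_rw [Finset.mul_sum]
    rw [Finset.sum_comm]
    exact Finset.sum_congr rfl fun k _ => by rw [key _ (fun a => (hh a).contDiff_divT k)]

theorem isAnnularTensor_of_mem_correctorSpace {ι : Type} {h : ι → TensorField}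
    (hh : ∀ a, IsAnnularTensor (h a)) {H : TensorField} (hH : H ∈ correctorSpace h) :
    IsAnnularTensor H := by
  induction hH using Submodule.span_induction with
  | mem x hx => obtain ⟨a, rfl⟩ := hx; exact hh a
  | zero => exact ⟨fun _ _ => contDiff_const, fun _ => Matrix.isSymm_zero, fun _ _ => rfl⟩
  | add x y _ _ hx hy =>
    exact ⟨fun i j => (hx.smooth i j).add (hy.smooth i j), fun z => (hx.symm z).add (hy.symm z),
      fun z hz => by simp [hx.support z hz, hy.support z hz]⟩
  | smul c x _ hx =>
    exact ⟨fun i j => contDiff_const.mul (hx.smooth i j), fun z => (hx.symm z).smul c,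
      fun z hz => by simp [hx.support z hz]⟩

theorem trace_eq_zero_of_mem_correctorSpace {ι : Type} {h : ι → TensorField}
    (hh : ∀ a x, (h a x).trace = 0) {H : TensorField} (hH : H ∈ correctorSpace h) (x : R3) :
    (H x).trace = 0 := by
  induction hH using Submodule.span_induction with
  | mem y hy => obtain ⟨a, rfl⟩ := hy; exact hh a x
  | zero => simp
  | add y z _ _ hy hz => simp [hy, hz]
  | smul c y _ hy => simp [hy]

/-! ### Distributional identities -/

/-- The divergence condition of `IsTT` is phrased with `wd`, which defaults to zero in the absence
of a weak derivative. Membership in `H^k_ρ` guarantees that the weak derivatives exist, so the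
condition can be tested against functions. -/
theorem IsTT.sum_integral_eq_zero {T : TensorField} (hT : IsTT T) {k : ℕ} {ρ : ℝ}
    (hm : ∀ i j, MemH k ρ (fun x => T x i j)) (hρ : ρ ≤ -(3 / 2)) (hk : 1 ≤ k) (i : Fin 3)
    {φ : R3 → ℝ} (hφ : IsTest φ) : ∑ j, ∫ x, T x j i * pd j φ x = 0 := by
  have hw : ∀ j, IsWeakDeriv j (fun x => T x j i) (wd j fun x => T x j i) :=
    fun j => (hm j i).isWeakDeriv_wd hρ hk j
  simp_rw [fun j => (hw j).2.2 φ hφ]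
  rw [Finset.sum_neg_distrib, ← integral_finsetSum _
    (fun j _ => integrable_mul_test (hw j).2.1 hφ), neg_eq_zero]
  refine integral_eq_zero_of_ae ?_
  filter_upwards [hT.div] with x hx
  rw [← Finset.sum_mul, hx i]
  simp

theorem IsAnnularTensor.sum_integral_mul_pd {T : TensorField} (hT : IsAnnularTensor T)
    (i : Fin 3) {φ : R3 → ℝ} (hφ : IsTest φ) :
    ∑ j, ∫ x, T x j i * pd j φ x = -∫ x, divT T x i * φ x := by
  simp_rw [fun j => integral_mul_pd (hT.smooth j i) hφ j]
  rw [Finset.sum_neg_distrib, ← integral_finsetSum _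
    (fun j _ => integrable_mul_test (contDiff_pd (hT.smooth j i) j).continuous.locallyIntegrable hφ)]
  simp_rw [← Finset.sum_mul]
  rfl

theorem IsAnnularTensor.integral_lapTrDivDiv {T : TensorField} (hT : IsAnnularTensor T)
    {φ : R3 → ℝ} (hφ : IsTest φ) :
    ∫ x, lapTrDivDiv T x * φ x =
      ∑ k, ∑ i, (∫ x, T x i i * pd k (pd k φ) x) + ∑ i, ∑ j, ∫ x, T x j i * pd j (pd i φ) x := by
  have hli : ∀ {f : R3 → ℝ}, ContDiff ℝ ∞ f → LocallyIntegrable f volume :=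
    fun hf => hf.continuous.locallyIntegrable
  have h1 : ∀ i, ContDiff ℝ ∞ (pd i fun x => divT T x i) :=
    fun i => contDiff_pd (hT.contDiff_divT i) i
  have h2 : ∀ k, ContDiff ℝ ∞ (pd k (pd k fun x => (T x).trace)) :=
    fun k => contDiff_pd (contDiff_pd hT.contDiff_trace k) k
  simp_rw [fun i => hT.sum_integral_mul_pd i (hφ.pd i), fun i =>
    integral_mul_pd (hT.contDiff_divT i) hφ i, neg_neg]
  have h3 : ∀ k, ∑ i, ∫ x, T x i i * pd k (pd k φ) x =
      ∫ x, pd k (pd k fun x => (T x).trace) x * φ x := by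
    intro k
    rw [← integral_finsetSum _
      (fun i _ => integrable_mul_test (hli (hT.smooth i i)) ((hφ.pd k).pd k))]
    have e : ∀ x, ∑ i, T x i i * pd k (pd k φ) x = (T x).trace * pd k (pd k φ) x :=
      fun x => (Finset.sum_mul ..).symm
    refine (integral_congr_ae (ae_of_all _ e)).trans ?_
    have := integral_mul_pd hT.contDiff_trace (hφ.pd k) k
    rw [integral_mul_pd (contDiff_pd hT.contDiff_trace k) hφ k, neg_neg] at this
    exact this
  simp_rw [h3]
  rw [← integral_finsetSum _ (fun k _ => integrable_mul_test (hli (h2 k)) hφ),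
    ← integral_finsetSum _ (fun k _ => integrable_mul_test (hli (h1 k)) hφ),
    ← integral_add (integrable_finsetSum _ fun k _ => integrable_mul_test (hli (h2 k)) hφ)
      (integrable_finsetSum _ fun k _ => integrable_mul_test (hli (h1 k)) hφ)]
  congr 1
  funext x
  simp only [lapTrDivDiv, add_mul, Finset.sum_mul]

/-- If `T₁ + H₁ = T₂ + H₂` with `Tᵢ` of TT type and correctors `Hᵢ`, then `H₁ = H₂`. -/
theorem metricCorrector_unique {ι : Type} [Fintype ι] {h : ι → TensorField}
    (hh : ∀ a, IsAnnularTensor (h a)) (hli : LinearIndependent ℝ (fun a => divT (h a)))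
    {k : ℕ} {ρ : ℝ} (hρ : ρ ≤ -(3 / 2)) (hk : 1 ≤ k) {T₁ T₂ H₁ H₂ : TensorField}
    (hT₁ : IsTT T₁) (hT₂ : IsTT T₂)
    (hm₁ : ∀ i j, MemH k ρ (fun x => T₁ x i j)) (hm₂ : ∀ i j, MemH k ρ (fun x => T₂ x i j))
    (hH₁ : H₁ ∈ correctorSpace h) (hH₂ : H₂ ∈ correctorSpace h)
    (he : ∀ᵐ x, T₁ x + H₁ x = T₂ x + H₂ x) : H₁ = H₂ := by
  have hH := Submodule.sub_mem _ hH₁ hH₂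
  have hA := isAnnularTensor_of_mem_correctorSpace hh hH
  rw [← sub_eq_zero]
  refine eq_zero_of_mem_correctorSpace (divT_sum_smul hh) hli hH ?_
  have h0 : ∀ i, (fun x => divT (H₁ - H₂) x i) = 0 := by
    intro i
    -- The difference of correctors is a difference of TT tensors, so its weak divergence vanishes;
    -- being smooth, its divergence vanishes everywhere.
    refine (hA.contDiff_divT i).continuous.ae_eq_iff_eq volume continuous_const |>.1 ?_
    refine ae_eq_zero_of_test (hA.contDiff_divT i).continuous.locallyIntegrable fun φ hφ => ?_
    have e := hA.sum_integral_mul_pd i hφ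
    have e1 := hT₁.sum_integral_eq_zero hm₁ hρ hk i hφ
    have e2 := hT₂.sum_integral_eq_zero hm₂ hρ hk i hφ
    have e3 : ∀ j, ∫ x, (H₁ - H₂) x j i * pd j φ x =
        (∫ x, T₂ x j i * pd j φ x) - ∫ x, T₁ x j i * pd j φ x := by
      intro j
      rw [← integral_sub
        (integrable_mul_test ((hm₂ j i).isWeakDeriv_wd hρ hk j).1 (hφ.pd j))
        (integrable_mul_test ((hm₁ j i).isWeakDeriv_wd hρ hk j).1 (hφ.pd j))]
      refine integral_congr_ae ?_
      filter_upwards [he] with x hx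
      have := congrFun (congrFun hx j) i
      simp only [Matrix.add_apply] at this
      simp only [Pi.sub_apply, Matrix.sub_apply]
      linear_combination (pd j φ x) * this
    simp_rw [e3] at e
    rw [Finset.sum_sub_distrib, e1, e2] at e
    linarith
  funext x i
  exact congrFun (h0 i) x

/-! ### Uniqueness of the decomposition of the second tensor -/

theorem IsApprox.sub {k : ℕ} {φ ψ : ℕ → R3 → ℝ} {F G : List (Fin 3) → R3 → ℝ}
    (h₁ : IsApprox k φ F) (h₂ : IsApprox k ψ G) :
    IsApprox k (fun n x => φ n x - ψ n x) (fun l x => F l x - G l x) := by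
  have key : ∀ n l, pdList l (fun x => φ n x - ψ n x) = fun x => pdList l (φ n) x - pdList l (ψ n) x := by
    intro n l
    induction l with
    | nil => rfl
    | cons i l ih =>
      funext x
      simp only [pdList, ih]
      unfold pd
      rw [fderiv_fun_sub (((h₁.test n).pdList l).1.differentiable (by simp) x)
        (((h₂.test n).pdList l).1.differentiable (by simp) x)]
      simp
  refine ⟨fun n => ⟨(h₁.test n).1.sub (h₂.test n).1, (h₁.test n).2.sub (h₂.test n).2⟩,
    fun l hl => (h₁.memLp l hl).sub (h₂.memLp l hl), fun l hl => ?_⟩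
  have := (h₁.tendsto l hl).add (h₂.tendsto l hl)
  rw [add_zero] at this
  refine tendsto_of_tendsto_of_tendsto_of_le_of_le tendsto_const_nhds this (fun _ => zero_le)
    fun n => ?_
  refine le_trans (le_of_eq ?_) (eLpNorm_sub_le
    ((((h₁.test n).pdList l).memLp 2).sub (h₁.memLp l hl)).1
    ((((h₂.test n).pdList l).memLp 2).sub (h₂.memLp l hl)).1 (by norm_num))
  congr 1
  funext x
  simp only [key, Pi.sub_apply]
  ring

/-- A weakly harmonic element of `H¹` is zero. -/
theorem IsApprox.ae_eq_zero_of_harmonic {k : ℕ} {φ : ℕ → R3 → ℝ} {F : List (Fin 3) → R3 → ℝ}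
    (h : IsApprox k φ F) (hk : 1 ≤ k)
    (hΔ : ∀ ψ, IsTest ψ → ∑ i, ∫ x, F [] x * pd i (pd i ψ) x = 0) : F [] =ᵐ[volume] 0 := by
  have hm : ∀ i : Fin 3, MemLp (F [i]) 2 volume := fun i => h.memLp [i] (by simpa using hk)
  have hgrad : ∀ ψ, IsTest ψ → ∑ i, ∫ x, F [i] x * pd i ψ x = 0 := by
    intro ψ hψ
    rw [← neg_eq_zero, ← Finset.sum_neg_distrib, ← hΔ ψ hψ]
    exact Finset.sum_congr rfl fun i _ =>
      ((h.isWeakDeriv [] i (by simpa using hk)).2.2 _ (hψ.pd i)).symm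
  -- The weak equation is tested with the approximants of `F []` themselves, so the limit is the
  -- Dirichlet energy and no boundary term arises.
  have ht : Tendsto (fun n => ∑ i, ∫ x, pd i (φ n) x * F [i] x) atTop
      (𝓝 (∑ i, ∫ x, F [i] x * F [i] x)) :=
    tendsto_finsetSum _ fun i _ => tendsto_integral_mul
      (fun n => ((h.test n).pd i).memLp 2) (hm i) (hm i) (h.tendsto [i] (by simpa using hk))
  have hz : ∑ i, ∫ x, F [i] x * F [i] x = 0 := by
    refine tendsto_nhds_unique ht (tendsto_const_nhds.congr fun n => ?_)
    rw [← hgrad (φ n) (h.test n)]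
    simp_rw [mul_comm]
  have hnn : ∀ i ∈ (Finset.univ : Finset (Fin 3)), 0 ≤ ∫ x, F [i] x * F [i] x :=
    fun i _ => integral_nonneg fun x => mul_self_nonneg _
  refine h.ae_eq_zero hk fun i => ?_
  have := (Finset.sum_eq_zero_iff_of_nonneg hnn).1 hz i (Finset.mem_univ i)
  rw [integral_eq_zero_iff_of_nonneg (fun x => mul_self_nonneg _)
    (MemLp.integrable_mul (hm i) (hm i))] at this
  filter_upwards [this] with x hx
  simpa using hx

/-- The algebra behind `(Δ tr + div div)(P + L_e X) = 0`. Here `p i j k l` stands for `∫ Pᵢⱼ ∂ₖ∂ₗφ`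
and `x m i k l` for `∫ Xₘ ∂ᵢ∂ₖ∂ₗφ`; the hypotheses `c₁`, `c₂` encode the symmetry of third
derivatives of `φ`. The trace part contributes `-Δ div X` and the double divergence `2Δ div X - Δ
div X`, up to the sign common to all integrations by parts. -/
theorem sum_eq_zero_of_decomposition {b p x : Fin 3 → Fin 3 → Fin 3 → Fin 3 → ℝ}
    (e : ∀ i j k l, p i j k l + b i j k l - x j i k l - x i j k l
      + (∑ m, x m m k l) * (1 : Matrix (Fin 3) (Fin 3) ℝ) i j = 0)
    (t : ∀ k l, ∑ i, p i i k l = 0) (d : ∀ i k, ∑ j, p j i j k = 0)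
    (c₁ : ∀ m i k l, x m i k l = x m k i l) (c₂ : ∀ m i k l, x m i k l = x m i l k) :
    ∑ k, ∑ i, b i i k k + ∑ i, ∑ j, b j i j i = 0 := by
  have hB₁ : ∑ k, ∑ i, b i i k k = -∑ k, ∑ i, x i i k k := by
    rw [← Finset.sum_neg_distrib]
    refine Finset.sum_congr rfl fun k _ => ?_
    have h0 := e 0 0 k k
    have h1 := e 1 1 k k
    have h2 := e 2 2 k k
    have h3 := t k k
    simp only [Fin.sum_univ_three, Matrix.one_apply_eq] at *
    linarith
  have hB₂ : ∀ i j, b j i j i = 2 * x i i j j - p j i j i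
      - (∑ m, x m m j i) * (1 : Matrix (Fin 3) (Fin 3) ℝ) j i
      + (x j j i i - x i i j j) := by
    intro i j
    have h0 := e j i j i
    rw [c₂ i j j i, c₁ i j i j, c₁ j i j i] at h0
    linarith
  have hB₃ : ∀ i, ∑ j, (∑ m, x m m j i) * (1 : Matrix (Fin 3) (Fin 3) ℝ) j i
      = ∑ m, x m m i i := by
    intro i
    simp [Matrix.one_apply]
  have hS : ∑ i, ∑ j, x j j i i = ∑ i, ∑ j, x i i j j := Finset.sum_comm
  rw [hB₁]
  simp_rw [hB₂, Finset.sum_add_distrib, Finset.sum_sub_distrib, hB₃, d, ← Finset.mul_sum]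
  rw [hS, Finset.sum_const_zero]
  ring

/-- Data for the equation `P + B + L_e X = 0`, where `W i j = ∂ᵢ Xⱼ`, in the weak sense. -/
structure WeakDecomposition (P B : Fin 3 → Fin 3 → R3 → ℝ) (X : Fin 3 → R3 → ℝ)
    (W : Fin 3 → Fin 3 → R3 → ℝ) : Prop where
  weakDeriv : ∀ i j, IsWeakDeriv i (X j) (W i j)
  intP : ∀ i j, LocallyIntegrable (P i j) volume
  intB : ∀ i j, LocallyIntegrable (B i j) volume
  eq : ∀ᵐ x, ∀ i j, P i j x + B i j x + (W i j x + W j i x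
    - (∑ k, W k k x) * (1 : Matrix (Fin 3) (Fin 3) ℝ) i j) = 0
  trace : ∀ᵐ x, ∑ i, P i i x = 0
  div : ∀ i φ, IsTest φ → ∑ j, ∫ x, P j i x * pd j φ x = 0

namespace WeakDecomposition

variable {P B : Fin 3 → Fin 3 → R3 → ℝ} {X : Fin 3 → R3 → ℝ} {W : Fin 3 → Fin 3 → R3 → ℝ}

theorem integral_eq (h : WeakDecomposition P B X W) (i j : Fin 3) {φ : R3 → ℝ} (hφ : IsTest φ) :
    (∫ x, P i j x * φ x) + (∫ x, B i j x * φ x) - (∫ x, X j x * pd i φ x)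
      - (∫ x, X i x * pd j φ x)
      + (∑ k, ∫ x, X k x * pd k φ x) * (1 : Matrix (Fin 3) (Fin 3) ℝ) i j = 0 := by
  have iW : ∀ i j, Integrable (fun x => W i j x * φ x) volume :=
    fun i j => integrable_mul_test (h.weakDeriv i j).2.1 hφ
  have iP := integrable_mul_test (h.intP i j) hφ
  have iB := integrable_mul_test (h.intB i j) hφ
  have iS : Integrable (fun x => ∑ k, W k k x * φ x) volume :=
    integrable_finsetSum _ fun k _ => iW k k
  simp_rw [fun i j => (h.weakDeriv i j).2.2 φ hφ]
  rw [Finset.sum_neg_distrib, ← integral_finsetSum _ (fun k _ => iW k k), neg_mul,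
    ← integral_mul_const]
  have e := integral_congr_ae (μ := volume) (f := fun x =>
    ((P i j x * φ x + B i j x * φ x) + (W i j x * φ x + W j i x * φ x))
      - (∑ k, W k k x * φ x) * (1 : Matrix (Fin 3) (Fin 3) ℝ) i j) (g := fun _ => (0 : ℝ)) (by
    filter_upwards [h.eq] with x hx
    have := hx i j
    rw [← Finset.sum_mul]
    linear_combination φ x * this)
  have iPB : Integrable (fun x => P i j x * φ x + B i j x * φ x) volume := iP.add iB
  have iWW : Integrable (fun x => W i j x * φ x + W j i x * φ x) volume := (iW i j).add (iW j i)
  have iT : Integrable (fun x => (P i j x * φ x + B i j x * φ x)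
    + (W i j x * φ x + W j i x * φ x)) volume := iPB.add iWW
  rw [integral_sub iT (iS.mul_const _), integral_add iPB iWW, integral_add iP iB,
    integral_add (iW i j) (iW j i), integral_zero] at e
  linarith

theorem integral_trace (h : WeakDecomposition P B X W) {φ : R3 → ℝ} (hφ : IsTest φ) :
    ∑ i, ∫ x, P i i x * φ x = 0 := by
  rw [← integral_finsetSum _ fun i _ => integrable_mul_test (h.intP i i) hφ]
  refine integral_eq_zero_of_ae ?_
  filter_upwards [h.trace] with x hx
  rw [← Finset.sum_mul, hx]
  simp

theorem integral_B (h : WeakDecomposition P B X W) {φ : R3 → ℝ} (hφ : IsTest φ) :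
    ∑ k, ∑ i, (∫ x, B i i x * pd k (pd k φ) x) + ∑ i, ∑ j, ∫ x, B j i x * pd j (pd i φ) x = 0 := by
  exact sum_eq_zero_of_decomposition
    (p := fun i j k l => ∫ x, P i j x * pd k (pd l φ) x)
    (x := fun m i k l => ∫ x, X m x * pd i (pd k (pd l φ)) x)
    (fun i j k l => h.integral_eq i j ((hφ.pd l).pd k))
    (fun k l => h.integral_trace ((hφ.pd l).pd k)) (fun i k => h.div i _ (hφ.pd k))
    (fun m i k l => by rw [pd_comm (hφ.pd l).1 i k])
    (fun m i k l => by rw [pd_comm hφ.1 k l])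

/-- Taking the divergence, `div P = 0` and `div L_e X = ΔX + ∇ div X - ∇ div X = ΔX`. -/
theorem integral_X (h : WeakDecomposition P 0 X W) {φ : R3 → ℝ} (hφ : IsTest φ) (j : Fin 3) :
    ∑ i, ∫ x, X j x * pd i (pd i φ) x = 0 := by
  have e : ∀ i, _ := fun i => h.integral_eq i j (hφ.pd i)
  have d := h.div j _ hφ
  have hs := Finset.sum_eq_zero (fun i (_ : i ∈ Finset.univ) => e i)
  have c1 : ∀ i, pd i (pd j φ) = pd j (pd i φ) := fun i => pd_comm hφ.1 i j
  simp only [Finset.sum_add_distrib, Finset.sum_sub_distrib, Pi.zero_apply, zero_mul,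
    integral_zero, Finset.sum_const_zero, d, Matrix.one_apply, mul_ite, mul_one, mul_zero,
    Finset.sum_ite_eq', Finset.mem_univ, if_true] at hs
  simp only [c1] at hs
  linarith

end WeakDecomposition

theorem weakDecomposition_of_eq {k : ℕ} {ρ : ℝ} (hρ : ρ ≤ -(3 / 2)) (hk : 1 ≤ k)
    {P₁ P₂ B : TensorField} {X₁ X₂ : VecField} (hP₁ : IsTT P₁) (hP₂ : IsTT P₂)
    (hB : IsAnnularTensor B)
    (mP₁ : ∀ i j, MemH k ρ (fun x => P₁ x i j)) (mP₂ : ∀ i j, MemH k ρ (fun x => P₂ x i j))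
    (mX₁ : ∀ i, MemH k ρ (fun x => X₁ x i)) (mX₂ : ∀ i, MemH k ρ (fun x => X₂ x i))
    (he : ∀ᵐ x, P₁ x + B x + Le X₁ x = P₂ x + Le X₂ x) :
    WeakDecomposition (fun i j x => P₁ x i j - P₂ x i j) (fun i j x => B x i j)
      (fun i x => X₁ x i - X₂ x i)
      (fun i j x => wd i (fun z => X₁ z j) x - wd i (fun z => X₂ z j) x) where
  weakDeriv i j := ((mX₁ j).isWeakDeriv_wd hρ hk i).sub ((mX₂ j).isWeakDeriv_wd hρ hk i)
  intP i j := ((mP₁ i j).isWeakDeriv_wd hρ hk i).1.sub ((mP₂ i j).isWeakDeriv_wd hρ hk i).1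
  intB i j := (hB.smooth i j).continuous.locallyIntegrable
  eq := by
    filter_upwards [he] with x hx i j
    have := congrFun (congrFun hx i) j
    simp only [Le, Matrix.add_apply, Matrix.of_apply] at this
    rw [Finset.sum_sub_distrib]
    linear_combination this
  trace := by
    filter_upwards [hP₁.trace, hP₂.trace] with x h1 h2
    rw [Finset.sum_sub_distrib]
    simpa [Matrix.trace] using congrArg₂ (· - ·) h1 h2
  div i φ hφ := by
    have e1 := hP₁.sum_integral_eq_zero mP₁ hρ hk i hφ
    have e2 := hP₂.sum_integral_eq_zero mP₂ hρ hk i hφ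
    have e3 : ∀ j, ∫ x, (P₁ x j i - P₂ x j i) * pd j φ x =
        (∫ x, P₁ x j i * pd j φ x) - ∫ x, P₂ x j i * pd j φ x := by
      intro j
      rw [← integral_sub
        (integrable_mul_test ((mP₁ j i).isWeakDeriv_wd hρ hk j).1 (hφ.pd j))
        (integrable_mul_test ((mP₂ j i).isWeakDeriv_wd hρ hk j).1 (hφ.pd j))]
      simp only [sub_mul]
    simp_rw [e3]
    rw [Finset.sum_sub_distrib, e1, e2, sub_zero]

/-- Uniqueness of the decomposition `P + B + L_e X` of a symmetric tensor. -/
theorem momentum_unique {ι : Type} [Fintype ι] {ϖ : ι → TensorField}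
    (hϖ : ∀ a, IsAnnularTensor (ϖ a)) (hli : LinearIndependent ℝ (fun a => lapTrDivDiv (ϖ a)))
    {k : ℕ} {ρ : ℝ} (hρ : ρ ≤ -(3 / 2)) (hk : 1 ≤ k)
    {P₁ P₂ B₁ B₂ : TensorField} {X₁ X₂ : VecField} (hP₁ : IsTT P₁) (hP₂ : IsTT P₂)
    (hB₁ : B₁ ∈ correctorSpace ϖ) (hB₂ : B₂ ∈ correctorSpace ϖ)
    (mP₁ : ∀ i j, MemH k ρ (fun x => P₁ x i j)) (mP₂ : ∀ i j, MemH k ρ (fun x => P₂ x i j))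
    (mX₁ : ∀ i, MemH k ρ (fun x => X₁ x i)) (mX₂ : ∀ i, MemH k ρ (fun x => X₂ x i))
    (he : ∀ᵐ x, P₁ x + B₁ x + Le X₁ x = P₂ x + B₂ x + Le X₂ x) :
    B₁ = B₂ ∧ X₁ =ᵐ[volume] X₂ ∧ P₁ =ᵐ[volume] P₂ := by
  have hB : B₁ = B₂ := by
    have hH := Submodule.sub_mem _ hB₁ hB₂
    have hA := isAnnularTensor_of_mem_correctorSpace hϖ hH
    have hW := weakDecomposition_of_eq hρ hk hP₁ hP₂ hA mP₁ mP₂ mX₁ mX₂ (by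
      filter_upwards [he] with x hx
      rw [Pi.sub_apply, show P₁ x + (B₁ x - B₂ x) + Le X₁ x = P₁ x + B₁ x + Le X₁ x - B₂ x by abel,
        hx]
      abel)
    rw [← sub_eq_zero]
    refine eq_zero_of_mem_correctorSpace (lapTrDivDiv_sum_smul hϖ) hli hH ?_
    refine hA.contDiff_lapTrDivDiv.continuous.ae_eq_iff_eq volume continuous_const |>.1 ?_
    refine ae_eq_zero_of_test hA.contDiff_lapTrDivDiv.continuous.locallyIntegrable fun φ hφ => ?_
    rw [hA.integral_lapTrDivDiv hφ]
    exact hW.integral_B hφ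
  -- With equal correctors the decomposition has `B = 0`, so each component of `X₁ - X₂` is weakly
  -- harmonic and in `H¹`.
  have hX : ∀ j, (fun x => X₁ x j) =ᵐ[volume] fun x => X₂ x j := by
    have h0 : IsAnnularTensor 0 :=
      isAnnularTensor_of_mem_correctorSpace hϖ (Submodule.zero_mem _)
    have hW := weakDecomposition_of_eq hρ hk hP₁ hP₂ h0 mP₁ mP₂ mX₁ mX₂ (by
      filter_upwards [he] with x hx
      rw [hB] at hx
      rw [Pi.zero_apply, add_zero]
      have : P₁ x + Le X₁ x + B₂ x = P₂ x + Le X₂ x + B₂ x := by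
        rw [add_right_comm, hx, add_right_comm]
      exact add_right_cancel this)
    intro j
    obtain ⟨φ, F, hφ, hF⟩ := (mX₁ j).exists_isApprox hρ
    obtain ⟨ψ, G, hψ, hG⟩ := (mX₂ j).exists_isApprox hρ
    have h := (hφ.sub hψ).ae_eq_zero_of_harmonic hk (fun η hη => by
      rw [← hW.integral_X hη j]
      refine Finset.sum_congr rfl fun i _ => integral_congr_ae ?_
      filter_upwards [hF, hG] with x h1 h2
      rw [h1, h2])
    filter_upwards [h, hF, hG] with x h0 h1 h2
    rw [← h1, ← h2]
    simpa [sub_eq_zero] using h0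
  -- `wd` is a choice of representative, so equality of its inputs almost everywhere gives equality
  -- of its outputs only almost everywhere, through uniqueness of weak derivatives.
  have hwd : ∀ i j, wd i (fun x => X₁ x j) =ᵐ[volume] wd i (fun x => X₂ x j) := fun i j =>
    (((mX₁ j).isWeakDeriv_wd hρ hk i).congr (hX j)).ae_eq ((mX₂ j).isWeakDeriv_wd hρ hk i)
  refine ⟨hB, ?_, ?_⟩
  · filter_upwards [ae_all_iff.2 hX] with x hx
    exact funext hx
  · filter_upwards [he, ae_all_iff.2 fun i => ae_all_iff.2 fun j => hwd i j] with x hx hw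
    have : Le X₁ x = Le X₂ x := by simp only [Le, hw]
    rw [hB, this, add_assoc, add_assoc] at hx
    exact add_right_cancel hx

/-! ### The sign of a conformal factor -/

theorem tendsto_eLpNorm_two_of_dominated {f : ℕ → R3 → ℝ} {g : R3 → ℝ} (hg : MemLp g 2 volume)
    (hf : ∀ n, AEStronglyMeasurable (f n) volume) (hb : ∀ n, ∀ᵐ x, ‖f n x‖ ≤ ‖g x‖)
    (ht : ∀ᵐ x, Tendsto (fun n => f n x) atTop (𝓝 0)) :
    Tendsto (fun n => eLpNorm (f n) 2 volume) atTop (𝓝 0) := by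
  have h2 : ∀ h : R3 → ℝ, eLpNorm h 2 volume = (∫⁻ x, ‖h x‖ₑ ^ (2 : ℝ)) ^ (1 / 2 : ℝ) := by
    intro h
    rw [eLpNorm_eq_lintegral_rpow_enorm_toReal (by norm_num) (by norm_num)]
    norm_num
  have hfin : ∫⁻ x, ‖g x‖ₑ ^ (2 : ℝ) ≠ ⊤ := by
    have := hg.2
    rw [h2] at this
    intro h
    rw [h] at this
    simp at this
  have hlim := tendsto_lintegral_of_dominated_convergence' (f := fun _ => 0)
    (F := fun n x => ‖f n x‖ₑ ^ (2 : ℝ)) (μ := (volume : Measure R3))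
    (fun x => ‖g x‖ₑ ^ (2 : ℝ)) (fun n => (hf n).enorm.pow_const _)
    (fun n => by
      filter_upwards [hb n] with x hx
      exact ENNReal.rpow_le_rpow (enorm_le_iff_norm_le.2 hx) (by norm_num)) hfin (by
      filter_upwards [ht] with x hx
      have := (hx.enorm).ennrpow_const 2
      simpa using this)
  simp_rw [h2]
  have := hlim.ennrpow_const (1 / 2)
  simpa using this

theorem IsApprox.comp_strictMono {k : ℕ} {φ : ℕ → R3 → ℝ} {F : List (Fin 3) → R3 → ℝ}
    (h : IsApprox k φ F) {s : ℕ → ℕ} (hs : StrictMono s) : IsApprox k (fun n => φ (s n)) F :=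
  ⟨fun n => h.test (s n), h.memLp, fun l hl => (h.tendsto l hl).comp hs.tendsto_atTop⟩

theorem IsApprox.exists_ae_tendsto {k : ℕ} {φ : ℕ → R3 → ℝ} {F : List (Fin 3) → R3 → ℝ}
    (h : IsApprox k φ F) : ∃ ψ, IsApprox k ψ F ∧
      ∀ᵐ x, Tendsto (fun n => ψ n x) atTop (𝓝 (F [] x)) := by
  obtain ⟨s, hs, ht⟩ := (tendstoInMeasure_of_tendsto_eLpNorm (p := 2) (by norm_num)
    (fun n => (h.test n).1.continuous.aestronglyMeasurable) (h.memLp [] (by simp)).1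
    (h.tendsto [] (by simp))).exists_seq_tendsto_ae
  exact ⟨_, h.comp_strictMono hs, ht⟩

/-- A smooth step from `1` (for `t ≤ -1 - c`) to `0` (for `t ≥ -1 + c`). -/
def lowerStep (c t : ℝ) : ℝ := Real.smoothTransition ((c - 1 - t) / (2 * c))

theorem contDiff_lowerStep (c : ℝ) : ContDiff ℝ ∞ (lowerStep c) :=
  Real.smoothTransition.contDiff.comp ((contDiff_const.sub contDiff_id).div_const _)

theorem lowerStep_eq_one {c t : ℝ} (hc : 0 < c) (ht : t ≤ -1 - c) : lowerStep c t = 1 :=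
  Real.smoothTransition.one_of_one_le (by rw [le_div_iff₀ (by positivity)]; linarith)

theorem lowerStep_eq_zero {c t : ℝ} (hc : 0 < c) (ht : -1 + c ≤ t) : lowerStep c t = 0 :=
  Real.smoothTransition.zero_of_nonpos
    (div_nonpos_of_nonpos_of_nonneg (by linarith) (by positivity))

/-- Where the step is nonzero, `t ≤ -1 + c ≤ -1/2`, hence `1 ≤ 2|t|`. Thus the `L²` norm of `u - 1`
controls the step function without reference to the volume of the region. -/
theorem abs_lowerStep_le {c : ℝ} (hc : 0 < c) (hc' : c ≤ 1 / 2) (t : ℝ) :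
    ‖lowerStep c t‖ ≤ ‖2 * t‖ := by
  have h0 : 0 ≤ lowerStep c t := Real.smoothTransition.nonneg _
  have h1 : lowerStep c t ≤ 1 := Real.smoothTransition.le_one _
  rw [Real.norm_of_nonneg h0]
  rcases le_total (-1 + c) t with h | h
  · rw [lowerStep_eq_zero hc h]
    exact norm_nonneg _
  · rw [Real.norm_eq_abs, abs_of_nonpos (by linarith)]
    linarith

theorem deriv_lowerStep_eq_zero {c t : ℝ} (hc : 0 < c) (ht : c < |t + 1|) :
    deriv (lowerStep c) t = 0 := by
  rcases lt_abs.1 ht with h | h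
  · have : lowerStep c =ᶠ[𝓝 t] fun _ => 0 := by
      filter_upwards [Ioi_mem_nhds (show -1 + c < t by linarith)] with s hs
      exact lowerStep_eq_zero hc (le_of_lt hs)
    rw [this.deriv_eq, deriv_const]
  · have : lowerStep c =ᶠ[𝓝 t] fun _ => 1 := by
      filter_upwards [Iio_mem_nhds (show t < -1 - c by linarith)] with s hs
      exact lowerStep_eq_one hc (le_of_lt hs)
    rw [this.deriv_eq, deriv_const]

theorem exists_deriv_lowerStep_bound {c : ℝ} (hc : 0 < c) :
    ∃ K : ℝ, 0 ≤ K ∧ ∀ t, ‖deriv (lowerStep c) t‖ ≤ K := by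
  have hcont : Continuous (deriv (lowerStep c)) := (contDiff_lowerStep c).continuous_deriv (by simp)
  obtain ⟨K, hK⟩ := (isCompact_Icc (a := -1 - c) (b := -1 + c)).exists_bound_of_continuousOn
    hcont.continuousOn
  refine ⟨max K 0, le_max_right _ _, fun t => ?_⟩
  by_cases ht : c < |t + 1|
  · rw [deriv_lowerStep_eq_zero hc ht, norm_zero]
    exact le_max_right _ _
  · have := abs_le.1 (not_lt.1 ht)
    exact (hK t ⟨by linarith, by linarith⟩).trans (le_max_left _ _)

/-- Smooth cutoffs equal to one on the ball of radius `R`, with gradient `O(1/R)`. -/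
theorem exists_cutoff : ∃ K : NNReal, ∀ R : ℝ, 1 ≤ R → ∃ ζ : R3 → ℝ, IsTest ζ ∧
    (∀ x, ‖ζ x‖ ≤ 1) ∧ (∀ x, ‖x‖ ≤ R → ζ x = 1) ∧ (∀ x, 2 * R ≤ ‖x‖ → ζ x = 0) ∧
    ∀ i x, ‖pd i ζ x‖ ≤ K / R := by
  let b : ContDiffBump (0 : R3) := ⟨1, 2, one_pos, one_lt_two⟩
  have hb : IsTest b := ⟨b.contDiff, b.hasCompactSupport⟩
  have : ∀ i, ∃ K : ℝ, ∀ x, ‖pd i b x‖ ≤ K := fun i =>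
    (hb.pd i).1.continuous.bounded_above_of_compact_support (hb.pd i).2
  choose K hK using this
  have hK0 : ∀ i, 0 ≤ K i := fun i => (norm_nonneg _).trans (hK i 0)
  refine ⟨(∑ i, K i).toNNReal, fun R hR => ?_⟩
  have hR0 : 0 < R := by linarith
  have hnorm : ∀ x : R3, ‖R⁻¹ • x‖ = ‖x‖ / R := by
    intro x
    rw [norm_smul, norm_inv, Real.norm_of_nonneg hR0.le]
    field_simp
  refine ⟨fun x => b (R⁻¹ • x), ⟨b.contDiff.comp (contDiff_const_smul _), ?_⟩, fun x => ?_,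
    fun x hx => ?_, fun x hx => ?_, fun i x => ?_⟩
  · exact b.hasCompactSupport.comp_homeomorph (Homeomorph.smulOfNeZero R⁻¹ (by positivity))
  · rw [Real.norm_of_nonneg b.nonneg]
    exact b.le_one
  · refine b.one_of_mem_closedBall ?_
    simp only [Metric.mem_closedBall, dist_zero_right, hnorm]
    exact (div_le_one hR0).2 hx
  · refine b.zero_of_le_dist ?_
    simp only [dist_zero_right, hnorm]
    exact (le_div_iff₀ hR0).2 hx
  · have : pd i (fun x => b (R⁻¹ • x)) x = R⁻¹ * pd i b (R⁻¹ • x) := by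
      unfold pd
      have h1 : HasFDerivAt (fun x : R3 => R⁻¹ • x) (R⁻¹ • ContinuousLinearMap.id ℝ R3) x :=
        (hasFDerivAt_id x).const_smul R⁻¹
      have h2 := ((hb.1.differentiable (by simp) (R⁻¹ • x)).hasFDerivAt).comp x h1
      rw [show (fun x => b (R⁻¹ • x)) = b ∘ fun x : R3 => R⁻¹ • x from rfl, h2.fderiv]
      simp
    rw [this, norm_mul, norm_inv, Real.norm_of_nonneg hR0.le, mul_comm, ← div_eq_mul_inv]
    refine div_le_div_of_nonneg_right ?_ hR0.le
    rw [Real.coe_toNNReal _ (Finset.sum_nonneg fun i _ => hK0 i)]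
    exact (hK i _).trans (Finset.single_le_sum (fun i _ => hK0 i) (Finset.mem_univ i))

/-- The Sobolev inequality is applied to a step of the approximants times a cutoff at scale `R`. The
gradient has two parts. The one with the derivative of the step disappears in the limit, because `F
[]` avoids the band around `-1` where that derivative lives. The one with the gradient of the cutoff
is `O(1/R)` times the `L²` norm. In `C * 6 * K` the factor `6` counts three directions and the `2`
of `abs_lowerStep_le`. -/
theorem eLpNorm_cutoff_mul_lowerStep_le : ∃ C : NNReal, ∀ (k : ℕ) (φ : ℕ → R3 → ℝ)
    (F : List (Fin 3) → R3 → ℝ), 1 ≤ k → IsApprox k φ F →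
    (∀ᵐ x, Tendsto (fun n => φ n x) atTop (𝓝 (F [] x))) → ∀ R c : ℝ, 1 ≤ R → 0 < c → c ≤ 1 / 2 →
    (∀ᵐ x, ‖x‖ ≤ 2 * R → c < |F [] x + 1|) →
    eLpNorm ({x | ‖x‖ ≤ R ∧ F [] x < -1}.indicator (1 : R3 → ℝ)) 6 volume ≤
      C * ENNReal.ofReal (1 / R) * eLpNorm (F []) 2 volume := by
  obtain ⟨C, hC⟩ := exists_eLpNorm_six_le
  obtain ⟨K, hK⟩ := exists_cutoff
  refine ⟨C * 6 * K, fun k φ F hk h hφ R c hR hc hc' hF => ?_⟩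
  obtain ⟨ζ, hζ, hζ1, hζR, hζ2, hζd⟩ := hK R hR
  obtain ⟨M, hM0, hM⟩ := exists_deriv_lowerStep_bound hc
  have hGc : Continuous (deriv (lowerStep c)) := (contDiff_lowerStep c).continuous_deriv (by simp)
  have hm : ∀ i : Fin 3, MemLp (F [i]) 2 volume := fun i => h.memLp [i] (by simpa using hk)
  have hφc : ∀ n, Continuous (φ n) := fun n => (h.test n).1.continuous
  let v : ℕ → R3 → ℝ := fun n x => lowerStep c (φ n x) * ζ x
  have hv : ∀ n, IsTest (v n) := fun n =>
    hζ.mul_left ((contDiff_lowerStep c).comp (h.test n).1)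
  have hdv : ∀ n i x, pd i (v n) x = lowerStep c (φ n x) * pd i ζ x +
      ζ x * (deriv (lowerStep c) (φ n x) * pd i (φ n) x) := by
    intro n i x
    have d1 : HasFDerivAt (fun x => lowerStep c (φ n x))
        (deriv (lowerStep c) (φ n x) • fderiv ℝ (φ n) x) x :=
      (((contDiff_lowerStep c).differentiable (by simp) _).hasDerivAt).comp_hasFDerivAt x
        ((h.test n).1.differentiable (by simp) x).hasFDerivAt
    have d2 := (hζ.1.differentiable (by simp) x).hasFDerivAt
    unfold pd
    have e : fderiv ℝ (v n) x = _ := (d1.mul d2).fderiv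
    rw [e]
    simp
  -- the part of the gradient with the derivative of the step tends to zero
  have hz : ∀ i, Tendsto (fun n => eLpNorm (fun x =>
      ζ x * (deriv (lowerStep c) (φ n x) * pd i (φ n) x)) 2 volume) atTop (𝓝 0) := by
    intro i
    -- The derivative of the approximant is split as `F [i]` plus an error tending to zero in `L²`;
    -- the `F [i]` term is handled by dominated convergence with majorant `M * F [i]`. The factor
    -- `M⁻¹ * M` is harmless: if `M = 0`, the derivative of the step vanishes identically.
    have t1 : Tendsto (fun n => eLpNorm (fun x =>
        ζ x * (deriv (lowerStep c) (φ n x) * (M⁻¹ * (M * F [i] x)))) 2 volume) atTop (𝓝 0) := by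
      refine tendsto_eLpNorm_two_of_dominated ((hm i).const_mul M) (fun n => ?_) (fun n => ?_) ?_
      · exact hζ.1.continuous.aestronglyMeasurable.mul
          ((hGc.comp (hφc n)).aestronglyMeasurable.mul (((hm i).1.const_mul M).const_mul M⁻¹))
      · refine ae_of_all _ fun x => ?_
        rcases hM0.eq_or_lt with h0 | h0
        · simp [← h0]
        rw [inv_mul_cancel_left₀ h0.ne', norm_mul, norm_mul, norm_mul, Real.norm_of_nonneg hM0]
        calc ‖ζ x‖ * (‖deriv (lowerStep c) (φ n x)‖ * ‖F [i] x‖) ≤ 1 * (M * ‖F [i] x‖) := by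
              gcongr
              exacts [hζ1 x, hM _]
          _ = _ := one_mul _
      · filter_upwards [hφ, hF] with x hx hx'
        by_cases hxR : ‖x‖ ≤ 2 * R
        · have := (hGc.tendsto (F [] x)).comp hx
          rw [deriv_lowerStep_eq_zero hc (hx' hxR)] at this
          simpa using (this.mul_const (M⁻¹ * (M * F [i] x))).const_mul (ζ x)
        · rw [hζ2 x (not_le.1 hxR).le]
          simp
    have t2 : Tendsto (fun n => ENNReal.ofReal M *
        eLpNorm (fun x => pd i (φ n) x - F [i] x) 2 volume) atTop (𝓝 0) := by
      simpa [pdList] using ENNReal.Tendsto.const_mul (a := ENNReal.ofReal M)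
        (h.tendsto [i] (by simpa using hk)) (Or.inr ENNReal.ofReal_ne_top)
    have t3 := t1.add t2
    rw [add_zero] at t3
    refine tendsto_of_tendsto_of_tendsto_of_le_of_le tendsto_const_nhds t3 (fun _ => zero_le)
      fun n => ?_
    have m1 : AEStronglyMeasurable (fun x =>
        ζ x * (deriv (lowerStep c) (φ n x) * (M⁻¹ * (M * F [i] x)))) volume :=
      hζ.1.continuous.aestronglyMeasurable.mul
          ((hGc.comp (hφc n)).aestronglyMeasurable.mul (((hm i).1.const_mul M).const_mul M⁻¹))
    have m2 : AEStronglyMeasurable (fun x =>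
        ζ x * (deriv (lowerStep c) (φ n x) * (pd i (φ n) x - F [i] x))) volume :=
      hζ.1.continuous.aestronglyMeasurable.mul
          ((hGc.comp (hφc n)).aestronglyMeasurable.mul
            ((((h.test n).pd i).1.continuous.aestronglyMeasurable).sub (hm i).1))
    calc _ = eLpNorm ((fun x => ζ x * (deriv (lowerStep c) (φ n x) * (M⁻¹ * (M * F [i] x)))) +
          fun x => ζ x * (deriv (lowerStep c) (φ n x) * (pd i (φ n) x - F [i] x))) 2 volume := by
          congr 1
          funext x
          rcases hM0.eq_or_lt with h0 | h0
          · have : deriv (lowerStep c) (φ n x) = 0 := by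
              have := hM (φ n x)
              rw [← h0] at this
              exact norm_le_zero_iff.1 this
            simp [this]
          · simp only [Pi.add_apply, inv_mul_cancel_left₀ h0.ne']
            ring
      _ ≤ _ := eLpNorm_add_le m1 m2 (by norm_num)
      _ ≤ _ := by
          gcongr
          have := eLpNorm_le_mul_eLpNorm_of_ae_le_mul (p := 2) (μ := (volume : Measure R3))
            (f := fun x => ζ x * (deriv (lowerStep c) (φ n x) * (pd i (φ n) x - F [i] x)))
            (g := fun x => pd i (φ n) x - F [i] x) (c := M) (ae_of_all _ fun x => by
              rw [norm_mul, norm_mul]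
              calc ‖ζ x‖ * (‖deriv (lowerStep c) (φ n x)‖ * ‖pd i (φ n) x - F [i] x‖) ≤
                  1 * (M * ‖pd i (φ n) x - F [i] x‖) := by
                    gcongr
                    exacts [hζ1 x, hM _]
                _ = _ := one_mul _)
          exact this
  have hKR : (0 : ℝ) ≤ K / R := by positivity
  have hstep : ∀ n i, eLpNorm (fun x => lowerStep c (φ n x) * pd i ζ x) 2 volume ≤
      ENNReal.ofReal (2 * (K / R)) * eLpNorm (φ n) 2 volume := by
    intro n i
    refine eLpNorm_le_mul_eLpNorm_of_ae_le_mul (ae_of_all _ fun x => ?_) _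
    rw [norm_mul]
    calc _ ≤ ‖2 * φ n x‖ * (K / R) :=
          mul_le_mul (abs_lowerStep_le hc hc' _) (hζd i x) (norm_nonneg _) (norm_nonneg _)
      _ = _ := by
          rw [norm_mul, Real.norm_of_nonneg zero_le_two]
          ring
  have hφb : ∀ n, eLpNorm (φ n) 2 volume ≤ eLpNorm (fun x => φ n x - F [] x) 2 volume +
      eLpNorm (F []) 2 volume := by
    intro n
    refine le_trans (le_of_eq ?_) (eLpNorm_add_le
      (((h.test n).memLp 2).sub (h.memLp [] (by simp))).1 (h.memLp [] (by simp)).1 (by norm_num))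
    congr 1
    funext x
    simp
  have hvn : ∀ n, eLpNorm (v n) 6 volume ≤ C * ∑ i : Fin 3, (ENNReal.ofReal (2 * (K / R)) *
      (eLpNorm (fun x => φ n x - F [] x) 2 volume + eLpNorm (F []) 2 volume) + eLpNorm (fun x =>
        ζ x * (deriv (lowerStep c) (φ n x) * pd i (φ n) x)) 2 volume) := by
    intro n
    refine (hC (v n) ((hv n).1.of_le (by simp)) (hv n).2).trans ?_
    gcongr with i
    have e : pd i (v n) = (fun x => lowerStep c (φ n x) * pd i ζ x) + fun x =>
        ζ x * (deriv (lowerStep c) (φ n x) * pd i (φ n) x) := funext (hdv n i)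
    rw [e]
    refine (eLpNorm_add_le ?_ ?_ (by norm_num)).trans (add_le_add_left
      ((hstep n i).trans (mul_le_mul_right (hφb n) _)) _)
    · exact (((contDiff_lowerStep c).continuous.comp (hφc n)).mul
        (hζ.pd i).1.continuous).aestronglyMeasurable
    · exact (hζ.1.continuous.mul ((hGc.comp (hφc n)).mul
        ((h.test n).pd i).1.continuous)).aestronglyMeasurable
  have hφn : Tendsto (fun n => eLpNorm (fun x => φ n x - F [] x) 2 volume +
      eLpNorm (F []) 2 volume) atTop (𝓝 (eLpNorm (F []) 2 volume)) := by
    simpa [pdList] using (h.tendsto [] (by simp)).add_const (eLpNorm (F []) 2 volume)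
  have hlim : Tendsto (fun n => C * ∑ i : Fin 3, (ENNReal.ofReal (2 * (K / R)) *
      (eLpNorm (fun x => φ n x - F [] x) 2 volume + eLpNorm (F []) 2 volume) + eLpNorm (fun x =>
        ζ x * (deriv (lowerStep c) (φ n x) * pd i (φ n) x)) 2 volume)) atTop
      (𝓝 (C * ∑ i : Fin 3, (ENNReal.ofReal (2 * (K / R)) * eLpNorm (F []) 2 volume + 0))) :=
    ENNReal.Tendsto.const_mul (tendsto_finsetSum _ fun i _ =>
      (ENNReal.Tendsto.const_mul hφn (Or.inr ENNReal.ofReal_ne_top)).add (hz i))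
      (Or.inr ENNReal.coe_ne_top)
  have hvlim : ∀ᵐ x, Tendsto (fun n => v n x) atTop (𝓝 (lowerStep c (F [] x) * ζ x)) := by
    filter_upwards [hφ] with x hx
    exact (((contDiff_lowerStep c).continuous.tendsto _).comp hx).mul_const _
  -- Fatou transfers the bound to the step of `F []`, which together with the cutoff dominates the
  -- indicator of the negative phase.
  have hfatou := Lp.eLpNorm_lim_le_liminf_eLpNorm (p := 6)
    (fun n => (hv n).1.continuous.aestronglyMeasurable) _ hvlim
  calc _ ≤ eLpNorm (fun x => lowerStep c (F [] x) * ζ x) 6 volume := by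
        refine eLpNorm_mono_ae ?_
        filter_upwards [hF] with x hx
        by_cases hxs : x ∈ {x | ‖x‖ ≤ R ∧ F [] x < -1}
        · have hx1 : ‖x‖ ≤ 2 * R := by linarith [hxs.1]
          have h2 := hx hx1
          rw [abs_of_neg (by linarith [hxs.2])] at h2
          rw [Set.indicator_of_mem hxs, hζR x hxs.1, lowerStep_eq_one hc (by linarith)]
          simp
        · rw [Set.indicator_of_notMem hxs, norm_zero]
          exact norm_nonneg _
    _ ≤ _ := hfatou
    _ ≤ _ := (liminf_le_liminf (Eventually.of_forall hvn)).trans (le_of_eq hlim.liminf_eq)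
    _ = _ := by
        rw [Finset.sum_const, Finset.card_univ, Fintype.card_fin, add_zero, nsmul_eq_mul,
          show (2 * ((K : ℝ) / R)) = (2 : ℝ) * K * (1 / R) by ring,
          ENNReal.ofReal_mul (by positivity), ENNReal.ofReal_mul (by positivity)]
        simp only [ENNReal.ofReal_coe_nnreal, ENNReal.ofReal_ofNat]
        push_cast
        ring

/-- A conformal factor `u ∈ 1 + H¹` that is locally bounded away from zero is positive. -/
theorem ae_pos_of_memH {k : ℕ} {ρ : ℝ} (hρ : ρ ≤ -(3 / 2)) (hk : 1 ≤ k) {u : R3 → ℝ}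
    (hu : MemH k ρ (fun x => u x - 1))
    (hb : ∀ R : ℝ, ∃ c > 0, ∀ᵐ x, ‖x‖ ≤ R → c ≤ |u x|) : ∀ᵐ x, 0 < u x := by
  obtain ⟨φ', F, h', hF⟩ := hu.exists_isApprox hρ
  obtain ⟨φ, h, hφ⟩ := h'.exists_ae_tendsto
  obtain ⟨C, hC⟩ := eLpNorm_cutoff_mul_lowerStep_le
  have hb' : ∀ R : ℝ, ∃ c > 0, c ≤ 1 / 2 ∧ ∀ᵐ x, ‖x‖ ≤ R → c < |F [] x + 1| := by
    intro R
    obtain ⟨c, hc, h1⟩ := hb R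
    -- Halving `c` makes the inequality strict, and the cap `1/2` is what `abs_lowerStep_le` needs.
    -- The shift by one appears since `F []` represents `u - 1`.
    refine ⟨min (c / 2) (1 / 2), by positivity, min_le_right _ _, ?_⟩
    filter_upwards [h1, hF] with x hx hx2 hxR
    rw [hx2, sub_add_cancel]
    exact (min_le_left _ _).trans_lt (by linarith [hx hxR])
  have hm := h.memLp [] (by simp)
  have hnull : ∀ R₀ : ℕ, ∀ᵐ x, ¬ (‖x‖ ≤ R₀ ∧ F [] x < -1) := by
    intro R₀
    have hms : NullMeasurableSet {x | ‖x‖ ≤ R₀ ∧ F [] x < -1} volume :=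
      (measurableSet_le measurable_norm measurable_const).nullMeasurableSet.inter
        (nullMeasurableSet_lt hm.1.aemeasurable aemeasurable_const)
    -- The set inside the fixed ball `R₀` is measured with ever larger cutoff scales `n + R₀ + 1`,
    -- and the bound tends to zero. The width of the avoided band may shrink with the scale, since
    -- the constant does not depend on it.
    have hle : ∀ n : ℕ, eLpNorm ({x | ‖x‖ ≤ R₀ ∧ F [] x < -1}.indicator (1 : R3 → ℝ)) 6 volume ≤
        C * ENNReal.ofReal (1 / ((n : ℝ) + (R₀ + 1))) * eLpNorm (F []) 2 volume := by
      intro n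
      obtain ⟨c, hc, hc', h2⟩ := hb' (2 * ((n : ℝ) + (R₀ + 1)))
      have hR : (1 : ℝ) ≤ (n : ℝ) + (R₀ + 1) := by
        have := Nat.cast_nonneg (α := ℝ) n
        have := Nat.cast_nonneg (α := ℝ) R₀
        linarith
      refine le_trans (eLpNorm_mono fun x => ?_) (hC k φ F hk h hφ _ c hR hc hc' h2)
      have hs : {x | ‖x‖ ≤ R₀ ∧ F [] x < -1} ⊆ {x | ‖x‖ ≤ (n : ℝ) + (R₀ + 1) ∧ F [] x < -1} := by
        intro y hy
        have := hy.1
        have := Nat.cast_nonneg (α := ℝ) n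
        exact ⟨by linarith, hy.2⟩
      exact norm_indicator_le_of_subset hs _ _
    have ht : Tendsto (fun n : ℕ => C * ENNReal.ofReal (1 / ((n : ℝ) + (R₀ + 1))) *
        eLpNorm (F []) 2 volume) atTop (𝓝 0) := by
      have t0 : Tendsto (fun n : ℕ => 1 / ((n : ℝ) + (R₀ + 1))) atTop (𝓝 0) :=
        (tendsto_natCast_atTop_atTop.atTop_add tendsto_const_nhds).const_div_atTop 1
      have t1 := ENNReal.tendsto_ofReal t0
      rw [ENNReal.ofReal_zero] at t1
      have t2 := ENNReal.Tendsto.mul_const (b := eLpNorm (F []) 2 volume)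
        (ENNReal.Tendsto.const_mul (a := C) t1 (Or.inr ENNReal.coe_ne_top)) (Or.inr hm.2.ne)
      simpa using t2
    have h0 : eLpNorm ({x | ‖x‖ ≤ R₀ ∧ F [] x < -1}.indicator (1 : R3 → ℝ)) 6 volume = 0 :=
      le_antisymm (ge_of_tendsto' ht hle) zero_le
    rw [eLpNorm_eq_zero_iff (aestronglyMeasurable_one.indicator₀ hms) (by norm_num)] at h0
    filter_upwards [h0] with x hx hxs
    rw [Set.indicator_of_mem (show x ∈ {x | ‖x‖ ≤ R₀ ∧ F [] x < -1} from hxs)] at hx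
    simp at hx
  have hne : ∀ n : ℕ, ∀ᵐ x, ‖x‖ ≤ n → u x ≠ 0 := by
    intro n
    obtain ⟨c, hc, h1⟩ := hb n
    filter_upwards [h1] with x hx hxn h0
    have := hx hxn
    rw [h0, abs_zero] at this
    linarith
  filter_upwards [ae_all_iff.2 hnull, ae_all_iff.2 hne, hF] with x h1 h2 h3
  obtain ⟨n, hn⟩ := exists_nat_ge ‖x‖
  have h4 := h1 n
  rw [h3] at h4
  rcases lt_trichotomy (u x) 0 with h5 | h5 | h5
  · exact absurd ⟨hn, by linarith⟩ h4
  · exact absurd h5 (h2 n hn)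
  · exact h5

/-! ### Kerr-Schild data in vector notation -/

/-- The function `r̃` of the Kerr-Schild coordinates centred at the origin, with axis `a`. -/
def kerrRadius (w a : Fin 3 → ℝ) : ℝ :=
  Real.sqrt ((w ⬝ᵥ w - a ⬝ᵥ a + Real.sqrt ((w ⬝ᵥ w - a ⬝ᵥ a) ^ 2 + 4 * (a ⬝ᵥ w) ^ 2)) / 2)

/-- The spatial part of the Kerr-Schild 1-form. -/
def kerrVec (w a : Fin 3 → ℝ) : Fin 3 → ℝ :=
  (kerrRadius w a ^ 2 + a ⬝ᵥ a)⁻¹ •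
    (kerrRadius w a • w + w ⨯₃ a + ((a ⬝ᵥ w) / kerrRadius w a) • a)

/-- The amplitude of the Kerr-Schild perturbation of mass one. -/
def kerrAmp (w a : Fin 3 → ℝ) : ℝ :=
  2 * kerrRadius w a ^ 3 / (kerrRadius w a ^ 4 + (a ⬝ᵥ w) ^ 2)

/-- The spatial part of a boost of velocity `v`. -/
def boostSpace (v : R3) (ξ : Fin 3 → ℝ) : Fin 3 → ℝ :=
  ξ + (lorentzFactor v ^ 2 / (1 + lorentzFactor v) * (v.ofLp ⬝ᵥ ξ)) • v.ofLp

/-- The pull-back of the Kerr-Schild 1-form to the boosted time slice. -/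
def kerrForm (v : R3) (w a ξ : Fin 3 → ℝ) : ℝ :=
  lorentzFactor v * (v.ofLp ⬝ᵥ ξ) + kerrVec w a ⬝ᵥ boostSpace v ξ

/-- For a rotation the adjugate equals the transpose, so every entry equals its own cofactor; this
is the identity to be proved, written in components. -/
theorem mulVec_crossProduct {R : Matrix (Fin 3) (Fin 3) ℝ} (h : Rᵀ * R = 1) (hd : R.det = 1)
    (u w : Fin 3 → ℝ) : R *ᵥ (u ⨯₃ w) = (R *ᵥ u) ⨯₃ (R *ᵥ w) := by
  have hadj : R.adjugate = Rᵀ := by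
    have h1 : R.adjugate * R = 1 := by rw [Matrix.adjugate_mul, hd, one_smul]
    have h2 : R * Rᵀ = 1 := mul_eq_one_comm.1 h
    calc R.adjugate = R.adjugate * (R * Rᵀ) := by rw [h2, mul_one]
      _ = Rᵀ := by rw [← mul_assoc, h1, one_mul]
  have e : ∀ i j, R j i = R.adjugate i j := fun i j => by rw [hadj]; rfl
  rw [Matrix.adjugate_fin_three] at e
  have e00 := e 0 0
  have e01 := e 0 1
  have e02 := e 0 2
  have e10 := e 1 0
  have e11 := e 1 1
  have e12 := e 1 2
  have e20 := e 2 0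
  have e21 := e 2 1
  have e22 := e 2 2
  simp at e00 e01 e02 e10 e11 e12 e20 e21 e22
  ext i
  fin_cases i <;> simp [Matrix.mulVec, dotProduct, Fin.sum_univ_three, cross_apply]
  · linear_combination (u 1 * w 2 - u 2 * w 1) * e00 + (u 2 * w 0 - u 0 * w 2) * e10 +
      (u 0 * w 1 - u 1 * w 0) * e20
  · linear_combination (u 1 * w 2 - u 2 * w 1) * e01 + (u 2 * w 0 - u 0 * w 2) * e11 +
      (u 0 * w 1 - u 1 * w 0) * e21
  · linear_combination (u 1 * w 2 - u 2 * w 1) * e02 + (u 2 * w 0 - u 0 * w 2) * e12 +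
      (u 0 * w 1 - u 1 * w 0) * e22

theorem dotProduct_self_eq_norm_sq (a : R3) : a.ofLp ⬝ᵥ a.ofLp = ‖a‖ ^ 2 := by
  rw [EuclideanSpace.norm_sq_eq]
  simp [dotProduct, sq]

section Coordinates

variable {R : Matrix (Fin 3) (Fin 3) ℝ} {a : R3}

theorem dotProduct_axis (hR : R *ᵥ ![0, 0, ‖a‖] = a.ofLp) (w : Fin 3 → ℝ) :
    a.ofLp ⬝ᵥ w = ‖a‖ * (Rᵀ *ᵥ w) 2 := by
  rw [← hR, dotProduct_comm, Matrix.dotProduct_mulVec, ← Matrix.mulVec_transpose]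
  simp [dotProduct, Fin.sum_univ_three, mul_comm]

theorem ksRadius_rotated (h : Rᵀ * R = 1) (hR : R *ᵥ ![0, 0, ‖a‖] = a.ofLp) (t : ℝ)
    (w : Fin 3 → ℝ) : ksRadius ‖a‖ (Fin.cons t (Rᵀ *ᵥ w)) = kerrRadius w a.ofLp := by
  have h2 : R * Rᵀ = 1 := mul_eq_one_comm.1 h
  have hn : (Rᵀ *ᵥ w) ⬝ᵥ (Rᵀ *ᵥ w) = w ⬝ᵥ w := by
    rw [Matrix.dotProduct_mulVec, ← Matrix.mulVec_transpose, Matrix.transpose_transpose,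
      Matrix.mulVec_mulVec, h2, Matrix.one_mulVec]
  rw [kerrRadius, ksRadius, dotProduct_axis hR w, ← hn, dotProduct_self_eq_norm_sq a]
  have e : (Fin.cons t (Rᵀ *ᵥ w) : Spacetime) 1 ^ 2 + (Fin.cons t (Rᵀ *ᵥ w) : Spacetime) 2 ^ 2 +
      (Fin.cons t (Rᵀ *ᵥ w) : Spacetime) 3 ^ 2 = (Rᵀ *ᵥ w) ⬝ᵥ (Rᵀ *ᵥ w) := by
    rw [dotProduct, Fin.sum_univ_three, ← sq, ← sq, ← sq]
    rfl
  have e3 : (Fin.cons t (Rᵀ *ᵥ w) : Spacetime) 3 = (Rᵀ *ᵥ w) 2 := rfl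
  rw [e3] at e
  simp only [e3, e, mul_pow, ← mul_assoc]

/-- In the rotated frame the Kerr–Schild form involves only `X`, the cross product with `|a| ∂₃` and
a multiple of `|a| ∂₃`, all equivariant under rotations. The result depends on the rotation only
through `a`, and not on the time `t`, since the metric is stationary. -/
theorem ksForm_rotated (h : Rᵀ * R = 1) (hd : R.det = 1) (hR : R *ᵥ ![0, 0, ‖a‖] = a.ofLp) (t : ℝ)
    (w : Fin 3 → ℝ) : ksForm ‖a‖ (Fin.cons t (Rᵀ *ᵥ w)) ᵥ* spaceMatrix Rᵀ =
      Fin.cons 1 (kerrVec w a.ofLp) := by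
  have h2 : R * Rᵀ = 1 := mul_eq_one_comm.1 h
  obtain ⟨X, hX⟩ : ∃ X, X = Rᵀ *ᵥ w := ⟨_, rfl⟩
  have hw : w = R *ᵥ X := by rw [hX, Matrix.mulVec_mulVec, h2, Matrix.one_mulVec]
  have hk : ksForm ‖a‖ (Fin.cons t X) = Fin.cons 1
      ((kerrRadius w a.ofLp ^ 2 + ‖a‖ ^ 2)⁻¹ • (kerrRadius w a.ofLp • X + X ⨯₃ ![0, 0, ‖a‖] +
        (‖a‖ * X 2 / kerrRadius w a.ofLp) • ![0, 0, ‖a‖])) := by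
    have hr : ksRadius ‖a‖ (Fin.cons t X) = kerrRadius w a.ofLp := by
      rw [hX, ksRadius_rotated h hR]
    unfold ksForm
    rw [hr]
    generalize kerrRadius w a.ofLp = r
    have e1 : (Fin.cons t X : Spacetime) 1 = X 0 := rfl
    have e2 : (Fin.cons t X : Spacetime) 2 = X 1 := rfl
    have e3 : (Fin.cons t X : Spacetime) 3 = X 2 := rfl
    ext i
    simp only [e1, e2, e3]
    refine Fin.cases rfl (fun i => ?_) i
    rw [Fin.cons_succ]
    fin_cases i
    · simp [cross_apply, div_eq_inv_mul, mul_comm, Matrix.vecHead]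
    · simp [cross_apply, div_eq_inv_mul, mul_comm, Matrix.vecHead, Matrix.vecTail]
      ring
    · simp [cross_apply, Matrix.vecHead, Matrix.vecTail]
      by_cases h0 : r = 0
      · simp [h0]
      · have : r ^ 2 + ‖a‖ ^ 2 ≠ 0 := by positivity
        field_simp
  rw [← hX, hk]
  have hv : kerrVec w a.ofLp = R *ᵥ ((kerrRadius w a.ofLp ^ 2 + ‖a‖ ^ 2)⁻¹ •
      (kerrRadius w a.ofLp • X + X ⨯₃ ![0, 0, ‖a‖] +
        (‖a‖ * X 2 / kerrRadius w a.ofLp) • ![0, 0, ‖a‖])) := by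
    rw [Matrix.mulVec_smul, Matrix.mulVec_add, Matrix.mulVec_add, Matrix.mulVec_smul,
      Matrix.mulVec_smul, mulVec_crossProduct h hd, hR, ← hw, kerrVec, dotProduct_axis hR w, ← hX,
      dotProduct_self_eq_norm_sq]
  rw [hv]
  generalize (kerrRadius w a.ofLp ^ 2 + ‖a‖ ^ 2)⁻¹ • (kerrRadius w a.ofLp • X +
    X ⨯₃ ![0, 0, ‖a‖] + (‖a‖ * X 2 / kerrRadius w a.ofLp) • ![0, 0, ‖a‖]) = Y
  ext i
  refine Fin.cases ?_ (fun i => ?_) i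
  · simp [Matrix.vecMul, dotProduct, Fin.sum_univ_succ, spaceMatrix]
  · rw [Fin.cons_succ]
    fin_cases i <;>
    simp [Matrix.vecMul, Matrix.mulVec, dotProduct, Fin.sum_univ_succ, spaceMatrix] <;>
    ring

end Coordinates

theorem spaceMatrix_mulVec_cons (R : Matrix (Fin 3) (Fin 3) ℝ) (t : ℝ) (w : Fin 3 → ℝ) :
    spaceMatrix R *ᵥ (Fin.cons t w : Spacetime) = Fin.cons t (R *ᵥ w) := by
  ext i
  refine Fin.cases ?_ (fun i => ?_) i
  · simp [Matrix.mulVec, dotProduct, Fin.sum_univ_succ, spaceMatrix]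
  · rw [Fin.cons_succ]
    fin_cases i <;>
    simp [Matrix.mulVec, dotProduct, Fin.sum_univ_succ, spaceMatrix]

theorem kerrCoordInv_atTimeZero (p : KerrParam) (x : R3) :
    ∃ t, kerrCoordInv p (atTimeZero x) =
      Fin.cons t ((axisRotation p.a)ᵀ *ᵥ (boostSpace p.v x.ofLp - p.y.ofLp)) := by
  refine ⟨lorentzFactor p.v * (p.v.ofLp ⬝ᵥ x.ofLp), ?_⟩
  rw [kerrCoordInv, ← spaceMatrix_mulVec_cons]
  congr 1
  have hl : lorentzFactor (-p.v) = lorentzFactor p.v := by simp [lorentzFactor]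
  ext i
  refine Fin.cases ?_ (fun i => ?_) i
  · simp [boost, atTimeZero, dotProduct, Fin.sum_univ_succ, hl]
    ring
  · have e : ∀ z : R3, atTimeZero z i.succ = z i := fun z => rfl
    rw [Fin.cons_succ, Pi.sub_apply, e]
    fin_cases i <;>
    simp [boost, atTimeZero, dotProduct, Fin.sum_univ_succ, hl, boostSpace] <;> ring

theorem spaceMatrix_minkowski {R : Matrix (Fin 3) (Fin 3) ℝ} (h : R * Rᵀ = 1) :
    (spaceMatrix Rᵀ)ᵀ * minkowski * spaceMatrix Rᵀ = minkowski := by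
  have e : ∀ i j, (R * Rᵀ) i j = (1 : Matrix (Fin 3) (Fin 3) ℝ) i j := fun i j => by rw [h]
  simp only [Matrix.mul_apply, Fin.sum_univ_three, Matrix.transpose_apply] at e
  ext i j
  have e00 := e 0 0
  have e01 := e 0 1
  have e02 := e 0 2
  have e10 := e 1 0
  have e11 := e 1 1
  have e12 := e 1 2
  have e20 := e 2 0
  have e21 := e 2 1
  have e22 := e 2 2
  simp at e00 e01 e02 e10 e11 e12 e20 e21 e22
  fin_cases i <;> fin_cases j <;>
    simp [minkowski, Matrix.mul_apply, Fin.sum_univ_four, Matrix.diagonal_apply, spaceMatrix] <;>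
    assumption

theorem kerrJacobian_minkowski {p : KerrParam} (hv : ‖p.v‖ < 1) :
    (kerrJacobian p)ᵀ * minkowski * kerrJacobian p = minkowski := by
  have h2 := mul_eq_one_comm.1 (axisRotation_spec p.a).1
  have hv' : ‖-p.v‖ < 1 := by rwa [norm_neg]
  rw [kerrJacobian, Matrix.transpose_mul]
  calc _ = (boost (-p.v))ᵀ * ((spaceMatrix (axisRotation p.a)ᵀ)ᵀ * minkowski *
        spaceMatrix (axisRotation p.a)ᵀ) * boost (-p.v) := by simp only [Matrix.mul_assoc]
    _ = minkowski := by rw [spaceMatrix_minkowski h2, boost_minkowski hv']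

/-- Without mass the Kerr–Schild metric is Minkowski, which the Lorentz change of coordinates
preserves, whatever the remaining parameters are. -/
theorem kerrMetric'_of_mass_zero {p : KerrParam} (hv : ‖p.v‖ < 1) (hm : p.m = 0) (x : Spacetime) :
    kerrMetric' p x = minkowski := by
  rw [kerrMetric', kerrMetric, hm]
  simp only [mul_zero, zero_mul, zero_div, zero_smul, add_zero]
  exact kerrJacobian_minkowski hv

theorem minkowski_succ (i j : Fin 3) :
    minkowski i.succ j.succ = (1 : Matrix (Fin 3) (Fin 3) ℝ) i j := by
  fin_cases i <;> fin_cases j <;> simp [minkowski]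

theorem kerrG_of_mass_zero {p : KerrParam} (hv : ‖p.v‖ < 1) (hm : p.m = 0) (x : R3) :
    kerrG p x = 1 := by
  ext i j
  simp only [kerrG, Matrix.of_apply, kerrMetric'_of_mass_zero hv hm, minkowski_succ]

theorem kerrPi_of_mass_zero {p : KerrParam} (hv : ‖p.v‖ < 1) (hm : p.m = 0) (x : R3) :
    kerrPi p x = 0 := by
  have hM : kerrMetric' p = fun _ => minkowski := funext (kerrMetric'_of_mass_zero hv hm)
  have hK : kerrK p = 0 := by
    funext x
    ext i j
    have h1 : ∀ μ ν (f : ℝ), pd4 μ (fun _ => f) ν = 0 := fun μ ν f => by simp [pd4]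
    simp only [kerrK, Matrix.of_apply, hM, lieDeriv4]
    have h2 : ∀ σ, unitNormal (fun _ => minkowski) σ = fun _ => -minkowski⁻¹ σ 0 /
      Real.sqrt (-minkowski⁻¹ 0 0) := fun σ => rfl
    simp only [h2, h1]
    simp
  simp [kerrPi, hK, trG]

/-- The Jacobian preserves the Minkowski part, so only the pulled-back rank-one term remains. The
boost contributes the term `γ v · ξ`, coming from the time component `1` of the null form. All later
asymptotics start from this closed formula. -/
theorem kerrG_sub_one_apply {p : KerrParam} (hv : ‖p.v‖ < 1) (x : R3) (i j : Fin 3) :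
    (kerrG p x - 1) i j =
      p.m * kerrAmp (boostSpace p.v x.ofLp - p.y.ofLp) p.a.ofLp *
        kerrForm p.v (boostSpace p.v x.ofLp - p.y.ofLp) p.a.ofLp (Pi.single i 1) *
        kerrForm p.v (boostSpace p.v x.ofLp - p.y.ofLp) p.a.ofLp (Pi.single j 1) := by
  obtain ⟨hR, hd, hRa⟩ := axisRotation_spec p.a
  obtain ⟨t, ht⟩ := kerrCoordInv_atTimeZero p x
  obtain ⟨w, hw⟩ : ∃ w, w = boostSpace p.v x.ofLp - p.y.ofLp := ⟨_, rfl⟩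
  rw [← hw] at ht ⊢
  have hform : ∀ i : Fin 3, (ksForm ‖p.a‖ (kerrCoordInv p (atTimeZero x)) ᵥ* kerrJacobian p) i.succ =
      kerrForm p.v w p.a.ofLp (Pi.single i 1) := by
    intro i
    rw [ht, kerrJacobian, ← Matrix.vecMul_vecMul, ksForm_rotated hR hd hRa]
    have hl : lorentzFactor (-p.v) = lorentzFactor p.v := by simp [lorentzFactor]
    unfold kerrForm
    generalize kerrVec w p.a.ofLp = k
    fin_cases i <;>
    simp [boost, Matrix.vecMul, dotProduct, Fin.sum_univ_succ, hl, boostSpace] <;> ring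
  have hamp : 2 * p.m * ksRadius ‖p.a‖ (kerrCoordInv p (atTimeZero x)) ^ 3 /
      (ksRadius ‖p.a‖ (kerrCoordInv p (atTimeZero x)) ^ 4 +
        ‖p.a‖ ^ 2 * kerrCoordInv p (atTimeZero x) 3 ^ 2) = p.m * kerrAmp w p.a.ofLp := by
    rw [ht, ksRadius_rotated hR hRa, kerrAmp, dotProduct_axis hRa, mul_pow]
    have e3 : (Fin.cons t ((axisRotation p.a)ᵀ *ᵥ w) : Spacetime) 3 =
      ((axisRotation p.a)ᵀ *ᵥ w) 2 := rfl
    rw [e3]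
    ring
  rw [Matrix.sub_apply, kerrG, Matrix.of_apply, kerrMetric', kerrMetric, hamp, Matrix.mul_add,
    Matrix.add_mul, kerrJacobian_minkowski hv, Matrix.mul_smul, Matrix.smul_mul,
    Matrix.mul_vecMulVec, Matrix.vecMulVec_mul, Matrix.mulVec_transpose, Matrix.add_apply,
    minkowski_succ, Matrix.smul_apply, Matrix.vecMulVec_apply, hform, hform, smul_eq_mul]
  ring

/-! ### The boost -/

theorem boostSpace_add (v : R3) (ξ η : Fin 3 → ℝ) :
    boostSpace v (ξ + η) = boostSpace v ξ + boostSpace v η := by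
  ext i
  simp only [boostSpace, dotProduct_add, Pi.add_apply, Pi.smul_apply, smul_eq_mul]
  ring

theorem boostSpace_smul (v : R3) (t : ℝ) (ξ : Fin 3 → ℝ) :
    boostSpace v (t • ξ) = t • boostSpace v ξ := by
  ext i
  simp only [boostSpace, dotProduct_smul, Pi.add_apply, Pi.smul_apply, smul_eq_mul]
  ring

theorem dotProduct_boostSpace (v : R3) (ξ η : Fin 3 → ℝ) :
    ξ ⬝ᵥ boostSpace v η = boostSpace v ξ ⬝ᵥ η := by
  simp only [boostSpace, dotProduct_add, add_dotProduct, dotProduct_smul, smul_dotProduct,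
    smul_eq_mul, dotProduct_comm ξ v.ofLp]
  ring

/-- The spatial block `B` of a boost is symmetric with `B² = 1 + γ² v ⊗ v`. Hence `B` does not
decrease lengths and is injective. -/
theorem boostSpace_dotProduct_self {v : R3} (hv : ‖v‖ < 1) (ξ : Fin 3 → ℝ) :
    boostSpace v ξ ⬝ᵥ boostSpace v ξ = ξ ⬝ᵥ ξ + (lorentzFactor v * (v.ofLp ⬝ᵥ ξ)) ^ 2 := by
  have h := lorentzFactor_sq hv
  have hp := lorentzFactor_pos hv
  have hvv : v.ofLp ⬝ᵥ v.ofLp = v 0 ^ 2 + v 1 ^ 2 + v 2 ^ 2 := by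
    simp [dotProduct, Fin.sum_univ_three, sq]
  simp only [boostSpace, dotProduct_add, add_dotProduct, dotProduct_smul, smul_dotProduct,
    smul_eq_mul, dotProduct_comm ξ v.ofLp, hvv]
  generalize v 0 ^ 2 + v 1 ^ 2 + v 2 ^ 2 = V at *
  generalize lorentzFactor v = γ at *
  have h1 : 1 + γ ≠ 0 := by positivity
  field_simp
  linear_combination -(v.ofLp ⬝ᵥ ξ) ^ 2 * γ ^ 2 * h

theorem dotProduct_self_pos {z : Fin 3 → ℝ} (hz : z ≠ 0) : 0 < z ⬝ᵥ z :=
  lt_of_le_of_ne (Finset.sum_nonneg fun _ _ => mul_self_nonneg _)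
    fun h => hz (dotProduct_self_eq_zero.1 h.symm)

theorem boostSpace_eq_zero {v : R3} (hv : ‖v‖ < 1) {ξ : Fin 3 → ℝ} (h : boostSpace v ξ = 0) :
    ξ = 0 := by
  by_contra h0
  have := boostSpace_dotProduct_self hv ξ
  rw [h, zero_dotProduct] at this
  nlinarith [dotProduct_self_pos h0, sq_nonneg (lorentzFactor v * (v.ofLp ⬝ᵥ ξ))]

theorem kerrForm_eq_sum (v : R3) (w a ξ : Fin 3 → ℝ) :
    kerrForm v w a ξ = ∑ i, ξ i * kerrForm v w a (Pi.single i 1) := by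
  simp only [kerrForm, dotProduct_boostSpace]
  simp only [dotProduct_single, mul_one]
  simp only [dotProduct, mul_add, Finset.sum_add_distrib, Finset.mul_sum]
  congr 1 <;> exact Finset.sum_congr rfl fun i _ => by ring

/-! ### Bounds on the Kerr-Schild perturbation -/

theorem kerrRadius_nonneg (w a : Fin 3 → ℝ) : 0 ≤ kerrRadius w a := Real.sqrt_nonneg _

theorem kerrRadius_arg_nonneg (w a : Fin 3 → ℝ) :
    0 ≤ (w ⬝ᵥ w - a ⬝ᵥ a + Real.sqrt ((w ⬝ᵥ w - a ⬝ᵥ a) ^ 2 + 4 * (a ⬝ᵥ w) ^ 2)) / 2 := by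
  have : |w ⬝ᵥ w - a ⬝ᵥ a| ≤ Real.sqrt ((w ⬝ᵥ w - a ⬝ᵥ a) ^ 2 + 4 * (a ⬝ᵥ w) ^ 2) :=
    Real.abs_le_sqrt (by nlinarith [sq_nonneg (a ⬝ᵥ w)])
  have := neg_abs_le (w ⬝ᵥ w - a ⬝ᵥ a)
  linarith

theorem kerrRadius_quartic (w a : Fin 3 → ℝ) : kerrRadius w a ^ 4 =
    (w ⬝ᵥ w - a ⬝ᵥ a) * kerrRadius w a ^ 2 + (a ⬝ᵥ w) ^ 2 := by
  have h1 : kerrRadius w a ^ 2 = _ := Real.sq_sqrt (kerrRadius_arg_nonneg w a)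
  have h2 := Real.sq_sqrt (show 0 ≤ (w ⬝ᵥ w - a ⬝ᵥ a) ^ 2 + 4 * (a ⬝ᵥ w) ^ 2 by positivity)
  rw [show kerrRadius w a ^ 4 = (kerrRadius w a ^ 2) ^ 2 by ring, h1]
  linear_combination h2 / 4

theorem le_kerrRadius_sq (w a : Fin 3 → ℝ) : w ⬝ᵥ w - a ⬝ᵥ a ≤ kerrRadius w a ^ 2 := by
  have h1 : kerrRadius w a ^ 2 = _ := Real.sq_sqrt (kerrRadius_arg_nonneg w a)
  have : |w ⬝ᵥ w - a ⬝ᵥ a| ≤ Real.sqrt ((w ⬝ᵥ w - a ⬝ᵥ a) ^ 2 + 4 * (a ⬝ᵥ w) ^ 2) :=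
    Real.abs_le_sqrt (by nlinarith [sq_nonneg (a ⬝ᵥ w)])
  have := le_abs_self (w ⬝ᵥ w - a ⬝ᵥ a)
  rw [h1]
  linarith

theorem kerrAmp_nonneg (w a : Fin 3 → ℝ) : 0 ≤ kerrAmp w a := by
  have := kerrRadius_nonneg w a
  unfold kerrAmp
  positivity

theorem kerrAmp_le {w a : Fin 3 → ℝ} (h : 0 < kerrRadius w a) :
    kerrAmp w a ≤ 2 / kerrRadius w a := by
  unfold kerrAmp
  rw [div_le_div_iff₀ (by positivity) h]
  nlinarith [sq_nonneg (a ⬝ᵥ w)]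

/-- The Kerr–Schild form is null with time component one, so its spatial part is a unit vector. In
components this is the quartic equation for the radius. -/
theorem kerrVec_dotProduct_self {w a : Fin 3 → ℝ} (h : 0 < kerrRadius w a) :
    kerrVec w a ⬝ᵥ kerrVec w a = 1 := by
  have hq := kerrRadius_quartic w a
  have ha : 0 ≤ a ⬝ᵥ a := Finset.sum_nonneg fun i _ => mul_self_nonneg _
  have h1 : kerrRadius w a ^ 2 + a ⬝ᵥ a ≠ 0 := by positivity
  unfold kerrVec
  generalize kerrRadius w a = r at *
  simp only [dotProduct, Fin.sum_univ_three, cross_apply, Pi.smul_apply, Pi.add_apply,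
    smul_eq_mul, Matrix.cons_val_zero, Matrix.cons_val_one, Matrix.cons_val] at *
  have h2 : r ≠ 0 := h.ne'
  field_simp
  linear_combination (-(a 0 * a 0 + a 1 * a 1 + a 2 * a 2 + r ^ 2)) * hq

theorem abs_kerrForm_le {w a : Fin 3 → ℝ} (h : 0 < kerrRadius w a) (v : R3) (ξ : Fin 3 → ℝ) :
    |kerrForm v w a ξ| ≤ |lorentzFactor v * (v.ofLp ⬝ᵥ ξ)| + ∑ i, |boostSpace v ξ i| := by
  refine (abs_add_le _ _).trans (add_le_add_right ?_ _)
  refine (Finset.abs_sum_le_sum_abs _ _).trans (Finset.sum_le_sum fun i _ => ?_)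
  rw [abs_mul]
  refine mul_le_of_le_one_left (abs_nonneg _) ?_
  have h1 : kerrVec w a i * kerrVec w a i ≤ 1 := by
    rw [← kerrVec_dotProduct_self h]
    exact Finset.single_le_sum (f := fun i => kerrVec w a i * kerrVec w a i)
      (fun i _ => mul_self_nonneg _) (Finset.mem_univ i)
  exact abs_le_one_iff_mul_self_le_one.2 h1

/-- The Kerr perturbation may be singular on the sphere where the cutoff starts, with growth at most
`t^(-1/2)` in the relative distance `t` outside it. Since `χ` vanishes at `1` and is Lipschitz on
`[1, 2]`, it compensates this growth. -/
theorem IsCutoff.exists_le_sqrt {χ : ℝ → ℝ} (hχ : IsCutoff χ) :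
    ∃ C : ℝ, 0 ≤ C ∧ ∀ t, 0 ≤ t → χ (1 + t) ≤ C * Real.sqrt t := by
  have hd : Differentiable ℝ χ := hχ.smooth.differentiable (by simp)
  obtain ⟨C, hC⟩ := (isCompact_Icc (a := (1 : ℝ)) (b := 2)).exists_bound_of_continuousOn
    (hχ.smooth.continuous_deriv (by simp)).continuousOn
  have hC0 : 0 ≤ C := (norm_nonneg _).trans (hC 1 ⟨le_rfl, by norm_num⟩)
  refine ⟨C + 1, by positivity, fun t ht => ?_⟩
  rcases le_total 1 t with h1 | h1
  · have h2 : 1 ≤ Real.sqrt t := Real.one_le_sqrt.2 h1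
    nlinarith [(hχ.mem_Icc (1 + t)).2]
  · have h2 := (convex_Icc (1 : ℝ) 2).norm_image_sub_le_of_norm_deriv_le
      (fun x _ => hd x) hC (x := 1) (y := 1 + t) ⟨le_rfl, by norm_num⟩
      ⟨by linarith, by linarith⟩
    rw [hχ.eq_zero 1 le_rfl, sub_zero, add_sub_cancel_left, Real.norm_of_nonneg ht,
      Real.norm_of_nonneg (hχ.mem_Icc _).1] at h2
    have h3 : t ≤ Real.sqrt t := Real.le_sqrt_of_sq_le (by nlinarith)
    have h4 := Real.sqrt_nonneg t
    nlinarith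

theorem norm_le_norm_boostSpace {v : R3} (hv : ‖v‖ < 1) (x : R3) :
    ‖x‖ ≤ ‖WithLp.toLp 2 (boostSpace v x.ofLp)‖ := by
  refine (pow_le_pow_iff_left₀ (norm_nonneg _) (norm_nonneg _) two_ne_zero).1 ?_
  rw [← dotProduct_self_eq_norm_sq, ← dotProduct_self_eq_norm_sq, boostSpace_dotProduct_self hv]
  nlinarith [sq_nonneg (lorentzFactor v * (v.ofLp ⬝ᵥ x.ofLp))]

/-- The radius at which the cutoff of the Kerr data starts. -/
def cutRadius (p : KerrParam) : ℝ := max (max (2 * ‖p.y‖) (2 * ‖p.a‖)) 3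

theorem cutRadius_pos (p : KerrParam) : 0 < cutRadius p :=
  lt_of_lt_of_le (by norm_num) (le_max_right _ _)

/-- With `λ` the cut radius, `|y|, |a| ≤ λ/2`, and boosts do not shorten vectors. Hence the squared
radius is at least `λ²((t + 1/2)² - 1/4) = λ²(t² + t) ≥ λ² t`. -/
theorem kerrRadius_lower_bound {p : KerrParam} (hv : ‖p.v‖ < 1) {x : R3} {t : ℝ} (ht : 0 ≤ t)
    (hx : ‖x‖ = cutRadius p * (1 + t)) : cutRadius p * Real.sqrt t ≤
      kerrRadius (boostSpace p.v x.ofLp - p.y.ofLp) p.a.ofLp := by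
  have hl := cutRadius_pos p
  have hy : 2 * ‖p.y‖ ≤ cutRadius p := (le_max_left _ _).trans (le_max_left _ _)
  have ha : 2 * ‖p.a‖ ≤ cutRadius p := (le_max_right _ _).trans (le_max_left _ _)
  have hw : ‖x‖ - ‖p.y‖ ≤ ‖WithLp.toLp 2 (boostSpace p.v x.ofLp - p.y.ofLp)‖ :=
    (sub_le_sub_right (norm_le_norm_boostSpace hv x) _).trans (norm_sub_norm_le _ p.y)
  have hww := dotProduct_self_eq_norm_sq (WithLp.toLp 2 (boostSpace p.v x.ofLp - p.y.ofLp))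
  have haa := dotProduct_self_eq_norm_sq p.a
  refine (pow_le_pow_iff_left₀ (by positivity) (kerrRadius_nonneg _ _) two_ne_zero).1
    (le_trans ?_ (le_kerrRadius_sq _ _))
  rw [mul_pow, Real.sq_sqrt ht, haa]
  simp only at hww
  rw [hww]
  have h1 : cutRadius p * (t + 1 / 2) ≤ ‖WithLp.toLp 2 (boostSpace p.v x.ofLp - p.y.ofLp)‖ := by
    linarith
  have h2 : (cutRadius p * (t + 1 / 2)) ^ 2 ≤
      ‖WithLp.toLp 2 (boostSpace p.v x.ofLp - p.y.ofLp)‖ ^ 2 :=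
    pow_le_pow_left₀ (by positivity) h1 2
  have h3 : ‖p.a‖ ^ 2 ≤ (cutRadius p / 2) ^ 2 :=
    pow_le_pow_left₀ (norm_nonneg _) (by linarith) 2
  nlinarith [sq_nonneg (cutRadius p * t)]

/-- The cut-off Kerr perturbation is bounded. -/
theorem exists_bound_chiP_mul_kerrG {χ : ℝ → ℝ} (hχ : IsCutoff χ) {p : KerrParam}
    (hv : ‖p.v‖ < 1) (hm : 0 ≤ p.m) : ∃ C : ℝ, ∀ x i j, |chiP χ p x * (kerrG p x - 1) i j| ≤ C := by
  obtain ⟨C, hC0, hC⟩ := hχ.exists_le_sqrt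
  let B : Fin 3 → ℝ := fun i => |lorentzFactor p.v * (p.v.ofLp ⬝ᵥ Pi.single i 1)| +
    ∑ l, |boostSpace p.v (Pi.single i 1) l|
  have hB0 : ∀ i, 0 ≤ B i := fun i => add_nonneg (abs_nonneg _) (Finset.sum_nonneg
    fun _ _ => abs_nonneg _)
  have hB1 : ∀ i, B i ≤ ∑ i, B i := fun i =>
    Finset.single_le_sum (fun i _ => hB0 i) (Finset.mem_univ i)
  have hl := cutRadius_pos p
  refine ⟨C * (p.m * (2 / cutRadius p)) * ((∑ i, B i) * ∑ i, B i), fun x i j => ?_⟩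
  have hS : 0 ≤ ∑ i, B i := Finset.sum_nonneg fun i _ => hB0 i
  rcases le_or_gt ‖x‖ (cutRadius p) with h | h
  · have : chiP χ p x = 0 := hχ.eq_zero _ ((div_le_one hl).2 h)
    rw [this, zero_mul, abs_zero]
    positivity
  obtain ⟨t, ht, hx⟩ : ∃ t, 0 < t ∧ ‖x‖ = cutRadius p * (1 + t) :=
    ⟨‖x‖ / cutRadius p - 1, by rw [sub_pos]; exact (one_lt_div hl).2 h, by field_simp; ring⟩
  have hchi : chiP χ p x ≤ C * Real.sqrt t := by
    have : chiP χ p x = χ (1 + t) := by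
      unfold chiP
      congr 1
      rw [hx]
      exact mul_div_cancel_left₀ _ hl.ne'
    rw [this]
    exact hC t ht.le
  have hchi0 : 0 ≤ chiP χ p x := (hχ.mem_Icc _).1
  have hst : 0 < Real.sqrt t := Real.sqrt_pos.2 ht
  have hr := kerrRadius_lower_bound hv ht.le hx
  have hr0 : 0 < kerrRadius (boostSpace p.v x.ofLp - p.y.ofLp) p.a.ofLp :=
    lt_of_lt_of_le (by positivity) hr
  have hamp : kerrAmp (boostSpace p.v x.ofLp - p.y.ofLp) p.a.ofLp ≤
      2 / (cutRadius p * Real.sqrt t) :=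
    (kerrAmp_le hr0).trans (div_le_div_of_nonneg_left zero_le_two (by positivity) hr)
  rw [kerrG_sub_one_apply hv, abs_mul, abs_mul, abs_mul, abs_mul, abs_of_nonneg hchi0,
    abs_of_nonneg hm, abs_of_nonneg (kerrAmp_nonneg _ _)]
  -- The amplitude is at most `2 / (λ √t)`, and its `√t` cancels against the one in the bound for
  -- the cutoff.
  calc _ ≤ (C * Real.sqrt t) * (p.m * (2 / (cutRadius p * Real.sqrt t)) * (∑ i, B i) *
        ∑ i, B i) := by
        have b1 := (abs_kerrForm_le hr0 p.v (Pi.single i 1)).trans (hB1 i)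
        have b2 := (abs_kerrForm_le hr0 p.v (Pi.single j 1)).trans (hB1 j)
        have hamp0 := kerrAmp_nonneg (boostSpace p.v x.ofLp - p.y.ofLp) p.a.ofLp
        gcongr
    _ = _ := by field_simp

theorem chiP_nonneg {χ : ℝ → ℝ} (hχ : IsCutoff χ) (p : KerrParam) (x : R3) : 0 ≤ chiP χ p x :=
  (hχ.mem_Icc _).1

theorem trace_kerrG_sub_one_nonneg {p : KerrParam} (hv : ‖p.v‖ < 1) (hm : 0 ≤ p.m) (x : R3) :
    0 ≤ (kerrG p x - 1).trace := by
  refine Finset.sum_nonneg fun i _ => ?_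
  rw [Matrix.diag_apply, kerrG_sub_one_apply hv, mul_assoc]
  exact mul_nonneg (mul_nonneg hm (kerrAmp_nonneg _ _)) (mul_self_nonneg _)

/-! ### Expansion of the Kerr metric along rays -/

/-- Under joint dilation of position and angular momentum parameter, the radius, the form and the
amplitude have degrees `1`, `0` and `-1`. This converts the expansion at infinity into one at `ε =
0`, with `y` and `a` replaced by `εy` and `εa`. -/
theorem kerrRadius_smul {t : ℝ} (ht : 0 < t) (w a : Fin 3 → ℝ) :
    kerrRadius (t • w) (t • a) = t * kerrRadius w a := by
  unfold kerrRadius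
  simp only [dotProduct_smul, smul_dotProduct, smul_eq_mul]
  rw [show (t * (t * w ⬝ᵥ w) - t * (t * a ⬝ᵥ a)) ^ 2 + 4 * (t * (t * a ⬝ᵥ w)) ^ 2 =
    (t ^ 2) ^ 2 * ((w ⬝ᵥ w - a ⬝ᵥ a) ^ 2 + 4 * (a ⬝ᵥ w) ^ 2) by ring,
    Real.sqrt_mul (by positivity), Real.sqrt_sq (by positivity),
    show (t * (t * w ⬝ᵥ w) - t * (t * a ⬝ᵥ a) + t ^ 2 *
      Real.sqrt ((w ⬝ᵥ w - a ⬝ᵥ a) ^ 2 + 4 * (a ⬝ᵥ w) ^ 2)) / 2 = t ^ 2 *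
      ((w ⬝ᵥ w - a ⬝ᵥ a + Real.sqrt ((w ⬝ᵥ w - a ⬝ᵥ a) ^ 2 + 4 * (a ⬝ᵥ w) ^ 2)) / 2) by ring,
    Real.sqrt_mul (by positivity), Real.sqrt_sq ht.le]

theorem kerrVec_smul {t : ℝ} (ht : 0 < t) (w a : Fin 3 → ℝ) :
    kerrVec (t • w) (t • a) = kerrVec w a := by
  have h0 := ht.ne'
  unfold kerrVec
  rw [kerrRadius_smul ht]
  generalize kerrRadius w a = r
  ext i
  simp only [Pi.smul_apply, Pi.add_apply, dotProduct_smul, smul_dotProduct, smul_eq_mul,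
    map_smul, LinearMap.smul_apply]
  rw [show (t * r) ^ 2 + t * (t * a ⬝ᵥ a) = t ^ 2 * (r ^ 2 + a ⬝ᵥ a) by ring,
    show t * (t * a ⬝ᵥ w) / (t * r) = t * (a ⬝ᵥ w / r) by field_simp, mul_inv]
  field_simp

theorem kerrAmp_smul {t : ℝ} (ht : 0 < t) (w a : Fin 3 → ℝ) :
    kerrAmp (t • w) (t • a) = t⁻¹ * kerrAmp w a := by
  have h0 := ht.ne'
  unfold kerrAmp
  rw [kerrRadius_smul ht]
  simp only [dotProduct_smul, smul_dotProduct, smul_eq_mul]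
  rw [show (t * kerrRadius w a) ^ 4 + (t * (t * a ⬝ᵥ w)) ^ 2 =
    t ^ 4 * (kerrRadius w a ^ 4 + (a ⬝ᵥ w) ^ 2) by ring,
    show 2 * (t * kerrRadius w a) ^ 3 = t ^ 4 * (t⁻¹ * (2 * kerrRadius w a ^ 3)) by field_simp,
    mul_div_mul_left _ _ (by positivity), mul_div_assoc]

/-- The rescaled Kerr perturbation along the ray of direction `s`, as a function of the inverse
distance `ε`, contracted with `ξ` and `η`. -/
def rayProfile (p : KerrParam) (s ξ η : Fin 3 → ℝ) (ε : ℝ) : ℝ :=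
  p.m * kerrAmp (boostSpace p.v s - ε • p.y.ofLp) (ε • p.a.ofLp) *
    kerrForm p.v (boostSpace p.v s - ε • p.y.ofLp) (ε • p.a.ofLp) ξ *
    kerrForm p.v (boostSpace p.v s - ε • p.y.ofLp) (ε • p.a.ofLp) η

theorem rayProfile_inv {p : KerrParam} (hv : ‖p.v‖ < 1) (s : R3) (ξ η : Fin 3 → ℝ) {N : ℝ}
    (hN : 0 < N) : rayProfile p s.ofLp ξ η N⁻¹ =
      N * ∑ i, ∑ j, (kerrG p (N • s) - 1) i j * ξ i * η j := by
  have e1 : boostSpace p.v (N • s).ofLp - p.y.ofLp =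
      N • (boostSpace p.v s.ofLp - N⁻¹ • p.y.ofLp) := by
    rw [smul_sub, smul_smul, mul_inv_cancel₀ hN.ne', one_smul, ← boostSpace_smul]
    rfl
  have e2 : p.a.ofLp = N • (N⁻¹ • p.a.ofLp) := by
    rw [smul_smul, mul_inv_cancel₀ hN.ne', one_smul]
  simp_rw [kerrG_sub_one_apply hv, e1]
  conv_rhs => rw [e2]
  simp_rw [kerrAmp_smul hN]
  have e3 : ∀ w a ξ, kerrForm p.v (N • w) (N • a) ξ = kerrForm p.v w a ξ := fun w a ξ => by
    unfold kerrForm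
    rw [kerrVec_smul hN]
  simp_rw [e3]
  rw [rayProfile, kerrForm_eq_sum _ _ _ ξ, kerrForm_eq_sum _ _ _ η, mul_assoc (_ * _),
    Finset.sum_mul_sum, Finset.mul_sum, Finset.mul_sum]
  refine Finset.sum_congr rfl fun i _ => ?_
  rw [Finset.mul_sum, Finset.mul_sum]
  refine Finset.sum_congr rfl fun j _ => ?_
  field_simp

section RayDerivative

variable {z y a : Fin 3 → ℝ}

theorem kerrRadius_zero_right : kerrRadius z 0 = Real.sqrt (z ⬝ᵥ z) := by
  have : 0 ≤ z ⬝ᵥ z := Finset.sum_nonneg fun i _ => mul_self_nonneg _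
  simp [kerrRadius, Real.sqrt_sq this]

theorem hasDerivAt_dotProduct_ray (z y a : Fin 3 → ℝ) :
    HasDerivAt (fun ε : ℝ => (ε • a) ⬝ᵥ (z - ε • y)) (a ⬝ᵥ z) 0 := by
  have : HasDerivAt (fun ε : ℝ => ε * (a ⬝ᵥ z) - ε ^ 2 * (a ⬝ᵥ y))
      (1 * (a ⬝ᵥ z) - 2 * 0 * (a ⬝ᵥ y)) 0 := by
    have h2 := (hasDerivAt_pow 2 (0 : ℝ))
    simp only [Nat.cast_ofNat, Nat.add_one_sub_one, pow_one] at h2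
    exact ((hasDerivAt_id' _).mul_const _).sub (h2.mul_const _)
  convert this using 1
  · funext ε
    simp only [dotProduct_sub, dotProduct_smul, smul_dotProduct, smul_eq_mul]
    ring
  · ring

/-- At `ε = 0` both square roots have positive arguments because `z ≠ 0`. The parameter `a` enters
the radius only at second order, so the derivative sees `y` alone. -/
theorem hasDerivAt_kerrRadius (hz : z ≠ 0) :
    HasDerivAt (fun ε : ℝ => kerrRadius (z - ε • y) (ε • a)) (-(z ⬝ᵥ y) / Real.sqrt (z ⬝ᵥ z)) 0 := by
  have h0 := dotProduct_self_pos hz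
  have hs : HasDerivAt (fun ε : ℝ => (z - ε • y) ⬝ᵥ (z - ε • y) - (ε • a) ⬝ᵥ (ε • a))
      (-2 * (z ⬝ᵥ y)) 0 := by
    have : HasDerivAt (fun ε : ℝ => z ⬝ᵥ z - 2 * (z ⬝ᵥ y) * ε + (y ⬝ᵥ y - a ⬝ᵥ a) * ε ^ 2)
        (0 - 2 * (z ⬝ᵥ y) * 1 + (y ⬝ᵥ y - a ⬝ᵥ a) * (2 * 0)) 0 := by
      have h2 := (hasDerivAt_pow 2 (0 : ℝ))
      simp only [Nat.cast_ofNat, Nat.add_one_sub_one, pow_one] at h2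
      exact ((hasDerivAt_const _ _).sub ((hasDerivAt_id' _).const_mul _)).add (h2.const_mul _)
    convert this using 1
    · funext ε
      simp only [dotProduct_sub, sub_dotProduct, dotProduct_smul, smul_dotProduct, smul_eq_mul,
        dotProduct_comm y z]
      ring
    · ring
  have ht := hasDerivAt_dotProduct_ray z y a
  have hq := ((hs.pow 2).add ((ht.pow 2).const_mul 4)).sqrt (by simp; exact hz)
  have hr := ((hs.add hq).div_const 2).sqrt (by
    simp [Real.sqrt_sq h0.le]; exact hz)
  refine hr.congr_deriv ?_
  simp [Real.sqrt_sq h0.le]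
  have : Real.sqrt (z ⬝ᵥ z) ≠ 0 := (Real.sqrt_pos.2 h0).ne'
  field_simp
  ring

theorem hasDerivAt_kerrAmp (hz : z ≠ 0) :
    HasDerivAt (fun ε : ℝ => kerrAmp (z - ε • y) (ε • a))
      (2 * (z ⬝ᵥ y) / Real.sqrt (z ⬝ᵥ z) ^ 3) 0 := by
  have h0 := dotProduct_self_pos hz
  have hp := Real.sqrt_pos.2 h0
  have hr := hasDerivAt_kerrRadius (y := y) (a := a) hz
  have ht := hasDerivAt_dotProduct_ray z y a
  have := ((hr.pow 3).const_mul 2).div ((hr.pow 4).add (ht.pow 2)) (by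
    simp [kerrRadius_zero_right]; exact hp.ne')
  refine this.congr_deriv ?_
  simp [kerrRadius_zero_right]
  field_simp
  ring

theorem kerrAmp_zero_right (hz : z ≠ 0) : kerrAmp z 0 = 2 / Real.sqrt (z ⬝ᵥ z) := by
  have hp := Real.sqrt_pos.2 (dotProduct_self_pos hz)
  simp only [kerrAmp, kerrRadius_zero_right, zero_dotProduct]
  field_simp
  ring

theorem kerrVec_zero_right (hz : z ≠ 0) : kerrVec z 0 = (Real.sqrt (z ⬝ᵥ z))⁻¹ • z := by
  have hp := Real.sqrt_pos.2 (dotProduct_self_pos hz)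
  ext i
  simp [kerrVec, kerrRadius_zero_right]
  field_simp

/-- The first two terms come from translating `z / |z|`. The rotation enters at first order only
through the cross product, which is the term that later reveals `a`. -/
theorem hasDerivAt_kerrVec (hz : z ≠ 0) (b : Fin 3 → ℝ) :
    HasDerivAt (fun ε : ℝ => kerrVec (z - ε • y) (ε • a) ⬝ᵥ b)
      (-(y ⬝ᵥ b) / Real.sqrt (z ⬝ᵥ z) + (z ⬝ᵥ b) * (z ⬝ᵥ y) / Real.sqrt (z ⬝ᵥ z) ^ 3 +
        (z ⨯₃ a) ⬝ᵥ b / Real.sqrt (z ⬝ᵥ z) ^ 2) 0 := by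
  have h0 := dotProduct_self_pos hz
  have hp := Real.sqrt_pos.2 h0
  have hr := hasDerivAt_kerrRadius (y := y) (a := a) hz
  have h2 := hasDerivAt_pow 2 (0 : ℝ)
  have h3 := hasDerivAt_pow 3 (0 : ℝ)
  have h1 := hasDerivAt_id' (0 : ℝ)
  have hden := (hr.pow 2).add (h2.mul_const (a ⬝ᵥ a))
  have hnum := ((hr.mul ((hasDerivAt_const (0 : ℝ) (z ⬝ᵥ b)).sub (h1.mul_const (y ⬝ᵥ b)))).add
    ((h1.mul_const ((z ⨯₃ a) ⬝ᵥ b)).sub (h2.mul_const ((y ⨯₃ a) ⬝ᵥ b)))).add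
    ((((h2.mul_const (a ⬝ᵥ z)).sub (h3.mul_const (a ⬝ᵥ y))).mul_const (a ⬝ᵥ b)).div hr (by
      simp [kerrRadius_zero_right]; exact hp.ne'))
  have := hnum.div hden (by simp [kerrRadius_zero_right]; exact hp.ne')
  refine (this.congr_deriv ?_).congr_of_eventuallyEq (Eventually.of_forall fun ε => ?_)
  · simp [kerrRadius_zero_right]
    field_simp
    ring
  · simp only [kerrVec, dotProduct_sub, dotProduct_smul, smul_dotProduct, smul_eq_mul,
      add_dotProduct, sub_dotProduct, map_sub, map_smul, LinearMap.sub_apply, LinearMap.smul_apply,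
      Pi.add_apply, Pi.sub_apply, Pi.mul_apply, Pi.div_apply, Pi.pow_apply]
    rw [inv_mul_eq_div]
    congr 1 <;> ring

end RayDerivative

/-! ### Recovering the parameters of Kerr data from the expansion along rays -/

/-- A function that is `o(ε²)` along `ε = 2^(-k)` has zero value and zero derivative at `0`; one
sequence suffices since the derivative is assumed to exist. -/
theorem eq_zero_of_tendsto_sq_mul {f : ℝ → ℝ} {f' : ℝ} (hf : HasDerivAt f f' 0)
    (h : Tendsto (fun k : ℕ => ((2 : ℝ) ^ k) ^ 2 * f ((2 : ℝ) ^ k)⁻¹) atTop (𝓝 0)) :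
    f 0 = 0 ∧ f' = 0 := by
  have he : Tendsto (fun k : ℕ => ((2 : ℝ) ^ k)⁻¹) atTop (𝓝 0) :=
    (tendsto_pow_atTop_atTop_of_one_lt one_lt_two).inv_tendsto_atTop
  have he' : Tendsto (fun k : ℕ => ((2 : ℝ) ^ k)⁻¹) atTop (𝓝[≠] 0) :=
    tendsto_nhdsWithin_iff.2 ⟨he, Eventually.of_forall fun k => by simp⟩
  have h1 : Tendsto (fun k : ℕ => (2 : ℝ) ^ k * f ((2 : ℝ) ^ k)⁻¹) atTop (𝓝 0) := by
    have := he.mul h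
    rw [mul_zero] at this
    refine this.congr fun k => ?_
    have : (2 : ℝ) ^ k ≠ 0 := by positivity
    field_simp
  have h2 : Tendsto (fun k : ℕ => f ((2 : ℝ) ^ k)⁻¹) atTop (𝓝 0) := by
    have := he.mul h1
    rw [mul_zero] at this
    refine this.congr fun k => ?_
    have : (2 : ℝ) ^ k ≠ 0 := by positivity
    field_simp
  have hf0 : f 0 = 0 := tendsto_nhds_unique (hf.continuousAt.tendsto.comp he) h2
  refine ⟨hf0, tendsto_nhds_unique (hf.tendsto_slope_zero.comp he') (h1.congr fun k => ?_)⟩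
  simp [hf0]

/-- The derivative of the boosted Kerr-Schild form along a ray. -/
def kerrFormDeriv (v : R3) (z y a ξ : Fin 3 → ℝ) : ℝ :=
  -(y ⬝ᵥ boostSpace v ξ) / Real.sqrt (z ⬝ᵥ z) +
    (z ⬝ᵥ boostSpace v ξ) * (z ⬝ᵥ y) / Real.sqrt (z ⬝ᵥ z) ^ 3 +
    (z ⨯₃ a) ⬝ᵥ boostSpace v ξ / Real.sqrt (z ⬝ᵥ z) ^ 2

theorem hasDerivAt_kerrForm {z y a : Fin 3 → ℝ} (hz : z ≠ 0) (v : R3) (ξ : Fin 3 → ℝ) :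
    HasDerivAt (fun ε : ℝ => kerrForm v (z - ε • y) (ε • a) ξ) (kerrFormDeriv v z y a ξ) 0 :=
  (hasDerivAt_kerrVec hz _).const_add _

theorem kerrForm_zero_right {z : Fin 3 → ℝ} (hz : z ≠ 0) (v : R3) (ξ : Fin 3 → ℝ) :
    kerrForm v z 0 ξ = lorentzFactor v * (v.ofLp ⬝ᵥ ξ) +
      (z ⬝ᵥ boostSpace v ξ) / Real.sqrt (z ⬝ᵥ z) := by
  rw [kerrForm, kerrVec_zero_right hz, smul_dotProduct, smul_eq_mul, inv_mul_eq_div]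

theorem rayProfile_zero {p : KerrParam} {s : Fin 3 → ℝ} (ξ η : Fin 3 → ℝ) :
    rayProfile p s ξ η 0 = p.m * kerrAmp (boostSpace p.v s) 0 * kerrForm p.v (boostSpace p.v s) 0 ξ *
      kerrForm p.v (boostSpace p.v s) 0 η := by
  simp [rayProfile]

/-- The derivative of the ray profile at infinity. -/
def rayDeriv (p : KerrParam) (z ξ η : Fin 3 → ℝ) : ℝ :=
  (p.m * (2 * (z ⬝ᵥ p.y.ofLp) / Real.sqrt (z ⬝ᵥ z) ^ 3) * kerrForm p.v z 0 ξ +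
    p.m * kerrAmp z 0 * kerrFormDeriv p.v z p.y.ofLp p.a.ofLp ξ) * kerrForm p.v z 0 η +
    p.m * kerrAmp z 0 * kerrForm p.v z 0 ξ * kerrFormDeriv p.v z p.y.ofLp p.a.ofLp η

theorem hasDerivAt_rayProfile (p : KerrParam) {s : Fin 3 → ℝ} (hs : boostSpace p.v s ≠ 0)
    (ξ η : Fin 3 → ℝ) :
    HasDerivAt (rayProfile p s ξ η) (rayDeriv p (boostSpace p.v s) ξ η) 0 := by
  have h := ((((hasDerivAt_kerrAmp (y := p.y.ofLp) (a := p.a.ofLp) hs).const_mul p.m).mul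
    (hasDerivAt_kerrForm (y := p.y.ofLp) (a := p.a.ofLp) hs p.v ξ)).mul
    (hasDerivAt_kerrForm (y := p.y.ofLp) (a := p.a.ofLp) hs p.v η))
  refine h.congr_deriv ?_
  simp [rayDeriv]

theorem continuous_boostSpace (v : R3) : Continuous fun s : R3 => boostSpace v s.ofLp := by
  unfold boostSpace
  refine continuous_pi fun i => ?_
  simp only [Pi.add_apply, Pi.smul_apply, smul_eq_mul, dotProduct]
  fun_prop

/-- Needed to evaluate the leading coefficient at a particular direction, although the asymptotics
are known only for almost every one. The condition `1 < ‖s‖` serves to stay away from the origin. -/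
theorem continuousOn_rayProfile_zero {p : KerrParam} (hv : ‖p.v‖ < 1) (ξ η : Fin 3 → ℝ) :
    ContinuousOn (fun s : R3 => rayProfile p s.ofLp ξ η 0) {s | 1 < ‖s‖} := by
  have hne : ∀ s ∈ {s : R3 | 1 < ‖s‖}, boostSpace p.v s.ofLp ≠ 0 := by
    intro s hs h
    have h1 := norm_le_norm_boostSpace hv s
    rw [h] at h1
    simp only [WithLp.toLp_zero, norm_zero] at h1
    have h2 : 1 < ‖s‖ := hs
    linarith
  have hsq : ∀ s ∈ {s : R3 | 1 < ‖s‖},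
      Real.sqrt (boostSpace p.v s.ofLp ⬝ᵥ boostSpace p.v s.ofLp) ≠ 0 :=
    fun s hs => (Real.sqrt_pos.2 (dotProduct_self_pos (hne s hs))).ne'
  have hc := continuous_boostSpace p.v
  have hd : ∀ b, Continuous fun s : R3 => boostSpace p.v s.ofLp ⬝ᵥ b :=
    fun b => hc.dotProduct continuous_const
  have hr : Continuous fun s : R3 => Real.sqrt (boostSpace p.v s.ofLp ⬝ᵥ boostSpace p.v s.ofLp) :=
    (hc.dotProduct hc).sqrt
  have hK : ∀ ξ, ContinuousOn (fun s : R3 => lorentzFactor p.v * (p.v.ofLp ⬝ᵥ ξ) +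
      (boostSpace p.v s.ofLp ⬝ᵥ boostSpace p.v ξ) /
        Real.sqrt (boostSpace p.v s.ofLp ⬝ᵥ boostSpace p.v s.ofLp)) {s | 1 < ‖s‖} :=
    fun ξ => continuousOn_const.add ((hd _).continuousOn.div hr.continuousOn hsq)
  refine (((continuousOn_const (c := p.m)).mul ((continuousOn_const (c := (2 : ℝ))).div
    hr.continuousOn hsq)).mul (hK ξ) |>.mul (hK η)).congr fun s hs => ?_
  simp only [rayProfile_zero, kerrAmp_zero_right (hne s hs), kerrForm_zero_right (hne s hs),
    Pi.mul_apply, Pi.div_apply]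

theorem eq_zero_of_ae_dotProduct_eq_zero {b : Fin 3 → ℝ}
    (h : ∀ᵐ s : R3, 1 < ‖s‖ → s.ofLp ⬝ᵥ b = 0) : b = 0 := by
  by_contra hb
  have hb' : WithLp.toLp 2 b ≠ (0 : R3) := fun h0 => hb (by simpa using congrArg WithLp.ofLp h0)
  have hn : 0 < ‖(WithLp.toLp 2 b : R3)‖ := norm_pos_iff.2 hb'
  have hc : Continuous fun s : R3 => s.ofLp ⬝ᵥ b :=
    (PiLp.continuous_ofLp 2 _).dotProduct continuous_const
  have hU : IsOpen {s : R3 | 1 < ‖s‖ ∧ s.ofLp ⬝ᵥ b ≠ 0} :=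
    (isOpen_lt continuous_const continuous_norm).inter (isOpen_ne_fun hc continuous_const)
  obtain ⟨s, hs, hs'⟩ := (Measure.dense_of_ae h).exists_mem_open hU
    ⟨(2 / ‖(WithLp.toLp 2 b : R3)‖) • WithLp.toLp 2 b, by
      constructor
      · rw [norm_smul, Real.norm_of_nonneg (by positivity), div_mul_cancel₀ _ hn.ne']
        norm_num
      · simp only [WithLp.ofLp_smul, smul_dotProduct, smul_eq_mul]
        exact mul_ne_zero (by positivity) (dotProduct_self_pos hb).ne'⟩
  exact hs'.2 (hs hs'.1)

theorem exists_orthogonal (a b : Fin 3 → ℝ) :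
    ∃ s : R3, ‖s‖ = 2 ∧ a ⬝ᵥ s.ofLp = 0 ∧ b ⬝ᵥ s.ofLp = 0 := by
  obtain ⟨u, hu, h1, h2⟩ : ∃ u : Fin 3 → ℝ, u ≠ 0 ∧ a ⬝ᵥ u = 0 ∧ b ⬝ᵥ u = 0 := by
    obtain ⟨u, hu, h⟩ := Matrix.exists_mulVec_eq_zero_iff.2
      (show (Matrix.of ![a, b, 0]).det = 0 from Matrix.det_eq_zero_of_row_eq_zero 2 fun _ => rfl)
    exact ⟨u, hu, congrFun h 0, congrFun h 1⟩
  have hu' : WithLp.toLp 2 u ≠ (0 : R3) := fun h0 => hu (by simpa using congrArg WithLp.ofLp h0)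
  have hn : 0 < ‖(WithLp.toLp 2 u : R3)‖ := norm_pos_iff.2 hu'
  refine ⟨(2 / ‖(WithLp.toLp 2 u : R3)‖) • WithLp.toLp 2 u, ?_, ?_, ?_⟩
  · rw [norm_smul, Real.norm_of_nonneg (by positivity), div_mul_cancel₀ _ hn.ne']
  · simp [h1]
  · simp [h2]

/-- By `boostSpace_dotProduct_self` the boosted length of `s` strictly exceeds `|γ v · s|`, so the
form does not vanish on the ray direction and may be divided out. -/
theorem kerrForm_self_pos {v : R3} (hv : ‖v‖ < 1) {s : Fin 3 → ℝ} (hs : s ≠ 0) :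
    0 < kerrForm v (boostSpace v s) 0 s := by
  have hz : boostSpace v s ≠ 0 := fun h => hs (boostSpace_eq_zero hv h)
  rw [kerrForm_zero_right hz, Real.div_sqrt]
  have h1 : |lorentzFactor v * (v.ofLp ⬝ᵥ s)| <
      Real.sqrt (boostSpace v s ⬝ᵥ boostSpace v s) := by
    refine Real.lt_sqrt_of_sq_lt ?_
    rw [sq_abs, boostSpace_dotProduct_self hv]
    linarith [dotProduct_self_pos hs]
  have := neg_abs_le (lorentzFactor v * (v.ofLp ⬝ᵥ s))
  linarith

/-- The derivative of a unit vector is orthogonal to it, and on the boosted ray the limiting unit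
vector is parallel to `boostSpace v s`. -/
theorem kerrFormDeriv_self {v : R3} {s y a : Fin 3 → ℝ} (hz : boostSpace v s ≠ 0) :
    kerrFormDeriv v (boostSpace v s) y a s = 0 := by
  have h0 := dotProduct_self_pos hz
  have hp := Real.sqrt_pos.2 h0
  have hsq := Real.sq_sqrt h0.le
  have hx : (boostSpace v s ⨯₃ a) ⬝ᵥ boostSpace v s = 0 := by
    rw [dotProduct_comm]
    exact dot_self_cross _ _
  unfold kerrFormDeriv
  rw [hx, dotProduct_comm y]
  generalize Real.sqrt (boostSpace v s ⬝ᵥ boostSpace v s) = r at *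
  rw [← hsq]
  field_simp
  ring

/-- The momentum `γv` determines `γ` through `γ² = 1 + |γv|²`, and then `v`. -/
theorem velocity_eq {v₁ v₂ : R3} (h₁ : ‖v₁‖ < 1) (h₂ : ‖v₂‖ < 1)
    (h : ∀ i, lorentzFactor v₁ * v₁ i = lorentzFactor v₂ * v₂ i) : v₁ = v₂ := by
  have e1 := lorentzFactor_sq h₁
  have e2 := lorentzFactor_sq h₂
  have p1 := lorentzFactor_pos h₁
  have p2 := lorentzFactor_pos h₂
  have hγ : lorentzFactor v₁ = lorentzFactor v₂ := by
    refine (pow_left_inj₀ p1.le p2.le two_ne_zero).1 ?_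
    linear_combination e1 - e2 + (lorentzFactor v₁ * v₁ 0 + lorentzFactor v₂ * v₂ 0) * h 0 +
      (lorentzFactor v₁ * v₁ 1 + lorentzFactor v₂ * v₂ 1) * h 1 +
      (lorentzFactor v₁ * v₁ 2 + lorentzFactor v₂ * v₂ 2) * h 2
  ext i
  have := h i
  rw [hγ] at this
  exact mul_left_cancel₀ p2.ne' this

theorem boostSpace_of_orthogonal {v : R3} {s : Fin 3 → ℝ} (h : v.ofLp ⬝ᵥ s = 0) :
    boostSpace v s = s := by
  simp [boostSpace, h]

theorem rayProfile_zero_of_orthogonal {p : KerrParam} {s : R3} (hs : ‖s‖ = 2)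
    (h : p.v.ofLp ⬝ᵥ s.ofLp = 0) (η : Fin 3 → ℝ) : rayProfile p s.ofLp s.ofLp η 0 =
      2 * p.m * (lorentzFactor p.v * (p.v.ofLp ⬝ᵥ η) + s.ofLp ⬝ᵥ η / 2) := by
  have hss : s.ofLp ⬝ᵥ s.ofLp = 4 := by rw [dotProduct_self_eq_norm_sq, hs]; norm_num
  have hz : s.ofLp ≠ 0 := fun h0 => by rw [h0, zero_dotProduct] at hss; norm_num at hss
  have h4 : Real.sqrt 4 = 2 := by
    rw [show (4 : ℝ) = 2 ^ 2 by norm_num]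
    exact Real.sqrt_sq (by norm_num)
  rw [rayProfile_zero, boostSpace_of_orthogonal h, kerrAmp_zero_right hz, kerrForm_zero_right hz,
    kerrForm_zero_right hz, dotProduct_boostSpace, dotProduct_boostSpace,
    boostSpace_of_orthogonal h, hss, h, h4]
  ring

/-- Cycling the triple product with an arbitrary `c` moves the vanishing onto `d × c`, tested
against almost every direction; `c = ∂₁, ∂₂` recover all components of `d`. -/
theorem eq_zero_of_crossProduct_eq_zero {v d : R3} (hv : ‖v‖ < 1)
    (h : ∀ᵐ s : R3, 1 < ‖s‖ → boostSpace v s.ofLp ⨯₃ d.ofLp = 0) : d = 0 := by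
  have h1 : ∀ c : Fin 3 → ℝ, d.ofLp ⨯₃ c = 0 := by
    intro c
    refine boostSpace_eq_zero hv (eq_zero_of_ae_dotProduct_eq_zero ?_)
    filter_upwards [h] with s hs hs1
    rw [dotProduct_boostSpace]
    have := hs hs1
    have e := triple_product_permutation (boostSpace v s.ofLp) d.ofLp c
    rw [e, triple_product_permutation, this, dotProduct_zero]
  have e0 := h1 ![1, 0, 0]
  have e1 := h1 ![0, 1, 0]
  simp [cross_apply] at e0 e1
  ext i
  fin_cases i
  · exact e1.2
  · exact e0.2
  · exact e0.1

/-- The Kerr parameters are determined by the metric up to `o(r⁻³)`. -/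
theorem kerrParam_eq_of_tendsto {p₁ p₂ : KerrParam} (hv₁ : ‖p₁.v‖ < 1) (hv₂ : ‖p₂.v‖ < 1)
    (H : ∀ᵐ s : R3, 1 < ‖s‖ → ∀ i j, Tendsto (fun k : ℕ => ((2 : ℝ) ^ k) ^ 3 *
      (kerrG p₁ ((2 : ℝ) ^ k • s) i j - kerrG p₂ ((2 : ℝ) ^ k • s) i j)) atTop (𝓝 0)) :
    p₁.m = p₂.m ∧ (0 < p₁.m → p₁ = p₂) := by
  have hne : ∀ {p : KerrParam}, ‖p.v‖ < 1 → ∀ {s : R3}, 1 < ‖s‖ → s.ofLp ≠ 0 := by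
    intro p _ s hs h
    have : s = 0 := by ext i; exact congrFun h i
    rw [this, norm_zero] at hs
    linarith
  have hz : ∀ {p : KerrParam}, ‖p.v‖ < 1 → ∀ {s : R3}, 1 < ‖s‖ → boostSpace p.v s.ofLp ≠ 0 :=
    fun hp _ hs h => hne hp hs (boostSpace_eq_zero hp h)
  have key : ∀ᵐ s : R3, 1 < ‖s‖ → ∀ ξ η : Fin 3 → ℝ,
      rayProfile p₁ s.ofLp ξ η 0 - rayProfile p₂ s.ofLp ξ η 0 = 0 ∧
      rayDeriv p₁ (boostSpace p₁.v s.ofLp) ξ η - rayDeriv p₂ (boostSpace p₂.v s.ofLp) ξ η = 0 := by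
    filter_upwards [H] with s hs hs1 ξ η
    refine eq_zero_of_tendsto_sq_mul ((hasDerivAt_rayProfile p₁ (hz hv₁ hs1) ξ η).sub
      (hasDerivAt_rayProfile p₂ (hz hv₂ hs1) ξ η)) ?_
    have ht := tendsto_finsetSum (Finset.univ : Finset (Fin 3)) fun i _ =>
      tendsto_finsetSum (Finset.univ : Finset (Fin 3)) fun j _ =>
        (hs hs1 i j).mul_const (ξ i * η j)
    simp only [zero_mul, Finset.sum_const_zero] at ht
    refine ht.congr fun k => ?_
    have hk : (0 : ℝ) < 2 ^ k := by positivity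
    simp only [Pi.sub_apply]
    rw [rayProfile_inv hv₁ s ξ η hk, rayProfile_inv hv₂ s ξ η hk, ← mul_sub,
      ← Finset.sum_sub_distrib, ← mul_assoc, Finset.mul_sum]
    refine Finset.sum_congr rfl fun i _ => ?_
    rw [← Finset.sum_sub_distrib, Finset.mul_sum]
    refine Finset.sum_congr rfl fun j _ => ?_
    rw [Matrix.sub_apply, Matrix.sub_apply]
    ring
  have hval : ∀ s : R3, 1 < ‖s‖ → ∀ ξ η, rayProfile p₁ s.ofLp ξ η 0 = rayProfile p₂ s.ofLp ξ η 0 := by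
    intro s hs ξ η
    have hU : IsOpen {s : R3 | 1 < ‖s‖} := isOpen_lt continuous_const continuous_norm
    refine Measure.eqOn_open_of_ae_eq (μ := (volume : Measure R3)) ?_ hU
      (continuousOn_rayProfile_zero hv₁ ξ η) (continuousOn_rayProfile_zero hv₂ ξ η) hs
    refine (ae_restrict_iff' hU.measurableSet).2 ?_
    filter_upwards [key] with s hs hs1
    exact sub_eq_zero.1 (hs hs1 ξ η).1
  -- In a direction orthogonal to both velocities the two boosts act trivially, so both leading
  -- coefficients become explicit. Taking `η = s₀` then gives the mass, and coordinate vectors `η`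
  -- give `γv`.
  obtain ⟨s₀, hs₀, ho₁, ho₂⟩ := exists_orthogonal p₁.v.ofLp p₂.v.ofLp
  have hval₀ : ∀ η : Fin 3 → ℝ,
      2 * p₁.m * (lorentzFactor p₁.v * (p₁.v.ofLp ⬝ᵥ η) + s₀.ofLp ⬝ᵥ η / 2) =
      2 * p₂.m * (lorentzFactor p₂.v * (p₂.v.ofLp ⬝ᵥ η) + s₀.ofLp ⬝ᵥ η / 2) := by
    intro η
    rw [← rayProfile_zero_of_orthogonal hs₀ ho₁, ← rayProfile_zero_of_orthogonal hs₀ ho₂]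
    exact hval s₀ (by rw [hs₀]; norm_num) _ _
  have hm : p₁.m = p₂.m := by
    have := hval₀ s₀.ofLp
    rw [ho₁, ho₂, dotProduct_self_eq_norm_sq, hs₀] at this
    linarith
  refine ⟨hm, fun hpos => ?_⟩
  have hv : p₁.v = p₂.v := by
    refine velocity_eq hv₁ hv₂ fun i => ?_
    have := hval₀ (Pi.single i 1)
    rw [← hm] at this
    have := mul_left_cancel₀ (by positivity) this
    simpa using this
  have hself : ∀ {p : KerrParam}, ‖p.v‖ < 1 → ∀ {s : R3}, 1 < ‖s‖ →
      rayDeriv p (boostSpace p.v s.ofLp) s.ofLp s.ofLp = p.m *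
        (2 * (boostSpace p.v s.ofLp ⬝ᵥ p.y.ofLp) /
          Real.sqrt (boostSpace p.v s.ofLp ⬝ᵥ boostSpace p.v s.ofLp) ^ 3) *
        kerrForm p.v (boostSpace p.v s.ofLp) 0 s.ofLp ^ 2 := by
    intro p hp s hs
    rw [rayDeriv, kerrFormDeriv_self (hz hp hs)]
    ring
  -- For `ξ = η = s` the derivative of the form vanishes and only that of the amplitude survives,
  -- which is proportional to `z · y` with `z` the boosted direction.
  have hy : p₁.y = p₂.y := by
    have h0 : boostSpace p₁.v (p₁.y.ofLp - p₂.y.ofLp) = 0 := by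
      refine eq_zero_of_ae_dotProduct_eq_zero ?_
      filter_upwards [key] with s hs hs1
      have h1 := (hs hs1 s.ofLp s.ofLp).2
      rw [hself hv₁ hs1, hself hv₂ hs1, ← hv, ← hm] at h1
      have hk := (kerrForm_self_pos hv₁ (hne hv₁ hs1)).ne'
      have hr := (Real.sqrt_pos.2 (dotProduct_self_pos (hz hv₁ hs1))).ne'
      have hm' := hpos.ne'
      field_simp at h1
      rw [mul_zero] at h1
      rw [dotProduct_boostSpace, dotProduct_sub]
      exact (mul_eq_zero.1 h1).resolve_left
        (mul_ne_zero (mul_ne_zero hm' two_ne_zero) (pow_ne_zero 2 hk))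
    have h1 := boostSpace_eq_zero hv₁ h0
    ext i
    exact sub_eq_zero.1 (congrFun h1 i)
  -- For `ξ = s` and `η` a coordinate vector, with `m`, `v`, `y` already equal, the two derivatives
  -- can differ only in the cross product `z × a`.
  have ha : p₁.a = p₂.a := by
    rw [← sub_eq_zero]
    refine eq_zero_of_crossProduct_eq_zero hv₁ ?_
    filter_upwards [key] with s hs hs1
    refine boostSpace_eq_zero hv₁ ?_
    ext i
    have h1 := (hs hs1 s.ofLp (Pi.single i 1)).2
    have hz₁ := hz hv₁ hs1
    simp only [rayDeriv, ← hv, ← hm, ← hy, kerrFormDeriv_self hz₁] at h1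
    have hk := (kerrForm_self_pos hv₁ (hne hv₁ hs1)).ne'
    have hr := (Real.sqrt_pos.2 (dotProduct_self_pos hz₁)).ne'
    have hA : kerrAmp (boostSpace p₁.v s.ofLp) 0 ≠ 0 := by
      rw [kerrAmp_zero_right hz₁]
      positivity
    have hc : p₁.m * kerrAmp (boostSpace p₁.v s.ofLp) 0 *
        kerrForm p₁.v (boostSpace p₁.v s.ofLp) 0 s.ofLp ≠ 0 :=
      mul_ne_zero (mul_ne_zero hpos.ne' hA) hk
    have h2 : kerrFormDeriv p₁.v (boostSpace p₁.v s.ofLp) p₁.y.ofLp p₁.a.ofLp (Pi.single i 1) =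
        kerrFormDeriv p₁.v (boostSpace p₁.v s.ofLp) p₁.y.ofLp p₂.a.ofLp (Pi.single i 1) := by
      refine mul_left_cancel₀ hc ?_
      linear_combination h1
    simp only [kerrFormDeriv] at h2
    have h3 := add_left_cancel h2
    rw [div_left_inj' (pow_ne_zero 2 hr), dotProduct_boostSpace, dotProduct_boostSpace,
      dotProduct_single, dotProduct_single, mul_one, mul_one] at h3
    rw [WithLp.ofLp_sub, map_sub, sub_eq_add_neg, boostSpace_add, ← neg_one_smul ℝ (_ ⨯₃ _),
      boostSpace_smul]
    simp [h3]
  exact KerrParam.ext hm hy ha hv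

/-! ### Decay along dyadic rays -/

theorem ae_smul_of_ae {P : R3 → Prop} (h : ∀ᵐ x, P x) {c : ℝ} (hc : c ≠ 0) :
    ∀ᵐ s : R3, P (c • s) := by
  rw [ae_iff] at h ⊢
  have := Measure.addHaar_preimage_smul (volume : Measure R3) hc {x | ¬ P x}
  rw [h, mul_zero] at this
  exact this

/-- By scaling, `∫ 2^(3k) h(2^k s)² ds = ∫ h²` for every `k`. The geometric factor makes the sum
over `k` integrable in `s`, so for almost every `s` the series converges and its terms tend to zero.
-/
theorem ae_tendsto_of_memLp {h : R3 → ℝ} (hh : MemLp h 2 volume) {δ : ℝ} (hδ : 0 < δ) :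
    ∀ᵐ s : R3, Tendsto (fun k : ℕ => ((2 : ℝ) ^ (-δ)) ^ k * (((2 : ℝ) ^ k) ^ 3 *
      h ((2 : ℝ) ^ k • s) ^ 2)) atTop (𝓝 0) := by
  have hint : Integrable (fun x => h x ^ 2) volume := hh.integrable_sq
  have hθ0 : (0 : ℝ) < 2 ^ (-δ) := Real.rpow_pos_of_pos two_pos _
  have hθ1 : (2 : ℝ) ^ (-δ) < 1 := Real.rpow_lt_one_of_one_lt_of_neg one_lt_two (by linarith)
  generalize (2 : ℝ) ^ (-δ) = θ at *
  let G : ℕ → R3 → ℝ := fun k s => θ ^ k * (((2 : ℝ) ^ k) ^ 3 * h ((2 : ℝ) ^ k • s) ^ 2)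
  have hG0 : ∀ k s, 0 ≤ G k s := fun k s => by positivity
  have hGint : ∀ k, Integrable (G k) volume := fun k =>
    ((hint.comp_smul (by positivity : (2 : ℝ) ^ k ≠ 0)).const_mul _).const_mul _
  have hGval : ∀ k, ∫ s, G k s = θ ^ k * ∫ x, h x ^ 2 := by
    intro k
    have hk : (0 : ℝ) < ((2 : ℝ) ^ k) ^ 3 := by positivity
    simp only [G]
    rw [integral_const_mul, integral_const_mul,
      Measure.integral_comp_smul volume (fun x => h x ^ 2) ((2 : ℝ) ^ k)]
    simp only [finrank_euclideanSpace, Fintype.card_fin, smul_eq_mul]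
    rw [abs_of_pos (inv_pos.2 hk), mul_inv_cancel_left₀ hk.ne']
  have hlint : ∀ k, ∫⁻ s, ENNReal.ofReal (G k s) = ENNReal.ofReal (θ ^ k * ∫ x, h x ^ 2) := by
    intro k
    rw [← hGval, ofReal_integral_eq_lintegral_ofReal (hGint k) (ae_of_all _ (hG0 k))]
  have hsum : ∫⁻ s, ∑' k, ENNReal.ofReal (G k s) ≠ ⊤ := by
    rw [lintegral_tsum fun k => (hGint k).1.aemeasurable.ennreal_ofReal]
    simp_rw [hlint]
    exact ((summable_geometric_of_lt_one hθ0.le hθ1).mul_right _).tsum_ofReal_ne_top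
  filter_upwards [ae_lt_top' (AEMeasurable.tsum
    fun k => (hGint k).1.aemeasurable.ennreal_ofReal) hsum] with s hs
  have ht := ENNReal.tendsto_atTop_zero_of_tsum_ne_top hs.ne
  have := (ENNReal.tendsto_toReal ENNReal.zero_ne_top).comp ht
  refine this.congr fun k => ?_
  exact ENNReal.toReal_ofReal (hG0 k s)

/-- As `q ≥ 3`, the weight at `2^k s` with `‖s‖ > 1` is at least `2^(k(3/2 + δ))`. Its square,
`2^(3k)` from the volume and the loss `2^(-2δk)` multiply to `2^(6k)`, the square of the claimed
rate. -/
theorem MemH.ae_tendsto {k q : ℕ} {δ : ℝ} {f : R3 → ℝ} (hf : MemH k (-q - δ) f) (hq : 3 ≤ q)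
    (hδ : 0 < δ) : ∀ᵐ s : R3, 1 < ‖s‖ →
      Tendsto (fun k : ℕ => ((2 : ℝ) ^ k) ^ 3 * f ((2 : ℝ) ^ k • s)) atTop (𝓝 0) := by
  obtain ⟨φ, F, -, h2, h3⟩ := hf
  have hm := (h3 [] (by simp)).1
  have hae : ∀ᵐ s : R3, ∀ k : ℕ, F [] ((2 : ℝ) ^ k • s) = f ((2 : ℝ) ^ k • s) :=
    ae_all_iff.2 fun k => ae_smul_of_ae h2 (by positivity)
  filter_upwards [hae, ae_tendsto_of_memLp hm (δ := 2 * δ) (by positivity)] with s hs ht hs1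
  have hq' : (3 : ℝ) ≤ q := by exact_mod_cast hq
  have hsq : Tendsto (fun k : ℕ => (((2 : ℝ) ^ k) ^ 3 * f ((2 : ℝ) ^ k • s)) ^ 2) atTop (𝓝 0) := by
    refine squeeze_zero (fun k => sq_nonneg _) (fun k => ?_) ht
    have hk1 : (1 : ℝ) ≤ 2 ^ k := one_le_pow₀ one_le_two
    have hk0 : (0 : ℝ) < 2 ^ k := by positivity
    rw [hs k, mul_pow, mul_pow _ (f _), ← mul_assoc, ← mul_assoc]
    refine mul_le_mul_of_nonneg_right ?_ (sq_nonneg _)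
    have hw : ((2 : ℝ) ^ k) ^ (3 / 2 + δ) ≤ sobolevWeight (-q - δ) 0 ((2 : ℝ) ^ k • s) := by
      unfold sobolevWeight
      have h1 : (2 : ℝ) ^ k ≤ 1 + ‖(2 : ℝ) ^ k • s‖ := by
        rw [norm_smul, Real.norm_of_nonneg hk0.le]
        nlinarith
      refine (Real.rpow_le_rpow hk0.le h1 (by positivity)).trans
        (Real.rpow_le_rpow_of_exponent_le (hk1.trans h1) ?_)
      push_cast
      linarith
    have hw2 := pow_le_pow_left₀ (Real.rpow_nonneg hk0.le _) hw 2
    have e : (((2 : ℝ) ^ (-(2 * δ))) ^ k) * ((2 : ℝ) ^ k) ^ 3 * (((2 : ℝ) ^ k) ^ (3 / 2 + δ)) ^ 2 =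
        (((2 : ℝ) ^ k) ^ 3) ^ 2 := by
      rw [← Real.rpow_natCast (2 ^ (-(2 * δ))), ← Real.rpow_mul zero_le_two, mul_comm (-(2 * δ)),
        Real.rpow_mul zero_le_two, Real.rpow_natCast]
      generalize (2 : ℝ) ^ k = t at *
      rw [← Real.rpow_natCast t 3, ← Real.rpow_natCast _ 2, ← Real.rpow_natCast _ 2,
        ← Real.rpow_mul hk0.le, ← Real.rpow_mul hk0.le, ← Real.rpow_add hk0, ← Real.rpow_add hk0]
      congr 1
      push_cast
      ring
    rw [← e]
    exact mul_le_mul_of_nonneg_left hw2 (by positivity)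
  have := hsq.sqrt
  rw [Real.sqrt_zero] at this
  refine (tendsto_zero_iff_abs_tendsto_zero _).2 (this.congr fun k => ?_)
  exact Real.sqrt_sq_eq_abs _

/-- Since `u⁴ - 1 = (u - 1)(u³ + u² + u + 1)` and the background `M` is bounded, the conformal
factor changes the background only by an error of the size of `u - 1`. -/
theorem tendsto_mul_conformal {a u M T : ℕ → ℝ} {C : ℝ} (ha : ∀ k, 1 ≤ a k)
    (hu : Tendsto (fun k => a k * (u k - 1)) atTop (𝓝 0)) (hM : ∀ k, |M k| ≤ C)
    (hT : Tendsto (fun k => a k * T k) atTop (𝓝 0)) :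
    Tendsto (fun k => a k * (u k ^ 4 * (M k + T k) - M k)) atTop (𝓝 0) := by
  have hT0 : Tendsto (fun k => |a k * (u k - 1)|) atTop (𝓝 0) := by simpa using hu.abs
  have h1 : Tendsto (fun k => u k - 1) atTop (𝓝 0) := by
    refine squeeze_zero_norm (fun k => ?_) hT0
    rw [Real.norm_eq_abs, abs_mul]
    exact le_mul_of_one_le_left (abs_nonneg _) ((ha k).trans (le_abs_self _))
  have hu1 : Tendsto u atTop (𝓝 1) := by simpa using h1.add_const 1
  have h2 : Tendsto (fun k => a k * (u k - 1) * (u k ^ 3 + u k ^ 2 + u k + 1)) atTop (𝓝 0) := by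
    simpa using hu.mul ((((hu1.pow 3).add (hu1.pow 2)).add hu1).add_const 1)
  have h3 : Tendsto (fun k => a k * (u k - 1) * (u k ^ 3 + u k ^ 2 + u k + 1) * M k) atTop
      (𝓝 0) := by
    have hb : Tendsto (fun k => |a k * (u k - 1) * (u k ^ 3 + u k ^ 2 + u k + 1)| * C) atTop
        (𝓝 0) := by simpa using h2.abs.mul_const C
    refine squeeze_zero_norm (fun k => ?_) hb
    rw [norm_mul, Real.norm_eq_abs, Real.norm_eq_abs]
    exact mul_le_mul_of_nonneg_left (hM k) (abs_nonneg _)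
  have h4 : Tendsto (fun k => u k ^ 4 * (a k * T k)) atTop (𝓝 0) := by
    simpa using (hu1.pow 4).mul hT
  have := h3.add h4
  rw [add_zero] at this
  exact this.congr fun k => by ring

/-! ### Uniqueness of the representation -/

/-- The background metric `e + χ_p (g_p - e)`. -/
def background (χ : ℝ → ℝ) (p : KerrParam) : TensorField :=
  fun x => 1 + chiP χ p x • (kerrG p x - 1)

theorem exists_bound_background {χ : ℝ → ℝ} (hχ : IsCutoff χ) {p : KerrParam}
    (hv : ‖p.v‖ < 1) (hm : 0 ≤ p.m) : ∃ C : ℝ, ∀ x i j, |background χ p x i j| ≤ C := by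
  obtain ⟨C, hC⟩ := exists_bound_chiP_mul_kerrG hχ hv hm
  refine ⟨1 + C, fun x i j => ?_⟩
  simp only [background, Matrix.add_apply, Matrix.smul_apply, smul_eq_mul]
  refine (abs_add_le _ _).trans (add_le_add ?_ (hC x i j))
  rw [Matrix.one_apply]
  split_ifs <;> simp

theorem three_le_trace_background {χ : ℝ → ℝ} (hχ : IsCutoff χ) {p : KerrParam}
    (hv : ‖p.v‖ < 1) (hm : 0 ≤ p.m) (x : R3) : 3 ≤ (background χ p x).trace := by
  rw [background, Matrix.trace_add, Matrix.trace_smul, Matrix.trace_one, Fintype.card_fin]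
  have := mul_nonneg (chiP_nonneg hχ p x) (trace_kerrG_sub_one_nonneg hv hm x)
  rw [smul_eq_mul]
  push_cast
  linarith

theorem chiP_eq_one {χ : ℝ → ℝ} (hχ : IsCutoff χ) {p : KerrParam} {x : R3}
    (hx : 2 * cutRadius p ≤ ‖x‖) : chiP χ p x = 1 :=
  hχ.eq_one _ ((le_div_iff₀ (cutRadius_pos p)).2 hx)

section

variable {q : ℕ} {δ : ℝ} {χ : ℝ → ℝ} {h : IdxA q → TensorField} {ϖ : IdxB q → TensorField}
  {g π : TensorField} {D D₁ D₂ : AnsatzData}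

theorem Represents.ae_tendsto (hD : Represents q δ χ h ϖ D g π) (hq : 3 ≤ q) (hδ : 0 < δ)
    (hχ : IsCutoff χ) (hh : ∀ a, IsAnnularTensor (h a)) :
    ∀ᵐ s : R3, 1 < ‖s‖ → ∀ i j, Tendsto (fun k : ℕ => ((2 : ℝ) ^ k) ^ 3 *
      (g ((2 : ℝ) ^ k • s) i j - kerrG D.p ((2 : ℝ) ^ k • s) i j)) atTop (𝓝 0) := by
  obtain ⟨C, hC⟩ := exists_bound_background hχ hD.boost_lt hD.mass_nonneg
  have hT : ∀ᵐ s : R3, ∀ i j, 1 < ‖s‖ → Tendsto (fun k : ℕ => ((2 : ℝ) ^ k) ^ 3 *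
      D.gTT ((2 : ℝ) ^ k • s) i j) atTop (𝓝 0) :=
    ae_all_iff.2 fun i => ae_all_iff.2 fun j => (hD.gTT_mem i j).ae_tendsto hq hδ
  have hA := isAnnularTensor_of_mem_correctorSpace hh hD.gCor_mem
  filter_upwards [hT, hD.u_mem.ae_tendsto hq hδ, ae_all_iff.2 fun k : ℕ =>
    ae_smul_of_ae hD.g_eq (c := (2 : ℝ) ^ k) (by positivity)] with s hs hu hg hs1 i j
  have hlim := tendsto_mul_conformal (M := fun k => background χ D.p ((2 : ℝ) ^ k • s) i j)
    (fun k => one_le_pow₀ (one_le_pow₀ one_le_two)) (hu hs1) (fun k => hC _ i j) (hs i j hs1)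
  have hnorm : Tendsto (fun k : ℕ => ‖(2 : ℝ) ^ k • s‖) atTop atTop := by
    have e : ∀ k : ℕ, ‖(2 : ℝ) ^ k • s‖ = (2 : ℝ) ^ k * ‖s‖ := fun k => by
      rw [norm_smul, Real.norm_of_nonneg (by positivity)]
    simp_rw [e]
    exact (tendsto_pow_atTop_atTop_of_one_lt one_lt_two).atTop_mul_const (by linarith)
  refine hlim.congr' ?_
  -- Far out the cutoff equals one and the corrector, supported in `r ≤ 10`, is absent.
  filter_upwards [hnorm.eventually_ge_atTop (2 * cutRadius D.p), hnorm.eventually_gt_atTop 10]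
    with k hk1 hk2
  have h1 := chiP_eq_one hχ hk1
  have h2 := hA.support ((2 : ℝ) ^ k • s) fun h => by linarith [h.2]
  have hB : background χ D.p ((2 : ℝ) ^ k • s) = kerrG D.p ((2 : ℝ) ^ k • s) := by
    rw [background, h1, one_smul, add_sub_cancel]
  have h3 := congrFun (congrFun (hg k) i) j
  rw [h2, add_zero] at h3
  change _ = (D.u _ ^ 4 • (background χ D.p ((2 : ℝ) ^ k • s) + D.gTT _)) i j at h3
  rw [hB, Matrix.smul_apply, Matrix.add_apply, smul_eq_mul] at h3
  rw [hB, h3]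

theorem Represents.ae_trace_eq (hD : Represents q δ χ h ϖ D g π) (ht : ∀ a x, (h a x).trace = 0) :
    ∀ᵐ x, (g x).trace = D.u x ^ 4 * (background χ D.p x).trace := by
  filter_upwards [hD.g_eq, hD.gTT_tt.trace] with x hx hT
  rw [hx, Matrix.trace_smul, Matrix.trace_add, Matrix.trace_add, hT,
    trace_eq_zero_of_mem_correctorSpace ht hD.gCor_mem, add_zero, add_zero, smul_eq_mul]
  rfl

theorem exists_trace_lower_bound (hg : Continuous g) (hpos : ∀ x, (g x).PosDef) (R : ℝ) :
    ∃ c > 0, ∀ x, ‖x‖ ≤ R → c ≤ (g x).trace := by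
  have hc : Continuous fun x => (g x).trace := hg.matrix_trace
  rcases lt_or_ge R 0 with hR | hR
  · exact ⟨1, one_pos, fun x hx => absurd (norm_nonneg x) (by linarith)⟩
  obtain ⟨x₀, -, h0⟩ := (isCompact_closedBall (0 : R3) R).exists_isMinOn
    ⟨0, by simpa using hR⟩ hc.continuousOn
  exact ⟨(g x₀).trace, (hpos x₀).trace_pos, fun x hx => h0 (by simpa using hx)⟩

theorem Represents.ae_pos (hD : Represents q δ χ h ϖ D g π) (hq : 3 ≤ q) (hδ : 0 < δ)
    (hχ : IsCutoff χ) (ht : ∀ a x, (h a x).trace = 0) (hg : Continuous g)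
    (hpos : ∀ x, (g x).PosDef) : ∀ᵐ x, 0 < D.u x := by
  have hq' : (3 : ℝ) ≤ q := by exact_mod_cast hq
  refine ae_pos_of_memH (by linarith) one_le_two hD.u_mem fun R => ?_
  obtain ⟨c, hc, hcR⟩ := exists_trace_lower_bound hg hpos R
  obtain ⟨C, hC⟩ := exists_bound_background hχ hD.boost_lt hD.mass_nonneg
  have hC' : ∀ x, (background χ D.p x).trace ≤ 3 * C := by
    intro x
    rw [Matrix.trace, Fin.sum_univ_three]
    have := fun i => (le_abs_self _).trans (hC x i i)
    simp only [Matrix.diag_apply]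
    linarith [this 0, this 1, this 2]
  have hC0 : 0 < 3 * C := by
    linarith [hC' 0, three_le_trace_background hχ hD.boost_lt hD.mass_nonneg 0]
  -- The trace identity bounds `u⁴` from below by `c / (3C)`; the cap at `1` allows passing to
  -- `|u|`, as `|u|⁴ ≤ |u|` when `|u| < 1`.
  refine ⟨min 1 (c / (3 * C)), by positivity, ?_⟩
  filter_upwards [hD.ae_trace_eq ht] with x hx hxR
  have h1 := hcR x hxR
  rw [hx] at h1
  have hu4 : 0 ≤ D.u x ^ 4 := by positivity
  have h2 : c / (3 * C) ≤ |D.u x| ^ 4 := by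
    rw [div_le_iff₀ hC0]
    have e : |D.u x| ^ 4 = D.u x ^ 4 := by
      rw [show 4 = 2 * 2 from rfl, pow_mul, sq_abs, ← pow_mul]
    rw [e]
    exact h1.trans (mul_le_mul_of_nonneg_left (hC' x) hu4)
  by_contra hlt
  push Not at hlt
  have h3 : |D.u x| < 1 := hlt.trans_le (min_le_left _ _)
  have h4 : |D.u x| < c / (3 * C) := hlt.trans_le (min_le_right _ _)
  have h5 : |D.u x| ^ 4 ≤ |D.u x| := pow_le_of_le_one (abs_nonneg _) h3.le (by norm_num)
  linarith

theorem Represents.kerrParam_eq (hD₁ : Represents q δ χ h ϖ D₁ g π)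
    (hD₂ : Represents q δ χ h ϖ D₂ g π) (hq : 3 ≤ q) (hδ : 0 < δ)
    (hχ : IsCutoff χ) (hh : ∀ a, IsAnnularTensor (h a)) :
    D₁.p.m = D₂.p.m ∧ (0 < D₁.p.m → D₁.p = D₂.p) := by
  refine kerrParam_eq_of_tendsto hD₁.boost_lt hD₂.boost_lt ?_
  filter_upwards [hD₁.ae_tendsto hq hδ hχ hh, hD₂.ae_tendsto hq hδ hχ hh] with s h1 h2 hs i j
  have := (h2 hs i j).sub (h1 hs i j)
  rw [sub_zero] at this
  exact this.congr fun k => by ring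

end

theorem background_eq_and_kerrPi_eq {χ : ℝ → ℝ} {p₁ p₂ : KerrParam} (hv₁ : ‖p₁.v‖ < 1)
    (hv₂ : ‖p₂.v‖ < 1) (h₁ : 0 ≤ p₁.m) (hm : p₁.m = p₂.m) (hp : 0 < p₁.m → p₁ = p₂) :
    background χ p₁ = background χ p₂ ∧
      ∀ x, chiP χ p₁ x • kerrPi p₁ x = chiP χ p₂ x • kerrPi p₂ x := by
  rcases h₁.eq_or_lt with h0 | h0
  · have h1 : p₁.m = 0 := h0.symm
    have h2 : p₂.m = 0 := by rw [← hm, h1]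
    constructor
    · funext x
      rw [background, background, kerrG_of_mass_zero hv₁ h1, kerrG_of_mass_zero hv₂ h2, sub_self,
        smul_zero, smul_zero]
    · intro x
      rw [kerrPi_of_mass_zero hv₁ h1, kerrPi_of_mass_zero hv₂ h2, smul_zero, smul_zero]
  · rw [hp h0]
    exact ⟨rfl, fun _ => rfl⟩

end

theorem proposition3p7 (q : ℕ) (hq : 3 ≤ q) (δ : ℝ) (hδ0 : 0 < δ) (hδ1 : δ < 1)
    (χ : ℝ → ℝ) (hχ : IsCutoff χ)
    (h : IdxA q → TensorField) (hh : IsMetricCorrectorFamily q h)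
    (ϖ : IdxB q → TensorField) (hϖ : IsMomentumCorrectorFamily q ϖ)
    (g π : TensorField) (hgπ : IsConstraintSolution g π)
    (D₁ D₂ : AnsatzData)
    (hD₁ : Represents q δ χ h ϖ D₁ g π) (hD₂ : Represents q δ χ h ϖ D₂ g π) :
    D₁.p.m = D₂.p.m ∧ (0 < D₁.p.m → D₁.p = D₂.p) ∧
    D₁.gTT =ᵐ[volume] D₂.gTT ∧ D₁.piTT =ᵐ[volume] D₂.piTT ∧
    D₁.gCor = D₂.gCor ∧ D₁.piCor = D₂.piCor ∧
    D₁.u =ᵐ[volume] D₂.u ∧ D₁.X =ᵐ[volume] D₂.X := by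
  have hq' : (3 : ℝ) ≤ q := by exact_mod_cast hq
  have hρ : -(q : ℝ) - δ ≤ -(3 / 2) := by linarith
  obtain ⟨hm, hp⟩ := hD₁.kerrParam_eq hD₂ hq hδ0 hχ hh.annular
  obtain ⟨hB, hPi⟩ := background_eq_and_kerrPi_eq (χ := χ) hD₁.boost_lt hD₂.boost_lt
    hD₁.mass_nonneg hm hp
  -- Equal backgrounds with nonzero trace give equal fourth powers, and positivity of both factors
  -- removes the sign ambiguity.
  have hu : ∀ᵐ x, D₁.u x = D₂.u x ∧ 0 < D₁.u x := by
    filter_upwards [hD₁.ae_trace_eq hh.trace, hD₂.ae_trace_eq hh.trace,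
      hD₁.ae_pos hq hδ0 hχ hh.trace hgπ.continuous hgπ.posDef,
      hD₂.ae_pos hq hδ0 hχ hh.trace hgπ.continuous hgπ.posDef] with x h1 h2 p1 p2
    refine ⟨?_, p1⟩
    rw [h1, hB] at h2
    have h3 := three_le_trace_background hχ hD₂.boost_lt hD₂.mass_nonneg x
    exact (pow_left_inj₀ p1.le p2.le four_ne_zero).1
      (mul_right_cancel₀ (by linarith : (background χ D₂.p x).trace ≠ 0) h2)
  have hsum : ∀ᵐ x, D₁.gTT x + D₁.gCor x = D₂.gTT x + D₂.gCor x := by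
    filter_upwards [hD₁.g_eq, hD₂.g_eq, hu] with x h1 h2 h3
    change g x = D₁.u x ^ 4 • (background χ D₁.p x + D₁.gTT x + D₁.gCor x) at h1
    change g x = D₂.u x ^ 4 • (background χ D₂.p x + D₂.gTT x + D₂.gCor x) at h2
    rw [h1, hB, h3.1, add_assoc, add_assoc] at h2
    have h4 : D₂.u x ^ 4 ≠ 0 := pow_ne_zero 4 (h3.1 ▸ h3.2).ne'
    exact add_left_cancel (smul_right_injective _ h4 h2)
  have hgCor : D₁.gCor = D₂.gCor :=
    metricCorrector_unique hh.annular hh.linInd hρ one_le_two hD₁.gTT_tt hD₂.gTT_tt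
      hD₁.gTT_mem hD₂.gTT_mem hD₁.gCor_mem hD₂.gCor_mem hsum
  have hpi : ∀ᵐ x, D₁.piTT x + D₁.piCor x + Le D₁.X x = D₂.piTT x + D₂.piCor x + Le D₂.X x := by
    filter_upwards [hD₁.pi_eq, hD₂.pi_eq] with x h1 h2
    rw [h1, hPi] at h2
    simp only [add_assoc] at h2 ⊢
    exact add_left_cancel h2
  obtain ⟨hpiCor, hX, hpiTT⟩ := momentum_unique hϖ.annular hϖ.linInd hρ one_le_two
    hD₁.piTT_tt hD₂.piTT_tt hD₁.piCor_mem hD₂.piCor_mem hD₁.piTT_mem hD₂.piTT_mem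
    hD₁.X_mem hD₂.X_mem hpi
  refine ⟨hm, hp, ?_, hpiTT, hgCor, hpiCor, hu.mono fun x hx => hx.1, hX⟩
  filter_upwards [hsum] with x hx
  rw [hgCor] at hx
  exact add_right_cancel hx
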